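/- Let $q$ be a power of a prime $p$. Let $F=\mathbb{F}_{q^2}$ (unitary case) or $F=\mathbb{F}_q$ (symplectic and orthogonal cases), write $\bar a=a^q$ for $a\in F$, and let $V$ be an $F$-vector space of finite dimension $n$. Let $\mathscr{C}\le \mathrm{GL}(V)$ be either the isometry group $\mathscr{C}(\beta)$ of a non-degenerate form $\beta$ on $V$ that is alternating (symplectic case), symmetric with $q$ odd (orthogonal case) or hermitian (unitary case), or the isometry group $\mathscr{C}(Q)$ of a quadratic form $Q$ on $V$, $q$ arbitrary, whose polar form $\beta_Q$ is non-degenerate (orthogonal case). Let $x\in\mathscr{C}$ be semisimple, i.e. of order coprime to $p$. For a monic $f\in F[t]$ of degree $d$ with $f(0)\ne 0$ put $f^*(t)=\overline{f(0)}^{\,-1}t^{d}\,\bar f(t^{-1})$, where $\bar f$ is obtained by applying $a\mapsto\bar a$ to the coefficients. Let $\Phi_1$ (resp. $\Phi_3$) be the set of monic irreducible $f=f^*$ of degree $1$ (resp. of degree $>1$), let $\Phi_2$ be the set of products $f=gg^*$ with $g$ monic irreducible, $g(0)\neq 0$ and $g\ne g^*$, and let $\Phi=\Phi_1\cup\Phi_2\cup\Phi_3$.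 For $f\in\Phi$ let $m_f$ be the multiplicity of $f$ (if $f\in\Phi_1\cup\Phi_3$) or of $g$ (if $f=gg^*\in\Phi_2$) as an elementary divisor of $x$; $f$ is called a generalized elementary divisor of $x$ if $m_f>0$. Let $d_f=\deg f$ in the unitary case and $d_f=\frac12\deg f$ in the symplectic and orthogonal cases, and let $\beta_f$ (resp. $Q_f$) be the restriction of $\beta$ (resp. $Q$) to $\ker f(x)$. **(1) Structure.** With products over the generalized elementary divisors of $x$, $$C_{\mathscr{C}}(x)\;\cong\;\prod_{f\in\Phi_1}\mathscr{C}(\beta_f)\times\prod_{f\in\Phi_2}\mathrm{GL}(m_f,q^{d_f})\times\prod_{f\in\Phi_3}\mathrm{U}(m_f,q^{d_f}),$$ with $Q_f$ in place of $\beta_f$ if $\mathscr{C}=\mathscr{C}(Q)$. Here $\mathrm{U}(m,r)$ is the unitary group of degree $m$ over $\mathbb{F}_{r^2}$. **(2) Special groups.** Let $\mathscr{S}=\{y\in\mathscr{C}:\det y=1\}$ and $C_{\mathscr{S}}(x)=C_{\mathscr{C}}(x)\cap\mathscr{S}$. Then $$|C_{\mathscr{S}}(x)|=\begin{cases}|C_{\mathscr{C}}(x)|/(q+1)&\text{if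 }\mathscr{C}\text{ is unitary and } n\ge1,\\ |C_{\mathscr{C}}(x)|/2&\text{if }\mathscr{C}\text{ is orthogonal, }q\text{ is odd and }x^2-1\text{ is singular},\\ |C_{\mathscr{C}}(x)|&\text{if } \mathscr C \text{ is symplectic, or orthogonal with } q \text{ even or } x^2-1 \text{ non-singular.}\end{cases}$$ **(3) Omega groups.** Let $\mathscr{C}=\mathscr{C}(Q)$. For $y\in\mathscr{C}$ put $V_y=\operatorname{im}(1-y)$. The spinor norm $\theta(y)\in\mathbb{F}_2$ is $\dim V_y \bmod 2$ if $q$ is even; if $q$ is odd, $\theta(y)=0$ exactly when the discriminant of the Wall form $\chi_y(u,v)=\beta_Q(w,v)$, $u=w-yw$, on $V_y$ is a square in $\mathbb{F}_q^*$. Let $\Omega=\Omega(Q)=\{y\in\mathscr{S}:\theta(y)=0\}$ and $C_\Omega(x)=C_{\mathscr{C}}(x)\cap\Omega$. If $q$ is even, the isomorphism in (1) can be chosen so that $C_\Omega(x)$ corresponds to the subset obtained by replacing the first factor by $\prod_{f\in\Phi_1}\Omega(Q_f)$. Moreover, if $q$ is even and $x+1$ is non-singular, then $|C_\Omega(x)|=|C_{\mathscr{S}}(x)|$.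 Otherwise $|C_\Omega(x)|=|C_{\mathscr{S}}(x)|/2$, provided that $n\ge 3$, or $n=2$ and $\det x=1$. -/

import Mathlib

namespace ClassicalGroups

open Polynomial

noncomputable section

/-! ### Elementary divisors -/

section ElementaryDivisors

variable {F V : Type*} [Field F] [AddCommGroup V] [Module F V]

/-- `s` is the list of elementary divisors of `x`: its members are powers (with positive exponent)
of monic irreducible polynomials, and `V`, as an `F[t]`-module with `t` acting as `x`, is the direct
sum of the cyclic modules `F[t] / (h)` for `h` in `s`. -/
def IsElementaryDivisors (x : V ≃ₗ[F] V) (s : Multiset F[X]) : Prop :=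
  (∀ h ∈ s, ∃ (f : F[X]) (e : ℕ), f.Monic ∧ Irreducible f ∧ 0 < e ∧ h = f ^ e) ∧
  ∃ (n : ℕ) (g : Fin n → F[X]), s = Finset.univ.val.map g ∧
    Nonempty (Module.AEval' (x : V →ₗ[F] V) ≃ₗ[F[X]] (∀ i, F[X] ⧸ Ideal.span {g i}))

theorem exists_isElementaryDivisors [FiniteDimensional F V] (x : V ≃ₗ[F] V) :
    ∃ s : Multiset F[X], IsElementaryDivisors x s := by
  classical
  obtain ⟨ι, _, p, hp, e, ⟨E⟩⟩ := Module.equiv_directSum_of_isTorsion (R := F[X])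
    (M := Module.AEval' (x : V →ₗ[F] V))
    (Module.AEval.isTorsion_of_finiteDimensional F V (x : V →ₗ[F] V))
  let E1 := E.trans (DirectSum.linearEquivFunOnFintype F[X] ι _)
  let P : ι → Prop := fun i => e i ≠ 0
  let g0 : {i // P i} → F[X] := fun i => normalize (p i) ^ e i
  have hspan : ∀ i : {i // P i}, Submodule.span F[X] {p i ^ e i} = Ideal.span {g0 i} := by
    intro i
    refine (Ideal.span_singleton_eq_span_singleton).2 ?_
    exact (associated_normalize _).pow_pow
  let r : (∀ i, F[X] ⧸ Submodule.span F[X] {p i ^ e i}) →ₗ[F[X]]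
      (∀ i : {i // P i}, F[X] ⧸ Submodule.span F[X] {p i ^ e i}) :=
    LinearMap.pi fun i => LinearMap.proj i.1
  have hr : Function.Bijective r := by
    constructor
    · intro a b hab
      funext i
      by_cases hi : P i
      · exact congrFun hab ⟨i, hi⟩
      · have h0 : e i = 0 := not_not.1 hi
        have : Subsingleton (F[X] ⧸ Submodule.span F[X] {p i ^ e i}) := by
          rw [Submodule.Quotient.subsingleton_iff, h0, pow_zero]
          exact Ideal.span_singleton_one
        exact Subsingleton.elim _ _
    · intro b
      refine ⟨fun i => if hi : P i then b ⟨i, hi⟩ else 0, ?_⟩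
      funext i
      have : P i.1 := i.2
      simp [r, this]
  let E2 := E1.trans (LinearEquiv.ofBijective r hr)
  let E3 := E2.trans (LinearEquiv.piCongrRight fun i => Submodule.quotEquivOfEq _ _ (hspan i))
  let c := Fintype.equivFin {i // P i}
  let E4 := E3.trans
    (LinearEquiv.piCongrLeft F[X] (fun i : {i // P i} => F[X] ⧸ Ideal.span {g0 i}) c.symm).symm
  refine ⟨Finset.univ.val.map (fun j => g0 (c.symm j)), ?_, _, _, rfl, ⟨E4⟩⟩
  intro h hh
  obtain ⟨j, -, rfl⟩ := Multiset.mem_map.1 hh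
  exact ⟨normalize (p (c.symm j)), e (c.symm j), Polynomial.monic_normalize (hp _).ne_zero,
    (associated_normalize _).irreducible (hp _), Nat.pos_of_ne_zero (c.symm j).2, rfl⟩

/-- The list of elementary divisors of `x`, with multiplicities. -/
def elementaryDivisors [FiniteDimensional F V] (x : V ≃ₗ[F] V) : Multiset F[X] :=
  (exists_isElementaryDivisors x).choose

theorem elementaryDivisors_spec [FiniteDimensional F V] (x : V ≃ₗ[F] V) :
    IsElementaryDivisors x (elementaryDivisors x) :=
  (exists_isElementaryDivisors x).choose_spec

/-- `ker f(x)`. -/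
def kerEval (x : V ≃ₗ[F] V) (f : F[X]) : Submodule F V :=
  LinearMap.ker (aeval (x : Module.End F V) f)

end ElementaryDivisors

/-! ### Dual polynomials and generalized elementary divisors -/

section Dual

variable {F V : Type*} [Field F] [AddCommGroup V] [Module F V]

/-- The dual `f*` of a monic polynomial `f` with `f(0) ≠ 0` and of degree `d`, with respect to the
field automorphism `σ`: `f*(t) = σ(f(0))⁻¹ t ^ d f^σ(t⁻¹)`. -/
def dualPoly (σ : F →+* F) (f : F[X]) : F[X] :=
  C (σ (f.coeff 0))⁻¹ * (f.map σ).reverse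

def Phi1 (σ : F →+* F) : Set F[X] :=
  {f | f.Monic ∧ f.coeff 0 ≠ 0 ∧ Irreducible f ∧ f = dualPoly σ f ∧ f.natDegree = 1}

/-- `f = g g*` with `g ≠ g*` monic irreducible. -/
def IsPhi2Factor (σ : F →+* F) (f g : F[X]) : Prop :=
  g.Monic ∧ g.coeff 0 ≠ 0 ∧ Irreducible g ∧ g ≠ dualPoly σ g ∧ f = g * dualPoly σ g

def Phi2 (σ : F →+* F) : Set F[X] :=
  {f | ∃ g, IsPhi2Factor σ f g}

def Phi3 (σ : F →+* F) : Set F[X] :=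
  {f | f.Monic ∧ f.coeff 0 ≠ 0 ∧ Irreducible f ∧ f = dualPoly σ f ∧ 1 < f.natDegree}

open Classical in
/-- The multiplicity of `f ^ e` as a generalized elementary divisor of `x`: for `f = g g*` in `Φ₂`
the multiplicity of `g ^ e` as an elementary divisor (the same for either choice of `g` when `x`
is an isometry), for `f` in `Φ₁ ∪ Φ₃` the multiplicity of `f ^ e` as an elementary divisor. -/
def genMult [FiniteDimensional F V] (σ : F →+* F) (x : V ≃ₗ[F] V) (f : F[X]) (e : ℕ) : ℕ :=
  if h : ∃ g, IsPhi2Factor σ f g then (elementaryDivisors x).count (h.choose ^ e)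
  else (elementaryDivisors x).count (f ^ e)

/-- The polynomials `f` in `Ψ` that are generalized elementary divisors of `x`. -/
abbrev GenDivisorsIn [FiniteDimensional F V] (σ : F →+* F) (x : V ≃ₗ[F] V) (Ψ : Set F[X]) :
    Type _ :=
  {f : F[X] // f ∈ Ψ ∧ 0 < genMult σ x f 1}

end Dual

/-! ### Forms and isometry groups -/

section Forms

variable {F V : Type*} [Field F] [AddCommGroup V] [Module F V] {σ : F →+* F}

/-- The isometry group of a sesquilinear form. -/
def isometryGroup (β : V →ₗ[F] V →ₛₗ[σ] F) : Subgroup (V ≃ₗ[F] V) where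
  carrier := {g | ∀ u v, β (g u) (g v) = β u v}
  mul_mem' := by
    intro a b ha hb u v
    rw [LinearEquiv.mul_apply, LinearEquiv.mul_apply, ha, hb]
  one_mem' := fun _ _ => rfl
  inv_mem' := by
    intro a ha u v
    have h := ha (a⁻¹ u) (a⁻¹ v)
    rw [← LinearEquiv.mul_apply, ← LinearEquiv.mul_apply, mul_inv_cancel] at h
    exact h.symm

/-- The isometry group of a quadratic form. -/
def quadIsometryGroup (Q : QuadraticForm F V) : Subgroup (V ≃ₗ[F] V) where
  carrier := {g | ∀ v, Q (g v) = Q v}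
  mul_mem' := by
    intro a b ha hb v
    rw [LinearEquiv.mul_apply, ha, hb]
  one_mem' := fun _ => rfl
  inv_mem' := by
    intro a ha v
    have h := ha (a⁻¹ v)
    rw [← LinearEquiv.mul_apply, mul_inv_cancel] at h
    exact h.symm

/-- The three types of isometry groups of sesquilinear forms. -/
inductive FormType
  | symplectic
  | orthogonal
  | unitary

/-- `β` is a non-degenerate form of type `T`, where `σ` is `a ↦ a ^ q`: alternating over the field
of `q` elements, symmetric over the field of `q` elements with `q` odd, or hermitian over the field
of `q ^ 2` elements. -/
def IsClassicalForm (q : ℕ) (T : FormType) (β : V →ₗ[F] V →ₛₗ[σ] F) : Prop :=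
  β.Nondegenerate ∧
  match T with
  | .symplectic => Nat.card F = q ∧ ∀ v, β v v = 0
  | .orthogonal => Nat.card F = q ∧ Odd q ∧ ∀ u v, β u v = β v u
  | .unitary => Nat.card F = q ^ 2 ∧ ∀ u v, β u v = σ (β v u)

/-- The number `d_f`; the division is exact for `f` in `Φ₂ ∪ Φ₃`. -/
def FormType.d (T : FormType) (f : F[X]) : ℕ :=
  match T with
  | .unitary => f.natDegree
  | .symplectic => f.natDegree / 2
  | .orthogonal => f.natDegree / 2

/-- The elements of determinant one of `GL(V)`. -/
def specialGroup (F V : Type*) [Field F] [AddCommGroup V] [Module F V] : Subgroup (V ≃ₗ[F] V) :=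
  (LinearEquiv.det : (V ≃ₗ[F] V) →* Fˣ).ker

/-- The standard sesquilinear form `(u, v) ↦ ∑ i, u i * τ (v i)`. -/
def stdForm {K : Type*} [Field K] (m : ℕ) (τ : K →+* K) :
    (Fin m → K) →ₗ[K] (Fin m → K) →ₛₗ[τ] K :=
  LinearMap.mk₂'ₛₗ (RingHom.id K) τ (fun u v => ∑ i, u i * τ (v i))
    (by intro u u' v; simp [add_mul, Finset.sum_add_distrib])
    (by intro c u v; simp [Finset.mul_sum, mul_assoc])
    (by intro u v v'; simp [mul_add, Finset.sum_add_distrib])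
    (by intro c u v; simp [Finset.mul_sum, mul_left_comm])

/-- `GL(m, p ^ a)`. -/
abbrev GLq (p : ℕ) [Fact p.Prime] (m a : ℕ) : Type :=
  GL (Fin m) (GaloisField p a)

/-- `U(m, p ^ a)`: the isometry group of the standard hermitian form on the `m`-dimensional space
over the field of `(p ^ a) ^ 2` elements, with conjugation `b ↦ b ^ (p ^ a)`. -/
abbrev Uq (p : ℕ) [Fact p.Prime] (m a : ℕ) : Type :=
  isometryGroup (stdForm m (iterateFrobenius (GaloisField p (2 * a)) p a))

/-! ### Spinor norm and Omega groups -/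

/-- The image `V_x` of `1 - x`. -/
def imOneSub (x : V ≃ₗ[F] V) : Submodule F V :=
  LinearMap.range ((1 : Module.End F V) - (x : Module.End F V))

theorem exists_of_mem_imOneSub {x : V ≃ₗ[F] V} (u : imOneSub x) :
    ∃ w : V, w - x w = u := by
  obtain ⟨w, hw⟩ := u.2
  exact ⟨w, hw⟩

/-- The Wall form of an isometry `x` of `Q`: `(u, v) ↦ β_Q(w, v)`, where `u = w - x w`. -/
def wallForm (Q : QuadraticForm F V) (x : V ≃ₗ[F] V) (u v : imOneSub x) : F :=
  QuadraticMap.polar Q (exists_of_mem_imOneSub u).choose v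

/-- The value of the Wall form does not depend on the choice of `w`. -/
theorem wallForm_eq (Q : QuadraticForm F V) (x : V ≃ₗ[F] V) (hx : x ∈ quadIsometryGroup Q)
    (u v : imOneSub x) (w : V) (hw : w - x w = u) :
    wallForm Q x u v = QuadraticMap.polar Q w v := by
  have hx' : ∀ v, Q (x v) = Q v := hx
  have hp : ∀ a b, QuadraticMap.polar Q (x a) (x b) = QuadraticMap.polar Q a b := by
    intro a b
    simp only [QuadraticMap.polar, ← map_add, hx']
  obtain ⟨z, hz⟩ := exists_of_mem_imOneSub v
  have h1 := (exists_of_mem_imOneSub u).choose_spec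
  unfold wallForm
  set w' := (exists_of_mem_imOneSub u).choose
  have h2 : x (w' - w) = w' - w := by
    have h3 : w' - x w' = w - x w := h1.trans hw.symm
    rw [map_sub]
    rw [sub_eq_sub_iff_add_eq_add] at h3 ⊢
    rw [add_comm (x w') w, h3]
  have h3 : QuadraticMap.polar Q (w' - w) (v : V) = 0 := by
    rw [← hz, QuadraticMap.polar_sub_right]
    nth_rewrite 2 [← h2]
    rw [hp, sub_self]
  rw [QuadraticMap.polar_sub_left] at h3
  exact sub_eq_zero.1 h3

open Classical in
/-- The spinor norm: in characteristic two the parity of `dim V_x`; in odd characteristic `0` if the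
discriminant of the Wall form is a square and `1` otherwise. -/
def spinorNorm [FiniteDimensional F V] (Q : QuadraticForm F V) (x : V ≃ₗ[F] V) : ZMod 2 :=
  if (2 : F) = 0 then (Module.finrank F (imOneSub x) : ZMod 2)
  else if IsSquare (Matrix.of fun i j =>
      wallForm Q x (Module.finBasis F (imOneSub x) i) (Module.finBasis F (imOneSub x) j)).det
    then 0 else 1

/-- The Omega group: the kernel of the spinor norm on the special orthogonal group. -/
def omegaGroup [FiniteDimensional F V] (Q : QuadraticForm F V) : Set (V ≃ₗ[F] V) :=
  {x | x ∈ quadIsometryGroup Q ∧ x ∈ specialGroup F V ∧ spinorNorm Q x = 0}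

/-- The centralizer of `x` in the group `G`. -/
def centralizerIn (G : Subgroup (V ≃ₗ[F] V)) (x : V ≃ₗ[F] V) : Subgroup (V ≃ₗ[F] V) :=
  Subgroup.centralizer {x} ⊓ G

end Forms

end

end ClassicalGroups

/-! Structure. For an isometry `x`, the kernel of `f*(x)` is the orthogonal complement of the image
of `f(x)` (`mem_kerEval_dualPoly`). Hence the kernels attached to distinct members of Φ are
orthogonal, and semisimplicity makes each of them non-degenerate. They fill `V`: an irreducible
polynomial killing a non-zero vector of the orthogonal complement of their sum would divide a member
of Φ, and the vector would lie in the radical of a non-degenerate piece (`iSup_kerEval`). So the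
centralizer is the product of the centralizers on the pieces (`exists_centralizer_equiv`). On a Φ₁
piece `x` is a scalar and imposes no condition. On a Φ₂ piece the kernels of `g(x)` and `g*(x)` are
totally isotropic and in duality, so an arbitrary automorphism of the first that is linear over
`F[t]/(g)` determines the action on the second (`phi2_equiv`). On a Φ₃ piece `L = F[t]/(f)` is a
field with an involution sending `t` to its inverse; the form is the trace of a multiple of a
hermitian form over `L` (`exists_hermitian_lift`), which has an orthonormal basis because norms are
surjective for finite fields (`phi3_equiv`). For a quadratic form, `x - 1` is invertible on the Φ₂
and Φ₃ pieces, and there `Q` can be recovered from its polar form and `x`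
(`mem_quadIsometryGroup_of_polar`).

Determinants. Elements of the centralizer are built by one device: if `a` commutes with its adjoint
`a'` and with `x`, then `a a'⁻¹` is an isometry commuting with `x` (`exists_normal_isometry`).
Letting `a` be a polynomial in `x` on a minimal invariant subspace and the identity on a complement,
`det a` can be prescribed, by surjectivity of the norm. In the unitary case this realizes every `c /
σ(c)`, which are all the `q + 1` possible determinants. In the orthogonal case a reflection in an
eigenvector for `1` or `-1` has determinant `-1`; if `x² - 1` is invertible, the centralizer
preserves the non-degenerate alternating form `β(u, (x - x⁻¹)v)` and so has determinant one.

Spinor norms. Multiplying `y` by the reflection in `v` changes the dimension of `V_y` by one and its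
Wall discriminant by `Q(v)` modulo squares (`HasWallDisc.reflection_mul`). For odd `q`, generation
by reflections then gives multiplicativity, and it remains to find one element of non-trivial spinor
norm. If `x² ≠ 1`, take `a a'⁻¹` with `det a` a non-square: its Wall discriminant is `det a'` times
the discriminant of an alternating form, which is a square (`exists_hasWallDisc_of_isAdj`). If `x² =
1`, some eigenspace has dimension at least two and a product of two reflections works. For even `q`,
`x` preserves the Wall form of every commuting `y`; when `x` has no fixed vectors this forces `dim
V_y` to be even, because the characteristic polynomial of an isometry is self-reciprocal
(`even_card_of_isometry_matrix`). In general the parity is therefore read off from the fixed space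
of `x`. -/

namespace ClassicalGroups

open Polynomial

/-! ### Adjoints, representability and orthogonality for ε-hermitian forms -/

section Toolkit

variable {F V : Type*} [Field F] [AddCommGroup V] [Module F V] {σ : F →+* F}

/-- A non-degenerate form that is hermitian or skew-hermitian with respect to `σ`, with sign `ε`. -/
structure IsEpsHermitian (ε : F) (β : V →ₗ[F] V →ₛₗ[σ] F) : Prop where
  invol : ∀ a, σ (σ a) = a
  eps : ε * σ ε = 1
  symm : ∀ u v, β v u = ε * σ (β u v)
  nondeg : ∀ u, (∀ v, β u v = 0) → u = 0

/-- `a'` is adjoint to `a` with respect to `β`. -/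
def IsAdj (β : V →ₗ[F] V →ₛₗ[σ] F) (a a' : Module.End F V) : Prop :=
  ∀ u v, β (a u) v = β u (a' v)

/-- The vectors orthogonal to `M`. -/
def orth (β : V →ₗ[F] V →ₛₗ[σ] F) (M : Submodule F V) : Submodule F V where
  carrier := {v | ∀ u ∈ M, β u v = 0}
  add_mem' := by
    intro a b ha hb u hu
    rw [map_add, ha u hu, hb u hu, add_zero]
  zero_mem' := fun u _ => map_zero _
  smul_mem' := by
    intro c v hv u hu
    rw [LinearMap.map_smulₛₗ, hv u hu, smul_zero]

namespace IsEpsHermitian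

variable {ε : F} {β : V →ₗ[F] V →ₛₗ[σ] F}

theorem eps_ne_zero (h : IsEpsHermitian ε β) : ε ≠ 0 := fun h0 => by
  simpa [h0] using h.eps

theorem eq_zero_symm (h : IsEpsHermitian ε β) {u v : V} (huv : β u v = 0) : β v u = 0 := by
  rw [h.symm u v, huv, map_zero, mul_zero]

theorem nondeg_right (h : IsEpsHermitian ε β) (v : V) (hv : ∀ u, β u v = 0) : v = 0 :=
  h.nondeg v fun u => h.eq_zero_symm (hv u)

theorem restrict (h : IsEpsHermitian ε β) (M : Submodule F V)
    (hM : ∀ u ∈ M, (∀ v ∈ M, β u v = 0) → u = 0) :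
    IsEpsHermitian ε (β.domRestrict₁₂ M M) where
  invol := h.invol
  eps := h.eps
  symm u v := h.symm u v
  nondeg u hu := Subtype.ext (hM u u.2 fun v hv => hu ⟨v, hv⟩)

theorem isAdj_symm (h : IsEpsHermitian ε β) {a a' : Module.End F V} (ha : IsAdj β a a') :
    IsAdj β a' a := by
  intro u v
  rw [h.symm v, h.symm (a v), ha v u]

theorem det_gram_ne_zero (h : IsEpsHermitian ε β) {ι : Type*} [Fintype ι] [DecidableEq ι]
    (b : Module.Basis ι F V) : (Matrix.of fun i j => β (b i) (b j)).det ≠ 0 := by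
  intro h0
  obtain ⟨v, hv, hv0⟩ := Matrix.exists_vecMul_eq_zero_iff.2 h0
  apply hv
  have : ∑ i, v i • b i = 0 := by
    refine h.nondeg _ fun w => ?_
    have hb : ∀ j, β (∑ i, v i • b i) (b j) = 0 := by
      intro j
      have := congrFun hv0 j
      simpa [Matrix.vecMul, dotProduct] using this
    rw [← b.sum_repr w]
    simp only [map_sum, LinearMap.map_smulₛₗ] at hb ⊢
    exact Finset.sum_eq_zero fun j _ => by rw [hb, smul_zero]
  ext i
  exact Fintype.linearIndependent_iff.1 b.linearIndependent v this i

/-- With Gram matrix `G`, adjointness reads `Aᵀ G = G σ(A')`; take determinants and cancel the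
non-zero `det G`. -/
theorem det_eq_of_isAdj [FiniteDimensional F V] (h : IsEpsHermitian ε β) {a a' : Module.End F V} (ha : IsAdj β a a') :
    LinearMap.det a = σ (LinearMap.det a') := by
  classical
  let b := Module.finBasis F V
  let G : Matrix _ _ F := Matrix.of fun i j => β (b i) (b j)
  have hG : G.det ≠ 0 := h.det_gram_ne_zero b
  have key : (LinearMap.toMatrix b b a).transpose * G =
      G * (LinearMap.toMatrix b b a').map σ := by
    ext i j
    have h1 := ha (b i) (b j)
    rw [← b.sum_repr (a (b i)), ← b.sum_repr (a' (b j))] at h1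
    simp only [map_sum, LinearMap.map_smulₛₗ, RingHom.id_apply, LinearMap.sum_apply,
      LinearMap.smul_apply, smul_eq_mul] at h1
    simp only [Matrix.mul_apply, Matrix.transpose_apply, Matrix.map_apply, LinearMap.toMatrix_apply,
      G, Matrix.of_apply]
    rw [h1]
    exact Finset.sum_congr rfl fun k _ => mul_comm _ _
  have h2 := congrArg Matrix.det key
  rw [Matrix.det_mul, Matrix.det_mul, Matrix.det_transpose, mul_comm] at h2
  have h3 := mul_left_cancel₀ hG h2
  rw [← LinearMap.det_toMatrix b, ← LinearMap.det_toMatrix b, h3, RingHom.map_det]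
  rfl

variable [Finite F] [FiniteDimensional F V]

/-- The map `v ↦ β(·, v)` into the dual is injective by non-degeneracy. Since it is only
`σ`-semilinear, surjectivity is obtained by counting elements rather than dimensions. -/
theorem exists_repr (h : IsEpsHermitian ε β) (l : V →ₗ[F] F) : ∃ v, ∀ u, β u v = l u := by
  have : Finite V := Module.finite_of_finite F
  have : Finite (Module.Dual F V) := Module.finite_of_finite F
  have hinj : Function.Injective (fun v => (β.flip v : Module.Dual F V)) := by
    intro v w hvw
    refine sub_eq_zero.1 (h.nondeg_right _ fun u => ?_)
    rw [map_sub, sub_eq_zero]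
    exact LinearMap.congr_fun hvw u
  have hb := hinj.bijective_of_nat_card_le (by
    rw [Module.natCard_eq_pow_finrank (K := F) (V := V),
      Module.natCard_eq_pow_finrank (K := F) (V := Module.Dual F V), Subspace.dual_finrank_eq])
  obtain ⟨v, hv⟩ := hb.2 l
  exact ⟨v, fun u => LinearMap.congr_fun hv u⟩

theorem exists_isAdj (h : IsEpsHermitian ε β) (a : Module.End F V) :
    ∃ a' : Module.End F V, IsAdj β a a' := by
  choose a' ha' using fun v => h.exists_repr ((β.flip v : V →ₗ[F] F) ∘ₗ a)
  have ha : ∀ u v, β u (a' v) = β (a u) v := fun u v => ha' v u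
  refine ⟨{ toFun := a', map_add' := fun v w => ?_, map_smul' := fun c v => ?_ },
    fun u v => (ha u v).symm⟩
  · refine sub_eq_zero.1 (h.nondeg_right _ fun u => ?_)
    simp only [map_sub, map_add, ha, sub_self]
  · refine sub_eq_zero.1 (h.nondeg_right _ fun u => ?_)
    simp only [map_sub, LinearMap.map_smulₛₗ, ha, sub_self, RingHom.id_apply]

/-- A functional vanishing on `M` but not at `v` is represented by a vector. This replaces dimension
formulas for orthogonal complements throughout. -/
theorem exists_orth_of_notMem (h : IsEpsHermitian ε β) {M : Submodule F V} {v : V} (hv : v ∉ M) :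
    ∃ k, (∀ u ∈ M, β u k = 0) ∧ β v k ≠ 0 := by
  obtain ⟨f, hf, hM⟩ := Submodule.exists_le_ker_of_notMem hv
  obtain ⟨k, hk⟩ := h.exists_repr f
  exact ⟨k, fun u hu => by rw [hk]; exact hM hu, by rwa [hk]⟩

end IsEpsHermitian

theorem isAdj_of_isometry {β : V →ₗ[F] V →ₛₗ[σ] F} {y : V ≃ₗ[F] V} (hy : y ∈ isometryGroup β) :
    IsAdj β (y : Module.End F V) ((y⁻¹ : V ≃ₗ[F] V) : Module.End F V) := by
  intro u v
  have h := hy u (y⁻¹ v)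
  rw [← LinearEquiv.mul_apply, mul_inv_cancel] at h
  exact h

theorem det_prod_of_isCompl [FiniteDimensional F V] {M N : Submodule F V} (h : IsCompl M N)
    (a : Module.End F V)
    (hM : ∀ v ∈ M, a v ∈ M) (hN : ∀ v ∈ N, a v ∈ N) :
    LinearMap.det a = LinearMap.det (a.restrict hM) * LinearMap.det (a.restrict hN) := by
  rw [← LinearMap.det_prodMap, ← LinearMap.det_conj _ (Submodule.prodEquivOfIsCompl M N h)]
  congr 1
  ext v
  obtain ⟨w, rfl⟩ := (Submodule.prodEquivOfIsCompl M N h).surjective v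
  simp

end Toolkit

end ClassicalGroups

namespace ClassicalGroups

open Polynomial

/-! ### Alternating forms: symplectic bases, determinants and discriminants -/

section Alternating

variable {F V : Type*} [Field F] [AddCommGroup V] [Module F V] {σ : F →+* F}

theorem linearIndependent_of_gram {ι : Type*} [Fintype ι] [DecidableEq ι]
    (β : V →ₗ[F] V →ₛₗ[σ] F) (c : ι → V)
    (h : (Matrix.of fun i j => β (c i) (c j)).det ≠ 0) : LinearIndependent F c := by
  rw [Fintype.linearIndependent_iff]
  intro g hg
  by_contra! hne
  obtain ⟨i, hi⟩ := hne
  refine h (Matrix.exists_vecMul_eq_zero_iff.1 ⟨g, fun h0 => hi (congrFun h0 i), ?_⟩)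
  ext j
  have := congrArg (fun v => β v (c j)) hg
  simpa [Matrix.vecMul, dotProduct] using this

/-- Congruent Gram matrices: the class of the discriminant modulo squares does not depend on the
basis. The index types may differ, since bases of the same space are reindexed into each other. -/
theorem gram_det_basis_change {ι κ : Type*} [Fintype ι] [DecidableEq ι] [Fintype κ] [DecidableEq κ]
    (B : V →ₗ[F] V →ₗ[F] F) (b : Module.Basis ι F V) (c : Module.Basis κ F V) :
    ∃ d : F, d ≠ 0 ∧ (Matrix.of fun i j => B (c i) (c j)).det =
      d ^ 2 * (Matrix.of fun i j => B (b i) (b j)).det := by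
  let e := b.indexEquiv c
  let c' := c.reindex e.symm
  have hc : (Matrix.of fun i j => B (c i) (c j)).det = (Matrix.of fun i j => B (c' i) (c' j)).det := by
    rw [← Matrix.det_submatrix_equiv_self e]
    congr 1
    ext i j
    simp [c']
  refine ⟨(b.toMatrix c').det, ?_, ?_⟩
  · intro h0
    have := congrArg Matrix.det (b.toMatrix_mul_toMatrix_flip c')
    rw [Matrix.det_mul, h0, zero_mul, Matrix.det_one] at this
    exact zero_ne_one this
  · have key : (Matrix.of fun i j => B (c' i) (c' j)) =
        (b.toMatrix c').transpose * (Matrix.of fun i j => B (b i) (b j)) * b.toMatrix c' := by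
      ext i j
      rw [Matrix.of_apply, ← b.sum_repr (c' i), ← b.sum_repr (c' j)]
      simp only [map_sum, LinearMap.map_smul, LinearMap.sum_apply, LinearMap.smul_apply,
        smul_eq_mul, Matrix.mul_apply, Matrix.transpose_apply, Matrix.of_apply,
        Module.Basis.toMatrix_apply]
      refine Finset.sum_congr rfl fun k _ => ?_
      rw [Finset.sum_mul]
      exact Finset.sum_congr rfl fun l _ => by ring
    rw [hc, key, Matrix.det_mul, Matrix.det_mul, Matrix.det_transpose]
    ring

theorem alternating_swap {γ : V →ₗ[F] V →ₗ[F] F} (halt : ∀ v, γ v v = 0) (u v : V) :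
    γ v u = -γ u v := by
  have h := halt (u + v)
  simp only [map_add, LinearMap.add_apply, halt, zero_add, add_zero] at h
  exact eq_neg_of_add_eq_zero_left (by simpa using h)

/-- A family of pairwise orthogonal hyperbolic pairs. -/
structure IsHyperbolic (γ : V →ₗ[F] V →ₗ[F] F) {m : ℕ} (e e' : Fin m → V) : Prop where
  left : ∀ i j, γ (e i) (e j) = 0
  right : ∀ i j, γ (e' i) (e' j) = 0
  pair : ∀ i j, γ (e i) (e' j) = if i = j then 1 else 0

namespace IsHyperbolic

variable {γ : V →ₗ[F] V →ₗ[F] F} {m : ℕ} {e e' : Fin m → V}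

/-- The primed vectors come first so that the Gram matrix is literally `Matrix.J`, whose upper right
block is `-1`. -/
theorem gram (h : IsHyperbolic γ e e') (halt : ∀ v, γ v v = 0) :
    (Matrix.of fun i j => γ (Sum.elim e' e i) (Sum.elim e' e j)) = Matrix.J (Fin m) F := by
  ext (i | i) (j | j)
  · simp [Matrix.J, h.right]
  · simp [Matrix.J, alternating_swap halt (e j), h.pair, Matrix.one_apply, eq_comm]
  · simp [Matrix.J, h.pair, Matrix.one_apply]
  · simp [Matrix.J, h.left]

theorem linearIndependent (h : IsHyperbolic γ e e') (halt : ∀ v, γ v v = 0) :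
    LinearIndependent F (Sum.elim e' e) :=
  linearIndependent_of_gram γ _ (by rw [h.gram halt]; exact (Matrix.isUnit_det_J _ _).ne_zero)

/-- The component of `v` orthogonal to a hyperbolic family. -/
def proj (γ : V →ₗ[F] V →ₗ[F] F) (e e' : Fin m → V) (v : V) : V :=
  v - ∑ i, γ v (e' i) • e i + ∑ i, γ v (e i) • e' i

theorem proj_left (h : IsHyperbolic γ e e') (halt : ∀ v, γ v v = 0) (v : V) (j : Fin m) :
    γ (proj γ e e' v) (e j) = 0 := by
  have h1 : ∀ i, γ (e' i) (e j) = -if j = i then 1 else 0 := fun i => by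
    rw [alternating_swap halt (e j), h.pair]
  simp [proj, h.left, h1]

theorem proj_right (h : IsHyperbolic γ e e') (v : V) (j : Fin m) :
    γ (proj γ e e' v) (e' j) = 0 := by
  simp [proj, h.right, h.pair]

theorem extend (h : IsHyperbolic γ e e') (halt : ∀ v, γ v v = 0)
    (hnd : ∀ u, (∀ v, γ u v = 0) → u = 0) {v : V} (hv : proj γ e e' v ≠ 0) :
    ∃ w w' : V, IsHyperbolic γ (Fin.cons w e : Fin (m + 1) → V) (Fin.cons w' e') := by
  set w := proj γ e e' v with hw
  have hwe : ∀ j, γ w (e j) = 0 := h.proj_left halt v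
  have hwe' : ∀ j, γ w (e' j) = 0 := h.proj_right v
  obtain ⟨u, hu⟩ : ∃ u, γ w u ≠ 0 := by
    by_contra! h0
    exact hv (hnd w h0)
  -- Since `w` is orthogonal to the whole family, passing from `u` to its projection does not change
  -- the pairing with `w`; the scalar normalizes that pairing to one.
  set w' := (γ w u)⁻¹ • proj γ e e' u with hw'
  have h1 : γ w w' = 1 := by
    rw [hw', map_smul]
    simp only [proj, map_add, map_sub, map_sum, map_smul, hwe, hwe', smul_eq_mul, mul_zero,
      Finset.sum_const_zero, sub_zero, add_zero]
    exact inv_mul_cancel₀ hu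
  have h2 : ∀ j, γ w' (e j) = 0 := fun j => by
    simp [hw', h.proj_left halt]
  have h3 : ∀ j, γ w' (e' j) = 0 := fun j => by
    simp [hw', h.proj_right]
  refine ⟨w, w', ?_, ?_, ?_⟩
  · intro i j
    refine Fin.cases ?_ (fun i => ?_) i <;> refine Fin.cases ?_ (fun j => ?_) j
    · simp [halt]
    · simp [hwe]
    · simp [alternating_swap halt w, hwe]
    · simp [h.left]
  · intro i j
    refine Fin.cases ?_ (fun i => ?_) i <;> refine Fin.cases ?_ (fun j => ?_) j
    · simp [halt]
    · simp [h3]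
    · simp [alternating_swap halt w', h3]
    · simp [h.right]
  · intro i j
    refine Fin.cases ?_ (fun i => ?_) i <;> refine Fin.cases ?_ (fun j => ?_) j
    · simp [h1]
    · simp [hwe', (Fin.succ_ne_zero j).symm]
    · simp [alternating_swap halt w', h2]
    · simp [h.pair]

end IsHyperbolic

variable [FiniteDimensional F V]

/-- A hyperbolic family of maximal length exists because such families are linearly independent. By
maximality every projection vanishes, so the family spans. -/
theorem exists_symplectic_basis (γ : V →ₗ[F] V →ₗ[F] F) (halt : ∀ v, γ v v = 0)
    (hnd : ∀ u, (∀ v, γ u v = 0) → u = 0) :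
    ∃ (m : ℕ) (b : Module.Basis (Fin m ⊕ Fin m) F V),
      (Matrix.of fun i j => γ (b i) (b j)) = Matrix.J (Fin m) F := by
  obtain ⟨m, ⟨e, e', h⟩, hm⟩ : ∃ m : ℕ, (∃ e e' : Fin m → V, IsHyperbolic γ e e') ∧
      ¬ ∃ e e' : Fin (m + 1) → V, IsHyperbolic γ e e' := by
    by_contra! hcon
    have hall : ∀ m : ℕ, ∃ e e' : Fin m → V, IsHyperbolic γ e e' := by
      intro m
      induction m with
      | zero => exact ⟨Fin.elim0, Fin.elim0, ⟨fun i => i.elim0, fun i => i.elim0, fun i => i.elim0⟩⟩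
      | succ m ih =>
        obtain ⟨e, e', h⟩ := ih
        exact hcon m ⟨e, e', h⟩
    obtain ⟨e, e', h⟩ := hall (Module.finrank F V + 1)
    have := (h.linearIndependent halt).fintype_card_le_finrank
    simp at this
    omega
  have hp : ∀ v, IsHyperbolic.proj γ e e' v = 0 := by
    intro v
    by_contra hv
    obtain ⟨w, w', hw⟩ := h.extend halt hnd hv
    exact hm ⟨_, _, hw⟩
  refine ⟨m, Module.Basis.mk (h.linearIndependent halt) ?_, ?_⟩
  · intro v _
    have hv := hp v
    rw [IsHyperbolic.proj, sub_add, sub_eq_zero] at hv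
    rw [hv]
    refine Submodule.sub_mem _ (Submodule.sum_mem _ fun i _ => Submodule.smul_mem _ _ ?_)
      (Submodule.sum_mem _ fun i _ => Submodule.smul_mem _ _ ?_)
    · exact Submodule.subset_span ⟨Sum.inr i, rfl⟩
    · exact Submodule.subset_span ⟨Sum.inl i, rfl⟩
  · simp only [Module.Basis.coe_mk]
    exact h.gram halt

theorem det_eq_one_of_alternating (γ : V →ₗ[F] V →ₗ[F] F) (halt : ∀ v, γ v v = 0)
    (hnd : ∀ u, (∀ v, γ u v = 0) → u = 0) (y : Module.End F V)
    (hy : ∀ u v, γ (y u) (y v) = γ u v) : LinearMap.det y = 1 := by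
  obtain ⟨m, b, hb⟩ := exists_symplectic_basis γ halt hnd
  rw [← LinearMap.det_toMatrix b]
  apply SymplecticGroup.det_eq_one
  rw [SymplecticGroup.mem_iff', ← hb]
  ext i j
  have h1 := hy (b i) (b j)
  rw [← b.sum_repr (y (b i)), ← b.sum_repr (y (b j))] at h1
  simp only [map_sum, LinearMap.map_smul, LinearMap.sum_apply, LinearMap.smul_apply,
    smul_eq_mul] at h1
  simp only [Matrix.mul_apply, Matrix.transpose_apply, LinearMap.toMatrix_apply, Matrix.of_apply]
  rw [← h1]
  refine Finset.sum_congr rfl fun k _ => ?_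
  rw [Finset.sum_mul]
  exact Finset.sum_congr rfl fun l _ => by ring

/-- In a symplectic basis the discriminant is `det J = 1`. This is the source of every statement
below that some discriminant or determinant is a square. -/
theorem isSquare_det_gram_of_alternating (γ : V →ₗ[F] V →ₗ[F] F) (halt : ∀ v, γ v v = 0)
    (hnd : ∀ u, (∀ v, γ u v = 0) → u = 0) {ι : Type*} [Fintype ι] [DecidableEq ι]
    (c : Module.Basis ι F V) : IsSquare (Matrix.of fun i j => γ (c i) (c j)).det := by
  obtain ⟨m, b, hb⟩ := exists_symplectic_basis γ halt hnd
  obtain ⟨d, -, hd⟩ := gram_det_basis_change γ b c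
  rw [hd, hb, SymplecticGroup.det_eq_one (SymplecticGroup.J_mem _ _), mul_one]
  exact ⟨d, sq d⟩

end Alternating

end ClassicalGroups

namespace ClassicalGroups

open Polynomial

/-! ### Semisimple operators and minimal invariant subspaces -/

section Semisimple

variable {F V : Type*} [Field F] [AddCommGroup V] [Module F V]

theorem isSemisimple_of_pow_eq_one {x : V ≃ₗ[F] V} {N : ℕ} (hN : (N : F) ≠ 0) (hx : x ^ N = 1) :
    Module.End.IsSemisimple (x : Module.End F V) := by
  refine Module.End.isSemisimple_of_squarefree_aeval_eq_zero (p := X ^ N - 1)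
    (X_pow_sub_one_separable_iff.2 hN).squarefree ?_
  ext v
  have := LinearEquiv.congr_fun hx v
  have hp : ∀ n : ℕ, ((x : Module.End F V) ^ n) v = (x ^ n) v := by
    intro n
    rw [Module.End.pow_apply, LinearEquiv.coe_coe, LinearEquiv.pow_apply]
  simp [hp, this]

theorem aeval_mem_of_invariant {a : Module.End F V} {T : Submodule F V} (hT : ∀ v ∈ T, a v ∈ T)
    (f : F[X]) {v : V} (hv : v ∈ T) : aeval a f v ∈ T := by
  induction f using Polynomial.induction_on' with
  | add f g hf hg => rw [map_add]; exact T.add_mem hf hg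
  | monomial n c =>
    rw [aeval_monomial, Module.End.mul_apply, Module.algebraMap_end_apply]
    refine T.smul_mem _ ?_
    induction n with
    | zero => exact hv
    | succ n ih => rw [pow_succ']; exact hT _ ih

variable [FiniteDimensional F V]

/-- The gcd `d` of `f²` and the minimal polynomial kills `w`. Being a divisor of a squarefree
polynomial, `d` is squarefree, and it divides `f²`, hence `f`. -/
theorem aeval_apply_eq_zero_of_sq {a : Module.End F V} (hs : a.IsSemisimple) (f : F[X]) (w : V)
    (hw : aeval a f (aeval a f w) = 0) : aeval a f w = 0 := by
  obtain ⟨d, A, B, hd1, hd2, hg⟩ : ∃ d A B : F[X], d ∣ f ^ 2 ∧ d ∣ minpoly F a ∧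
      A * f ^ 2 + B * minpoly F a = d := by
    obtain ⟨d, hd'⟩ := IsPrincipalIdealRing.principal (Ideal.span {f ^ 2, minpoly F a})
    have hd : Ideal.span {f ^ 2, minpoly F a} = Ideal.span {d} := hd'
    have hmem : ∀ g ∈ ({f ^ 2, minpoly F a} : Set F[X]), d ∣ g := fun g hg =>
      Ideal.mem_span_singleton.1 (by rw [← hd]; exact Ideal.subset_span hg)
    obtain ⟨A, B, h⟩ := Ideal.mem_span_pair.1 (by rw [hd]; exact Ideal.mem_span_singleton_self d)
    exact ⟨d, A, B, hmem _ (by simp), hmem _ (by simp), h⟩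
  obtain ⟨e, rfl⟩ :=
    (Squarefree.dvd_pow_iff_dvd (hs.minpoly_squarefree.squarefree_of_dvd hd2) two_ne_zero).1 hd1
  have h0 : aeval a d w = 0 := by
    rw [← hg, map_add, map_mul, map_mul, minpoly.aeval, mul_zero, add_zero,
      Module.End.mul_apply, sq, map_mul, Module.End.mul_apply, hw, map_zero]
  rw [mul_comm, map_mul, Module.End.mul_apply, h0, map_zero]

theorem isCompl_ker_range {a : Module.End F V} (hs : a.IsSemisimple) (f : F[X]) :
    IsCompl (LinearMap.ker (aeval a f)) (LinearMap.range (aeval a f)) := by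
  have hd : Disjoint (LinearMap.ker (aeval a f)) (LinearMap.range (aeval a f)) := by
    rw [Submodule.disjoint_def]
    rintro _ h1 ⟨w, rfl⟩
    exact aeval_apply_eq_zero_of_sq hs f w h1
  refine Submodule.isCompl_iff_disjoint _ _ ?_ |>.2 hd
  rw [add_comm, LinearMap.finrank_range_add_finrank_ker]

/-- Peel irreducible factors off the minimal polynomial until the remaining product no longer kills
`v`; its value at `v` is then killed by the last factor removed. -/
theorem exists_irreducible_kill {a : Module.End F V} {T : Submodule F V} (hT : ∀ v ∈ T, a v ∈ T)
    (hT0 : T ≠ ⊥) : ∃ (g : F[X]) (w : V), g.Monic ∧ Irreducible g ∧ w ∈ T ∧ w ≠ 0 ∧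
      aeval a g w = 0 := by
  classical
  obtain ⟨v, hv, hv0⟩ := T.ne_bot_iff.1 hT0
  have key : ∀ h : F[X], h ≠ 0 → aeval a h v = 0 → ∃ (g : F[X]) (w : V), g.Monic ∧ Irreducible g ∧
      w ∈ T ∧ w ≠ 0 ∧ aeval a g w = 0 := by
    intro h
    induction h using WfDvdMonoid.induction_on_irreducible with
    | zero => exact fun h => absurd rfl h
    | unit u hu =>
      intro _ h0
      obtain ⟨u', hu'⟩ := hu.exists_left_inv
      refine absurd ?_ hv0
      have := congrArg (aeval a u') h0
      rwa [← Module.End.mul_apply, ← map_mul, hu', map_one, map_zero] at this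
    | mul b i hb hi ih =>
      intro _ h0
      by_cases hbv : aeval a b v = 0
      · exact ih hb hbv
      · refine ⟨normalize i, aeval a b v, monic_normalize hi.ne_zero,
          (associated_normalize i).irreducible_iff.1 hi, aeval_mem_of_invariant hT b hv, hbv, ?_⟩
        obtain ⟨u, hu⟩ := associated_normalize i
        rw [← hu, mul_comm, map_mul, Module.End.mul_apply, ← Module.End.mul_apply (aeval a i),
          ← map_mul, h0, map_zero]
  exact key (minpoly F a) (minpoly.ne_zero (Algebra.IsIntegral.isIntegral a)) (by
    rw [minpoly.aeval]; rfl)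

/-- A minimal non-zero invariant subspace. -/
structure IsMinInvariant (a : Module.End F V) (U : Submodule F V) : Prop where
  inv : ∀ v ∈ U, a v ∈ U
  ne_bot : U ≠ ⊥
  min : ∀ W : Submodule F V, W ≤ U → (∀ v ∈ W, a v ∈ W) → W = ⊥ ∨ W = U

theorem exists_isMinInvariant {a : Module.End F V} {T : Submodule F V} (hT : ∀ v ∈ T, a v ∈ T)
    (hT0 : T ≠ ⊥) : ∃ U ≤ T, IsMinInvariant a U := by
  obtain ⟨U, ⟨hUT, hU, hU0⟩, hmin⟩ := wellFounded_lt.has_min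
    {U : Submodule F V | U ≤ T ∧ (∀ v ∈ U, a v ∈ U) ∧ U ≠ ⊥} ⟨T, le_rfl, hT, hT0⟩
  refine ⟨U, hUT, hU, hU0, fun W hWU hW => ?_⟩
  by_contra! h
  exact hmin W ⟨hWU.trans hUT, hW, h.1⟩ (lt_of_le_of_ne hWU h.2)

theorem inv_mem_of_invariant {y : V ≃ₗ[F] V} {T : Submodule F V} (hT : ∀ v ∈ T, y v ∈ T) {v : V}
    (hv : v ∈ T) : y⁻¹ v ∈ T := by
  have h1 : T.map (y : V →ₗ[F] V) = T := by
    refine Submodule.eq_of_le_of_finrank_eq ?_ (LinearEquiv.finrank_map_eq y T)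
    rintro _ ⟨w, hw, rfl⟩
    exact hT w hw
  rw [← h1] at hv
  obtain ⟨w, hw, rfl⟩ := hv
  rw [LinearEquiv.coe_coe, ← LinearEquiv.mul_apply, inv_mul_cancel]
  exact hw

end Semisimple

end ClassicalGroups

namespace ClassicalGroups

open Polynomial

/-! ### Dual polynomials and the set Φ -/

section DualPoly

variable {F : Type*} [Field F] {σ : F →+* F}

theorem dualPoly_mul (f g : F[X]) : dualPoly σ (f * g) = dualPoly σ f * dualPoly σ g := by
  simp only [dualPoly, mul_coeff_zero, Polynomial.map_mul, reverse_mul_of_domain, map_mul, mul_inv]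
  ring

theorem dualPoly_coeff_zero {f : F[X]} (hf : f.Monic) :
    (dualPoly σ f).coeff 0 = (σ (f.coeff 0))⁻¹ := by
  simp [dualPoly, mul_coeff_zero, coeff_zero_reverse, (hf.map σ).leadingCoeff]

theorem dualPoly_coeff_zero_ne {f : F[X]} (hf : f.Monic) (h0 : f.coeff 0 ≠ 0) :
    (dualPoly σ f).coeff 0 ≠ 0 := by
  rw [dualPoly_coeff_zero hf]
  exact inv_ne_zero ((map_ne_zero σ).2 h0)

theorem natTrailingDegree_map_of_coeff_zero {f : F[X]} (h0 : f.coeff 0 ≠ 0) :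
    (f.map σ).natTrailingDegree = 0 := by
  refine natTrailingDegree_eq_zero_of_constantCoeff_ne_zero ?_
  simpa using h0

theorem natDegree_dualPoly {f : F[X]} (h0 : f.coeff 0 ≠ 0) :
    (dualPoly σ f).natDegree = f.natDegree := by
  rw [dualPoly, natDegree_C_mul (inv_ne_zero ((map_ne_zero σ).2 h0)), reverse_natDegree,
    natTrailingDegree_map_of_coeff_zero h0, natDegree_map, Nat.sub_zero]

theorem dualPoly_monic {f : F[X]} (h0 : f.coeff 0 ≠ 0) : (dualPoly σ f).Monic := by
  rw [Monic, dualPoly, leadingCoeff_mul, leadingCoeff_C, reverse_leadingCoeff, trailingCoeff,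
    natTrailingDegree_map_of_coeff_zero h0, coeff_map]
  exact inv_mul_cancel₀ ((map_ne_zero σ).2 h0)

theorem reverse_reverse_of_coeff_zero {f : F[X]} (h0 : f.coeff 0 ≠ 0) :
    f.reverse.reverse = f := by
  have : f.natTrailingDegree = 0 := natTrailingDegree_eq_zero_of_constantCoeff_ne_zero (by simpa)
  rw [reverse, reverse_natDegree, this, Nat.sub_zero, reverse, reflect_reflect]

theorem dualPoly_dualPoly (hσ : ∀ a, σ (σ a) = a) {f : F[X]} (hf : f.Monic)
    (h0 : f.coeff 0 ≠ 0) : dualPoly σ (dualPoly σ f) = f := by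
  have h1 : (f.map σ).reverse.map σ = f.reverse := by
    have : σ.comp σ = RingHom.id F := RingHom.ext hσ
    rw [reverse, ← reflect_map, Polynomial.map_map, this, Polynomial.map_id, natDegree_map, reverse]
  rw [dualPoly, dualPoly_coeff_zero hf, dualPoly, Polynomial.map_mul, reverse_mul_of_domain,
    h1, reverse_reverse_of_coeff_zero h0, map_C, reverse_C, ← mul_assoc, ← C_mul]
  simp [hσ, h0]

/-- Dualizing is a multiplicative, degree-preserving involution on monic polynomials with non-zero
constant term, so a factorization of `f*` dualizes to one of `f`. -/
theorem dualPoly_irreducible (hσ : ∀ a, σ (σ a) = a) {f : F[X]} (hf : f.Monic)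
    (h0 : f.coeff 0 ≠ 0) (hi : Irreducible f) : Irreducible (dualPoly σ f) := by
  rw [(dualPoly_monic h0).irreducible_iff_natDegree']
  have hi' := hf.irreducible_iff_natDegree'.1 hi
  refine ⟨?_, fun a b ha hb hab hdeg => ?_⟩
  · intro h1
    have := natDegree_dualPoly (σ := σ) h0
    rw [h1, natDegree_one] at this
    exact hi'.1 (hf.natDegree_eq_zero.1 this.symm)
  · have hab0 : a.coeff 0 * b.coeff 0 ≠ 0 := by
      rw [← mul_coeff_zero, hab]; exact dualPoly_coeff_zero_ne hf h0
    have ha0 := left_ne_zero_of_mul hab0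
    have hb0 := right_ne_zero_of_mul hab0
    refine hi'.2 _ _ (dualPoly_monic (σ := σ) ha0) (dualPoly_monic (σ := σ) hb0) ?_ ?_
    · rw [← dualPoly_mul, hab, dualPoly_dualPoly hσ hf h0]
    · rwa [natDegree_dualPoly hb0, ← natDegree_dualPoly (σ := σ) h0]

/-- The polynomials that can be generalized elementary divisors. -/
def IsPhi (σ : F →+* F) (f : F[X]) : Prop := f ∈ Phi1 σ ∨ f ∈ Phi2 σ ∨ f ∈ Phi3 σ

theorem isPhi_irreducible_or {f : F[X]} (hf : IsPhi σ f) :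
    (f.Monic ∧ f.coeff 0 ≠ 0 ∧ Irreducible f ∧ f = dualPoly σ f) ∨ f ∈ Phi2 σ := by
  rcases hf with ⟨h1, h2, h3, h4, -⟩ | h | ⟨h1, h2, h3, h4, -⟩
  exacts [Or.inl ⟨h1, h2, h3, h4⟩, Or.inr h, Or.inl ⟨h1, h2, h3, h4⟩]

theorem IsPhi.coeff_zero_ne {f : F[X]} (hf : IsPhi σ f) : f.coeff 0 ≠ 0 := by
  rcases isPhi_irreducible_or hf with h | ⟨g, h1, h2, h3, h4, rfl⟩
  · exact h.2.1
  · rw [mul_coeff_zero]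
    exact mul_ne_zero h2 (dualPoly_coeff_zero_ne h1 h2)

theorem IsPhi.monic {f : F[X]} (hf : IsPhi σ f) : f.Monic := by
  rcases isPhi_irreducible_or hf with h | ⟨g, h1, h2, h3, h4, rfl⟩
  · exact h.1
  · exact h1.mul (dualPoly_monic h2)

theorem IsPhi.self_dual (hσ : ∀ a, σ (σ a) = a) {f : F[X]} (hf : IsPhi σ f) :
    dualPoly σ f = f := by
  rcases isPhi_irreducible_or hf with h | ⟨g, h1, h2, h3, h4, rfl⟩
  · exact h.2.2.2.symm
  · rw [dualPoly_mul, dualPoly_dualPoly hσ h1 h2, mul_comm]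

theorem exists_isPhi_of_irreducible {h : F[X]} (h1 : h.Monic) (h2 : h.coeff 0 ≠ 0)
    (h3 : Irreducible h) : ∃ f, IsPhi σ f ∧ h ∣ f := by
  by_cases h4 : h = dualPoly σ h
  · refine ⟨h, ?_, dvd_rfl⟩
    rcases (Nat.succ_le_of_lt h3.natDegree_pos).eq_or_lt with hd | hd
    · exact Or.inl ⟨h1, h2, h3, h4, hd.symm⟩
    · exact Or.inr (Or.inr ⟨h1, h2, h3, h4, hd⟩)
  · exact ⟨h * dualPoly σ h, Or.inr (Or.inl ⟨h, h1, h2, h3, h4, rfl⟩), dvd_mul_right _ _⟩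

open Classical in
-- Any monic irreducible divisor determines the member of Φ that it divides. Pairwise coprimality of
-- Φ follows at once.
theorem IsPhi.eq_of_dvd (hσ : ∀ a, σ (σ a) = a) {f h : F[X]} (hf : IsPhi σ f) (h1 : h.Monic)
    (h3 : Irreducible h) (hd : h ∣ f) :
    f = if h = dualPoly σ h then h else h * dualPoly σ h := by
  rcases isPhi_irreducible_or hf with h | ⟨g, g1, g2, g3, g4, rfl⟩
  · have := eq_of_monic_of_associated h1 h.1 (h3.associated_of_dvd h.2.2.1 hd)
    subst this
    rw [if_pos h.2.2.2]
  · rcases h3.prime.dvd_or_dvd hd with hd | hd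
    · have := eq_of_monic_of_associated h1 g1 (h3.associated_of_dvd g3 hd)
      subst this
      rw [if_neg g4]
    · have := eq_of_monic_of_associated h1 (dualPoly_monic g2)
        (h3.associated_of_dvd (dualPoly_irreducible hσ g1 g2 g3) hd)
      subst this
      rw [dualPoly_dualPoly hσ g1 g2, if_neg (Ne.symm g4), mul_comm]

theorem IsPhi.isCoprime (hσ : ∀ a, σ (σ a) = a) {f f' : F[X]} (hf : IsPhi σ f) (hf' : IsPhi σ f')
    (hne : f ≠ f') : IsCoprime f f' := by
  classical
  refine isCoprime_of_irreducible_dvd (fun h => hf.monic.ne_zero h.1) fun z hz h1 h2 => hne ?_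
  have hn := associated_normalize z
  have hm := monic_normalize hz.ne_zero
  have hi := hn.irreducible_iff.1 hz
  rw [hf.eq_of_dvd hσ hm hi (hn.dvd_iff_dvd_left.1 h1),
    hf'.eq_of_dvd hσ hm hi (hn.dvd_iff_dvd_left.1 h2)]

theorem not_isPhi2Factor_of_irreducible {f : F[X]} (hf : Irreducible f) :
    ¬ ∃ g, IsPhi2Factor σ f g := by
  rintro ⟨g, g1, g2, g3, g4, rfl⟩
  rcases of_irreducible_mul hf with h | h
  · exact g3.not_isUnit h
  · have := natDegree_eq_zero_of_isUnit h
    rw [natDegree_dualPoly g2] at this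
    exact g3.natDegree_pos.ne' this

end DualPoly

/-! ### Orthogonality and non-degeneracy of the kernels -/

section Kernels

variable {F V : Type*} [Field F] [AddCommGroup V] [Module F V] {σ : F →+* F} {ε : F}
  {β : V →ₗ[F] V →ₛₗ[σ] F} {x : V ≃ₗ[F] V}

theorem isometry_pow {y : V ≃ₗ[F] V} (hy : y ∈ isometryGroup β) (n : ℕ) (u v : V) :
    β (((y : Module.End F V) ^ n) u) (((y : Module.End F V) ^ n) v) = β u v := by
  induction n with
  | zero => rfl
  | succ n ih =>
    rw [pow_succ', Module.End.mul_apply, Module.End.mul_apply]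
    exact (hy _ _).trans ih

/-- On a monomial this is `β(x^N u, x^(N-n) v) = β(x^n u, v)`, obtained by removing `x^(N-n)` from
both sides. The auxiliary power `x^N` avoids polynomials in `x⁻¹`. -/
theorem form_reflect (hσ : ∀ a, σ (σ a) = a) (hx : x ∈ isometryGroup β) (N : ℕ) (f : F[X])
    (hf : f.natDegree ≤ N) (u v : V) :
    β (((x : Module.End F V) ^ N) u) (aeval (x : Module.End F V) ((f.map σ).reflect N) v) =
      β (aeval (x : Module.End F V) f u) v := by
  revert f
  refine Polynomial.induction_with_natDegree_le _ N ?_ ?_ ?_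
  · simp
  · intro n r _ hn
    have h1 : ((C r * X ^ n : F[X]).map σ).reflect N = C (σ r) * X ^ (N - n) := by
      rw [Polynomial.map_mul, Polynomial.map_pow, map_C, map_X, reflect_C_mul_X_pow,
        revAt_le hn]
    rw [h1]
    simp only [map_mul, aeval_C, map_pow, aeval_X, Module.End.mul_apply,
      Module.algebraMap_end_apply, LinearMap.map_smulₛₗ, LinearMap.smul_apply, hσ, RingHom.id_apply]
    congr 1
    conv_lhs => rw [← Nat.sub_add_cancel hn, pow_add, Module.End.mul_apply, Nat.sub_add_cancel hn]
    exact isometry_pow hx _ _ _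
  · intro f g _ _ hf hg
    rw [Polynomial.map_add, reflect_add, map_add, map_add, LinearMap.add_apply, map_add, hf, hg,
      LinearMap.add_apply, map_add, LinearMap.add_apply]

theorem form_dualPoly (hσ : ∀ a, σ (σ a) = a) (hx : x ∈ isometryGroup β) (f : F[X]) (u v : V) :
    β (((x : Module.End F V) ^ f.natDegree) u) (aeval (x : Module.End F V) (dualPoly σ f) v) =
      (f.coeff 0)⁻¹ * β (aeval (x : Module.End F V) f u) v := by
  rw [dualPoly, map_mul, aeval_C, Module.End.mul_apply, Module.algebraMap_end_apply,
    LinearMap.map_smulₛₗ, map_inv₀, hσ, reverse, natDegree_map, form_reflect hσ hx _ _ le_rfl]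
  rfl

theorem kerEval_invariant (x : V ≃ₗ[F] V) (f : F[X]) {y : V ≃ₗ[F] V} (hy : y * x = x * y) {v : V}
    (hv : v ∈ kerEval x f) : y v ∈ kerEval x f := by
  have h : Commute (y : Module.End F V) (aeval (x : Module.End F V) f) := by
    have hc : Commute (y : Module.End F V) (x : Module.End F V) := by
      ext w
      exact LinearEquiv.congr_fun hy w
    clear hv
    induction f using Polynomial.induction_on' with
    | add f g hf hg => rw [map_add]; exact hf.add_right hg
    | monomial n c =>
      rw [aeval_monomial]
      exact (Algebra.commute_algebraMap_right c _).mul_right (hc.pow_right n)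
  have h2 := LinearMap.congr_fun h.eq v
  rw [Module.End.mul_apply, Module.End.mul_apply, LinearMap.mem_ker.1 hv, map_zero] at h2
  exact h2.symm

/-- Up to a non-zero constant and an application of the bijective power `x ^ deg f`, the operator
`f*(x)` is the adjoint of `f(x)`; the kernel of an adjoint is the orthogonal complement of the
image. -/
theorem mem_kerEval_dualPoly (hβ : IsEpsHermitian ε β) (hx : x ∈ isometryGroup β) {f : F[X]}
    (h0 : f.coeff 0 ≠ 0) (v : V) :
    v ∈ kerEval x (dualPoly σ f) ↔ ∀ u, β (aeval (x : Module.End F V) f u) v = 0 := by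
  constructor
  · intro hv u
    have h := form_dualPoly hβ.invol hx f u v
    rw [LinearMap.mem_ker.1 hv, map_zero, eq_comm, mul_eq_zero] at h
    exact h.resolve_left (inv_ne_zero h0)
  · intro hv
    refine hβ.nondeg_right _ fun u => ?_
    have hu : ((x : Module.End F V) ^ f.natDegree) ((x⁻¹ ^ f.natDegree : V ≃ₗ[F] V) u) = u := by
      rw [Module.End.pow_apply, LinearEquiv.coe_coe, ← LinearEquiv.pow_apply, inv_pow,
        ← LinearEquiv.mul_apply, mul_inv_cancel]
      rfl
    have h := form_dualPoly hβ.invol hx f ((x⁻¹ ^ f.natDegree : V ≃ₗ[F] V) u) v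
    rwa [hu, hv, mul_zero] at h

/-- By the Bézout relation `ker f'(x)` lies in the image of `f(x)`, whose orthogonal complement is
`ker f*(x)`. -/
theorem kerEval_orthogonal (hβ : IsEpsHermitian ε β) (hx : x ∈ isometryGroup β) {f f' : F[X]}
    (h0 : f.coeff 0 ≠ 0) (hc : IsCoprime f f') {u v : V}
    (hu : u ∈ kerEval x (dualPoly σ f)) (hv : v ∈ kerEval x f') : β v u = 0 := by
  obtain ⟨A, B, hAB⟩ := hc
  have hv' : v = aeval (x : Module.End F V) f (aeval (x : Module.End F V) A v) := by
    have h := congrArg (fun q => aeval (x : Module.End F V) q v) hAB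
    simp only [map_add, map_mul, LinearMap.add_apply, Module.End.mul_apply, map_one,
      LinearMap.mem_ker.1 hv, map_zero, add_zero, Module.End.one_apply] at h
    rw [← Module.End.mul_apply, ← map_mul, mul_comm, map_mul, Module.End.mul_apply, h]
  rw [hv']
  exact (mem_kerEval_dualPoly hβ hx h0 u).1 hu _

variable [FiniteDimensional F V]

/-- By semisimplicity `V` is the sum of the kernel and the image of `f(x)`. As `f = f*`, the image
is orthogonal to the kernel, so a radical vector of the kernel is orthogonal to all of `V`. -/
theorem kerEval_nondeg (hβ : IsEpsHermitian ε β) (hx : x ∈ isometryGroup β)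
    (hs : Module.End.IsSemisimple (x : Module.End F V)) {f : F[X]} (h0 : f.coeff 0 ≠ 0)
    (hf : dualPoly σ f = f) (u : V) (hu : u ∈ kerEval x f)
    (h : ∀ v ∈ kerEval x f, β u v = 0) : u = 0 := by
  refine hβ.nondeg_right u fun w => ?_
  obtain ⟨a, ha, b, hb, rfl⟩ := Submodule.mem_sup.1
    ((isCompl_ker_range hs f).sup_eq_top ▸ Submodule.mem_top : w ∈ _)
  obtain ⟨t, rfl⟩ := hb
  rw [map_add, LinearMap.add_apply, hβ.eq_zero_symm (h a ha),
    (mem_kerEval_dualPoly hβ hx h0 u).1 (by rwa [hf]), add_zero]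

variable [Finite F]

/-- Otherwise the orthogonal complement of the sum is a non-zero invariant subspace and contains
some `w ≠ 0` killed by an irreducible `g`. Then `w` lies in the kernel of a member of Φ divisible by
`g` and is orthogonal to that kernel, contradicting its non-degeneracy. -/
theorem iSup_kerEval (hβ : IsEpsHermitian ε β) (hx : x ∈ isometryGroup β)
    (hs : Module.End.IsSemisimple (x : Module.End F V)) {ι : Type*} (P : ι → F[X])
    (hP : ∀ f, IsPhi σ f → kerEval x f ≠ ⊥ → ∃ i, P i = f) : ⨆ i, kerEval x (P i) = ⊤ := by
  by_contra hT
  set T := ⨆ i, kerEval x (P i) with hTdef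
  have hTx : ∀ v ∈ T, x v ∈ T := by
    intro v hv
    have hle : T ≤ T.comap (x : V →ₗ[F] V) := iSup_le fun i w hw =>
      Submodule.mem_iSup_of_mem i (kerEval_invariant x (P i) rfl hw)
    exact hle hv
  have hox : ∀ v ∈ orth β T, (x : Module.End F V) v ∈ orth β T := by
    intro v hv u hu
    have h := hv (x⁻¹ u) (inv_mem_of_invariant hTx hu)
    rw [← hx, ← LinearEquiv.mul_apply, mul_inv_cancel] at h
    exact h
  have ho : orth β T ≠ ⊥ := by
    obtain ⟨v, -, hv⟩ := SetLike.exists_of_lt (lt_top_iff_ne_top.2 hT)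
    obtain ⟨k, hk, hk'⟩ := hβ.exists_orth_of_notMem hv
    exact fun h0 => hk' (by rw [(Submodule.mem_bot F).1 (h0 ▸ hk : k ∈ (⊥ : Submodule F V)),
      map_zero])
  obtain ⟨g, w, g1, g2, hw, hw0, hgw⟩ := exists_irreducible_kill hox ho
  -- The only monic irreducible with zero constant term is `X`, and `x` is injective.
  have g0 : g.coeff 0 ≠ 0 := by
    intro h0
    have hX : g = X := eq_of_monic_of_associated g1 monic_X
      (irreducible_X.associated_of_dvd g2 (X_dvd_iff.2 h0)).symm
    rw [hX, aeval_X] at hgw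
    exact hw0 ((LinearEquiv.map_eq_zero_iff x).1 hgw)
  obtain ⟨f, hf, e, he⟩ := exists_isPhi_of_irreducible (σ := σ) g1 g0 g2
  have hwf : w ∈ kerEval x f := by
    rw [kerEval, LinearMap.mem_ker, he, mul_comm, map_mul, Module.End.mul_apply, hgw, map_zero]
  obtain ⟨i, rfl⟩ := hP f hf fun h => hw0 (by simpa [h] using hwf)
  refine hw0 (kerEval_nondeg hβ hx hs hf.coeff_zero_ne (hf.self_dual hβ.invol) w hwf fun v hv => ?_)
  exact hβ.eq_zero_symm (hw v (Submodule.mem_iSup_of_mem i hv))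

end Kernels

end ClassicalGroups

namespace ClassicalGroups

open Polynomial

/-! ### Multiplicities of elementary divisors as dimensions of kernels -/

section Multiplicity

variable {F V : Type*} [Field F] [AddCommGroup V] [Module F V] [FiniteDimensional F V]

open Classical in
-- For semisimple `x` all elementary divisors are irreducible, so `ker g(x)` is exactly the sum of
-- those cyclic summands whose divisor equals `g`; the other summands meet it trivially by
-- coprimality.
theorem count_elementaryDivisors {x : V ≃ₗ[F] V}
    (hs : Module.End.IsSemisimple (x : Module.End F V)) {g : F[X]} (hg : g.Monic)
    (hi : Irreducible g) :
    (elementaryDivisors x).count g * g.natDegree = Module.finrank F (kerEval x g) := by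
  obtain ⟨hel, n, q, hq, ⟨E⟩⟩ := elementaryDivisors_spec x
  have hq' : ∀ i, (q i).Monic ∧ Irreducible (q i) := by
    intro i
    obtain ⟨f, e, h1, h2, h3, h4⟩ := hel (q i) (by rw [hq]; exact Multiset.mem_map_of_mem _ (by simp))
    have hdvd : q i ∣ minpoly F (x : Module.End F V) := by
      -- The minimal polynomial annihilates the generator of the `i`-th cyclic summand, hence is
      -- divisible by `q i`. As it is squarefree, the exponent `e` must be one.
      have h5 : minpoly F (x : Module.End F V) • E.symm (Pi.single i 1) = 0 := by
        obtain ⟨v, hv⟩ := (Module.AEval'.of (x : Module.End F V)).surjective (E.symm (Pi.single i 1))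
        rw [← hv, Module.AEval'.of, ← Module.AEval.of_aeval_smul, minpoly.aeval, zero_smul, map_zero]
      rw [← map_smul, LinearEquiv.map_eq_zero_iff] at h5
      have h6 := congrFun h5 i
      rw [Pi.smul_apply, Pi.single_eq_same, Pi.zero_apply] at h6
      have h7 : Ideal.Quotient.mk (Ideal.span {q i}) (minpoly F (x : Module.End F V)) = 0 := by
        rw [← h6, ← mul_one (Ideal.Quotient.mk (Ideal.span {q i}) (minpoly F (x : Module.End F V)))]
        rfl
      exact Ideal.mem_span_singleton.1 (Ideal.Quotient.eq_zero_iff_mem.1 h7)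
    have he : e = 1 := by
      by_contra hne
      have hsq := hs.minpoly_squarefree.squarefree_of_dvd hdvd
      refine h2.not_isUnit (hsq f ?_)
      rw [h4, ← sq]
      exact pow_dvd_pow f (by omega)
    rw [h4, he, pow_one]
    exact ⟨h1, h2⟩
  let o := Module.AEval'.of (x : Module.End F V)
  have hact : ∀ (f : F[X]) (v : V) (i : Fin n),
      E (o (aeval (x : Module.End F V) f v)) i = f • E (o v) i := by
    intro f v i
    rw [← Pi.smul_apply, ← map_smul]
    rfl
  let L : kerEval x g →ₗ[F] (∀ i : {i // q i = g}, F[X] ⧸ Ideal.span {q i.1}) :=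
    { toFun := fun v i => E (o v) i.1
      map_add' := fun v w => by ext i; simp
      map_smul' := fun c v => by
        ext i
        have h := hact (C c) (v : V) i.1
        rw [aeval_C, Module.algebraMap_end_apply] at h
        rw [Submodule.coe_smul, h, Pi.smul_apply, RingHom.id_apply, C_eq_algebraMap,
          algebraMap_smul] }
  have hzero : ∀ v ∈ kerEval x g, ∀ i, q i ≠ g → E (o v) i = 0 := by
    intro v hv i hne
    have hco : IsCoprime g (q i) := by
      refine hi.coprime_iff_not_dvd.2 fun hd => hne ?_
      exact (eq_of_monic_of_associated hg (hq' i).1 (hi.associated_of_dvd (hq' i).2 hd)).symm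
    obtain ⟨A, B, hAB⟩ := hco
    have h1 : g • E (o v) i = 0 := by
      rw [← hact, LinearMap.mem_ker.1 hv]; simp
    have h2 : q i • E (o v) i = 0 := by
      obtain ⟨r, hr⟩ := Ideal.Quotient.mk_surjective (E (o v) i)
      rw [← hr]
      change Ideal.Quotient.mk _ (q i * r) = 0
      exact Ideal.Quotient.eq_zero_iff_mem.2 (Ideal.mul_mem_right _ _ (Ideal.mem_span_singleton_self _))
    rw [← one_smul F[X] (E (o v) i), ← hAB, add_smul, mul_smul, mul_smul, h1, h2, smul_zero,
      smul_zero, add_zero]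
  have hL : Function.Bijective L := by
    constructor
    · intro v w hvw
      apply Subtype.ext
      apply o.injective
      apply E.injective
      ext i
      by_cases h : q i = g
      · exact congrFun hvw ⟨i, h⟩
      · rw [hzero v v.2 i h, hzero w w.2 i h]
    · intro b
      let w : ∀ i, F[X] ⧸ Ideal.span {q i} := fun i => if h : q i = g then b ⟨i, h⟩ else 0
      let v : V := o.symm (E.symm w)
      have hv : E (o v) = w := by simp [v]
      refine ⟨⟨v, ?_⟩, ?_⟩
      · rw [kerEval, LinearMap.mem_ker]
        apply o.injective
        apply E.injective
        ext i
        rw [hact, hv, map_zero, map_zero, Pi.zero_apply]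
        by_cases h : q i = g
        · obtain ⟨r, hr⟩ := Ideal.Quotient.mk_surjective (w i)
          rw [← hr]
          change Ideal.Quotient.mk _ (g * r) = 0
          rw [Ideal.Quotient.eq_zero_iff_mem]
          conv => enter [1, 1, 1]; rw [h]
          exact Ideal.mul_mem_right _ _ (Ideal.mem_span_singleton_self _)
        · simp [w, h]
      · ext i
        change E (o v) i.1 = b i
        rw [hv]
        simp [w, i.2]
  rw [(LinearEquiv.ofBijective L hL).finrank_eq]
  have hfin : ∀ i, Module.Finite F (F[X] ⧸ Ideal.span {q i}) := fun i =>
    (AdjoinRoot.powerBasis (hq' i).1.ne_zero).finite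
  rw [Module.finrank_pi_fintype]
  have hdeg : ∀ i : {i // q i = g}, Module.finrank F (F[X] ⧸ Ideal.span {q i.1}) = g.natDegree := by
    intro i
    rw [finrank_quotient_span_eq_natDegree, i.2]
  rw [Finset.sum_congr rfl fun i _ => hdeg i, Finset.sum_const, smul_eq_mul, Finset.card_univ,
    Fintype.card_subtype, hq, Multiset.count_map]
  congr 1
  rw [Finset.card_def, Finset.filter_val]
  congr 2
  ext i
  exact eq_comm

variable {σ : F →+* F} {x : V ≃ₗ[F] V}

theorem genMult_mul_natDegree (hs : Module.End.IsSemisimple (x : Module.End F V)) {f : F[X]}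
    (h1 : f.Monic) (h3 : Irreducible f) :
    genMult σ x f 1 * f.natDegree = Module.finrank F (kerEval x f) := by
  rw [genMult, dif_neg (not_isPhi2Factor_of_irreducible h3), pow_one,
    count_elementaryDivisors hs h1 h3]

/-- The multiplicity of `f = g g*` is defined through a chosen factor, so only the existence of a
suitable `g` is asserted. -/
theorem exists_genMult_mul_natDegree (hs : Module.End.IsSemisimple (x : Module.End F V)) {f : F[X]}
    (hf : f ∈ Phi2 σ) : ∃ g, IsPhi2Factor σ f g ∧
      genMult σ x f 1 * g.natDegree = Module.finrank F (kerEval x g) := by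
  have hf' : ∃ g, IsPhi2Factor σ f g := hf
  refine ⟨hf'.choose, hf'.choose_spec, ?_⟩
  rw [genMult, dif_pos hf', pow_one,
    count_elementaryDivisors hs hf'.choose_spec.1 hf'.choose_spec.2.2.1]

/-- This guarantees that no kernel is lost when the index set is cut down to the generalized
elementary divisors. For `f = g g*`, triviality of `ker g(x)` makes `g(x)` surjective, so `ker
g*(x)`, the orthogonal complement of its image, is trivial as well. -/
theorem genMult_pos [Finite F] {ε : F} {β : V →ₗ[F] V →ₛₗ[σ] F} (hβ : IsEpsHermitian ε β)
    (hx : x ∈ isometryGroup β) (hs : Module.End.IsSemisimple (x : Module.End F V)) {f : F[X]}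
    (hf : IsPhi σ f) (hker : kerEval x f ≠ ⊥) : 0 < genMult σ x f 1 := by
  rw [Nat.pos_iff_ne_zero]
  intro h0
  rcases isPhi_irreducible_or hf with h | h
  · have h1 := genMult_mul_natDegree (σ := σ) hs h.1 h.2.2.1
    rw [h0, zero_mul] at h1
    exact hker (Submodule.finrank_eq_zero.1 h1.symm)
  · obtain ⟨g, ⟨g1, g2, g3, g4, rfl⟩, h1⟩ := exists_genMult_mul_natDegree hs h
    rw [h0, zero_mul] at h1
    have hk := Submodule.finrank_eq_zero.1 h1.symm
    have hsurj : Function.Surjective (aeval (x : Module.End F V) g) :=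
      LinearMap.injective_iff_surjective.1 (LinearMap.ker_eq_bot.1 hk)
    have hk' : ∀ v ∈ kerEval x (dualPoly σ g), v = 0 := by
      intro v hv
      refine hβ.nondeg_right v fun u => ?_
      obtain ⟨t, rfl⟩ := hsurj u
      exact (mem_kerEval_dualPoly hβ hx g2 v).1 hv t
    refine hker ((Submodule.eq_bot_iff _).2 fun v hv => ?_)
    rw [kerEval, LinearMap.mem_ker, map_mul, Module.End.mul_apply] at hv
    have h5 : aeval (x : Module.End F V) (dualPoly σ g) v ∈ kerEval x g := hv
    rw [hk] at h5
    exact hk' v ((Submodule.mem_bot F).1 h5)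

end Multiplicity

end ClassicalGroups

namespace ClassicalGroups

open Polynomial

/-! ### The centralizer as a product over the generalized elementary divisors -/

section Glue

variable {F V : Type*} [Field F] [AddCommGroup V] [Module F V]

theorem comm_of_mem_centralizer {x y : V ≃ₗ[F] V}
    (hy : y ∈ Subgroup.centralizer ({x} : Set (V ≃ₗ[F] V))) : y * x = x * y :=
  (Subgroup.mem_centralizer_iff.1 hy x rfl).symm

theorem mem_centralizer_of_comm {x y : V ≃ₗ[F] V} (hy : y * x = x * y) :
    y ∈ Subgroup.centralizer ({x} : Set (V ≃ₗ[F] V)) :=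
  Subgroup.mem_centralizer_iff.2 fun _ h => by rw [Set.mem_singleton_iff.1 h, hy]

theorem mem_centralizerIn {G : Subgroup (V ≃ₗ[F] V)} {x y : V ≃ₗ[F] V} :
    y ∈ centralizerIn G x ↔ y * x = x * y ∧ y ∈ G :=
  ⟨fun h => ⟨comm_of_mem_centralizer h.1, h.2⟩, fun h => ⟨mem_centralizer_of_comm h.1, h.2⟩⟩

/-- The restriction to `ker f(x)` of elements of the centralizer of `x`. -/
noncomputable def kerRestrict (x : V ≃ₗ[F] V) (f : F[X]) :
    Subgroup.centralizer ({x} : Set (V ≃ₗ[F] V)) →* (kerEval x f ≃ₗ[F] kerEval x f) where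
  toFun y :=
    { toFun := fun v =>
        ⟨(y : V ≃ₗ[F] V) v, kerEval_invariant x f (comm_of_mem_centralizer y.2) v.2⟩
      invFun := fun v =>
        ⟨(y⁻¹ : Subgroup.centralizer ({x} : Set (V ≃ₗ[F] V))).1 v,
          kerEval_invariant x f (comm_of_mem_centralizer y⁻¹.2) v.2⟩
      map_add' := fun v w => Subtype.ext (map_add y.1 _ _)
      map_smul' := fun c v => Subtype.ext (map_smul y.1 _ _)
      left_inv := fun v => Subtype.ext (by
        change ((y⁻¹ * y : Subgroup.centralizer ({x} : Set (V ≃ₗ[F] V))) : V ≃ₗ[F] V) v = v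
        rw [inv_mul_cancel]; rfl)
      right_inv := fun v => Subtype.ext (by
        change ((y * y⁻¹ : Subgroup.centralizer ({x} : Set (V ≃ₗ[F] V))) : V ≃ₗ[F] V) v = v
        rw [mul_inv_cancel]; rfl) }
  map_one' := rfl
  map_mul' _ _ := rfl

/-- The restriction of `x` to `ker f(x)`. -/
noncomputable def selfRestrict (x : V ≃ₗ[F] V) (f : F[X]) : kerEval x f ≃ₗ[F] kerEval x f :=
  kerRestrict x f ⟨x, mem_centralizer_of_comm rfl⟩

theorem selfRestrict_apply (x : V ≃ₗ[F] V) (f : F[X]) (v : kerEval x f) :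
    (selfRestrict x f v : V) = x v := rfl

theorem exists_linearEquiv_of_isInternal {ι : Type*} [DecidableEq ι] {A : ι → Submodule F V}
    (hA : DirectSum.IsInternal A) (z : ∀ i, A i ≃ₗ[F] A i) :
    ∃ y : V ≃ₗ[F] V, ∀ i (v : A i), y v = z i v := by
  let e := LinearEquiv.ofBijective (DirectSum.coeLinearMap A) hA
  have hev : ∀ i (v : A i), e (DirectSum.lof F ι (fun i => A i) i v) = v := fun i v =>
    DirectSum.coeLinearMap_lof A i v
  refine ⟨e.symm.trans ((DFinsupp.mapRange.linearEquiv z).trans e), fun i v => ?_⟩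
  have h1 : e.symm v = DirectSum.lof F ι (fun i => A i) i v := by
    rw [LinearEquiv.symm_apply_eq, hev]
  rw [LinearEquiv.trans_apply, LinearEquiv.trans_apply, h1, ← hev i (z i v)]
  congr 1
  exact DFinsupp.mapRange_single (hf := fun i => map_zero (z i))

/-- Membership in `G` is assumed to be decided piece by piece, so one gluing argument serves
sesquilinear and quadratic forms. The final clause identifies the isomorphism as restriction. -/
theorem exists_glue {x : V ≃ₗ[F] V} {ι : Type*} [DecidableEq ι] (P : ι → F[X])
    (hint : DirectSum.IsInternal fun i => kerEval x (P i)) (G : Subgroup (V ≃ₗ[F] V))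
    (Gf : ∀ i, Subgroup (kerEval x (P i) ≃ₗ[F] kerEval x (P i)))
    (hG : ∀ y : Subgroup.centralizer ({x} : Set (V ≃ₗ[F] V)),
      (y : V ≃ₗ[F] V) ∈ G ↔ ∀ i, kerRestrict x (P i) y ∈ Gf i) :
    ∃ φ : centralizerIn G x ≃* (∀ i, centralizerIn (Gf i) (selfRestrict x (P i))),
      ∀ y i v, ((φ y i : kerEval x (P i) ≃ₗ[F] kerEval x (P i)) v : V) = (y : V ≃ₗ[F] V) v := by
  let ψ : centralizerIn G x →* (∀ i, centralizerIn (Gf i) (selfRestrict x (P i))) :=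
    { toFun := fun y i => ⟨kerRestrict x (P i) ⟨y, y.2.1⟩, mem_centralizerIn.2 ⟨by
          rw [selfRestrict, ← map_mul, ← map_mul]
          congr 1
          exact Subtype.ext (comm_of_mem_centralizer y.2.1), (hG ⟨y, y.2.1⟩).1 y.2.2 i⟩⟩
      map_one' := rfl
      map_mul' := fun _ _ => rfl }
  have hψ : ∀ y i v, ((ψ y i : kerEval x (P i) ≃ₗ[F] kerEval x (P i)) v : V) =
    (y : V ≃ₗ[F] V) v := fun y i v => rfl
  have htop : ⨆ i, kerEval x (P i) = ⊤ := hint.submodule_iSup_eq_top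
  have hext : ∀ y z : V ≃ₗ[F] V, (∀ i, ∀ v ∈ kerEval x (P i), y v = z v) → y = z := by
    intro y z h
    ext v
    have hv : v ∈ ⨆ i, kerEval x (P i) := htop ▸ Submodule.mem_top
    induction hv using Submodule.iSup_induction' with
    | mem i v hv => exact h i v hv
    | zero => rw [map_zero, map_zero]
    | add v w _ _ hv hw => rw [map_add, map_add, hv, hw]
  have hinj : Function.Injective ψ := by
    intro y z hyz
    refine Subtype.ext (hext _ _ fun i v hv => ?_)
    have h1 := hψ y i ⟨v, hv⟩
    have h2 := hψ z i ⟨v, hv⟩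
    rw [hyz] at h1
    exact h1.symm.trans h2
  have hsurj : Function.Surjective ψ := by
    intro z
    obtain ⟨y, hy⟩ := exists_linearEquiv_of_isInternal hint
      (fun i => (z i : kerEval x (P i) ≃ₗ[F] kerEval x (P i)))
    have hyx : y * x = x * y := by
      refine hext _ _ fun i v hv => ?_
      have h1 := congrArg Subtype.val
        (LinearEquiv.congr_fun (mem_centralizerIn.1 (z i).2).1 ⟨v, hv⟩)
      rw [LinearEquiv.mul_apply, LinearEquiv.mul_apply, ← hy, selfRestrict_apply,
        selfRestrict_apply, ← hy] at h1
      exact h1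
    have hres : ∀ i, kerRestrict x (P i) ⟨y, mem_centralizer_of_comm hyx⟩ =
        (z i : kerEval x (P i) ≃ₗ[F] kerEval x (P i)) := by
      intro i
      ext v
      exact hy i v
    refine ⟨⟨y, mem_centralizerIn.2 ⟨hyx, (hG ⟨y, mem_centralizer_of_comm hyx⟩).2 fun i => ?_⟩⟩, ?_⟩
    · rw [hres]
      exact (mem_centralizerIn.1 (z i).2).2
    · ext i : 1
      exact Subtype.ext (hres i)
  exact ⟨MulEquiv.ofBijective ψ ⟨hinj, hsurj⟩, hψ⟩

variable {σ : F →+* F} {ε : F} {β : V →ₗ[F] V →ₛₗ[σ] F} {x : V ≃ₗ[F] V}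

/-- On the kernel of `f = t + f(0)` the operator `x` is the scalar `-f(0)`, with which everything
commutes. -/
theorem centralizerIn_eq_of_phi1 {f : F[X]} (hf : f ∈ Phi1 σ)
    (G : Subgroup (kerEval x f ≃ₗ[F] kerEval x f)) :
    centralizerIn G (selfRestrict x f) = G := by
  refine inf_eq_right.2 fun y _ => mem_centralizer_of_comm ?_
  have hsc : ∀ v : kerEval x f, selfRestrict x f v = (-f.coeff 0) • v := by
    intro v
    have h2 : f = X + C (f.coeff 0) := by
      conv_lhs => rw [eq_X_add_C_of_natDegree_le_one hf.2.2.2.2.le]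
      have := hf.1.coeff_natDegree
      rw [hf.2.2.2.2] at this
      rw [this, C_1, one_mul]
    have h3 : aeval (x : Module.End F V) f = (x : Module.End F V) +
        algebraMap F (Module.End F V) (f.coeff 0) := by
      conv_lhs => rw [h2]
      rw [map_add, aeval_X, aeval_C]
    have h1 : aeval (x : Module.End F V) f (v : V) = 0 := v.2
    rw [h3, LinearMap.add_apply, Module.algebraMap_end_apply] at h1
    refine Subtype.ext ?_
    rw [selfRestrict_apply, Submodule.coe_smul, neg_smul]
    exact eq_neg_of_add_eq_zero_left h1
  ext v : 1
  rw [LinearEquiv.mul_apply, LinearEquiv.mul_apply, hsc, hsc, map_smul]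

/-- The index set of all generalized elementary divisors. -/
abbrev GenIndex [FiniteDimensional F V] (σ : F →+* F) (x : V ≃ₗ[F] V) : Type _ :=
  GenDivisorsIn σ x (Phi1 σ) ⊕ GenDivisorsIn σ x (Phi2 σ) ⊕ GenDivisorsIn σ x (Phi3 σ)

/-- The polynomial attached to an index. -/
noncomputable def genPoly [FiniteDimensional F V] (σ : F →+* F) (x : V ≃ₗ[F] V) : GenIndex σ x → F[X] :=
  Sum.elim (fun f => f.1) (Sum.elim (fun f => f.1) (fun f => f.1))

variable [FiniteDimensional F V]

theorem genPoly_isPhi (i : GenIndex σ x) : IsPhi σ (genPoly σ x i) := by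
  rcases i with f | f | f
  exacts [Or.inl f.2.1, Or.inr (Or.inl f.2.1), Or.inr (Or.inr f.2.1)]

theorem genPoly_injective : Function.Injective (genPoly σ x) := by
  have h13 : ∀ f : F[X], f ∈ Phi1 σ → f ∈ Phi3 σ → False := fun f h h' =>
    absurd h.2.2.2.2 h'.2.2.2.2.ne'
  have h12 : ∀ f : F[X], f ∈ Phi1 σ → f ∈ Phi2 σ → False := fun f h h' =>
    not_isPhi2Factor_of_irreducible h.2.2.1 h'
  have h32 : ∀ f : F[X], f ∈ Phi3 σ → f ∈ Phi2 σ → False := fun f h h' =>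
    not_isPhi2Factor_of_irreducible h.2.2.1 h'
  rintro (⟨f, hf, _⟩ | ⟨f, hf, _⟩ | ⟨f, hf, _⟩) (⟨g, hg, _⟩ | ⟨g, hg, _⟩ | ⟨g, hg, _⟩) hfg <;>
  simp only [genPoly, Sum.elim_inl, Sum.elim_inr] at hfg <;> subst hfg
  · rfl
  · exact (h12 _ hf hg).elim
  · exact (h13 _ hf hg).elim
  · exact (h12 _ hg hf).elim
  · rfl
  · exact (h32 _ hg hf).elim
  · exact (h13 _ hg hf).elim
  · exact (h32 _ hf hg).elim
  · rfl

theorem genPoly_orthogonal (hβ : IsEpsHermitian ε β) (hx : x ∈ isometryGroup β)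
    {i j : GenIndex σ x} (hij : i ≠ j) {u v : V} (hu : u ∈ kerEval x (genPoly σ x i))
    (hv : v ∈ kerEval x (genPoly σ x j)) : β u v = 0 := by
  refine kerEval_orthogonal hβ hx (genPoly_isPhi j).coeff_zero_ne
    ((genPoly_isPhi j).isCoprime hβ.invol (genPoly_isPhi i) fun h => hij (genPoly_injective h).symm)
    (by rwa [(genPoly_isPhi j).self_dual hβ.invol]) hu

variable [Finite F]

/-- Independence follows from orthogonality: a vector of one piece lying in the sum of the others is
orthogonal to its own, non-degenerate, piece. -/
theorem isInternal_genPoly [DecidableEq (GenIndex σ x)] (hβ : IsEpsHermitian ε β)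
    (hx : x ∈ isometryGroup β) (hs : Module.End.IsSemisimple (x : Module.End F V)) :
    DirectSum.IsInternal fun i => kerEval x (genPoly σ x i) := by
  refine DirectSum.isInternal_submodule_of_iSupIndep_of_iSup_eq_top ?_ ?_
  · rw [iSupIndep_def]
    intro i
    rw [Submodule.disjoint_def]
    intro v hv hv'
    refine kerEval_nondeg hβ hx hs (genPoly_isPhi i).coeff_zero_ne
      ((genPoly_isPhi i).self_dual hβ.invol) v hv fun w hw => hβ.eq_zero_symm ?_
    have hle : ⨆ j, ⨆ (_ : j ≠ i), kerEval x (genPoly σ x j) ≤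
        orth β (kerEval x (genPoly σ x i)) :=
      iSup_le fun j => iSup_le fun hj a ha b hb => genPoly_orthogonal hβ hx hj.symm hb ha
    exact hle hv' w hw
  · refine iSup_kerEval hβ hx hs _ fun f hf hker => ?_
    have hpos := genMult_pos hβ hx hs hf hker
    rcases hf with hf | hf | hf
    exacts [⟨Sum.inl ⟨f, hf, hpos⟩, rfl⟩, ⟨Sum.inr (Sum.inl ⟨f, hf, hpos⟩), rfl⟩,
      ⟨Sum.inr (Sum.inr ⟨f, hf, hpos⟩), rfl⟩]

theorem mem_isometryGroup_iff_genPoly (hβ : IsEpsHermitian ε β) (hx : x ∈ isometryGroup β)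
    (hs : Module.End.IsSemisimple (x : Module.End F V))
    (y : Subgroup.centralizer ({x} : Set (V ≃ₗ[F] V))) :
    (y : V ≃ₗ[F] V) ∈ isometryGroup β ↔ ∀ i : GenIndex σ x, kerRestrict x (genPoly σ x i) y ∈
      isometryGroup (β.domRestrict₁₂ (kerEval x (genPoly σ x i)) (kerEval x (genPoly σ x i))) := by
  classical
  refine ⟨fun h i u v => h u v, fun h => ?_⟩
  have htop := (isInternal_genPoly hβ hx hs).submodule_iSup_eq_top
  intro u v
  have hu : u ∈ ⨆ i, kerEval x (genPoly σ x i) := htop ▸ Submodule.mem_top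
  have hv : v ∈ ⨆ i, kerEval x (genPoly σ x i) := htop ▸ Submodule.mem_top
  induction hu using Submodule.iSup_induction' with
  | zero => simp
  | add a b _ _ ha hb => simp only [map_add, LinearMap.add_apply, ha, hb]
  | mem i u hu =>
    induction hv using Submodule.iSup_induction' with
    | zero => simp
    | add a b _ _ ha hb => simp only [map_add, ha, hb]
    | mem j v hv =>
      by_cases hij : i = j
      · subst hij
        exact h i ⟨u, hu⟩ ⟨v, hv⟩
      · rw [genPoly_orthogonal hβ hx hij hu hv]
        exact genPoly_orthogonal hβ hx hij
          (kerEval_invariant x _ (comm_of_mem_centralizer y.2) hu)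
          (kerEval_invariant x _ (comm_of_mem_centralizer y.2) hv)

/-- The Φ₂ and Φ₃ factors are needed only up to isomorphism. The Φ₁ components are tracked
explicitly, because the description of the Omega group refers to them. -/
theorem exists_centralizer_equiv (hβ : IsEpsHermitian ε β) (hx : x ∈ isometryGroup β)
    (hs : Module.End.IsSemisimple (x : Module.End F V)) (G : Subgroup (V ≃ₗ[F] V))
    (Gf : ∀ f : F[X], Subgroup (kerEval x f ≃ₗ[F] kerEval x f))
    (hG : ∀ y : Subgroup.centralizer ({x} : Set (V ≃ₗ[F] V)),
      (y : V ≃ₗ[F] V) ∈ G ↔ ∀ i, kerRestrict x (genPoly σ x i) y ∈ Gf (genPoly σ x i))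
    (H₂ : GenDivisorsIn σ x (Phi2 σ) → Type*) [∀ f, Group (H₂ f)]
    (H₃ : GenDivisorsIn σ x (Phi3 σ) → Type*) [∀ f, Group (H₃ f)]
    (e₂ : ∀ f, Nonempty (centralizerIn (Gf f.1) (selfRestrict x f.1) ≃* H₂ f))
    (e₃ : ∀ f, Nonempty (centralizerIn (Gf f.1) (selfRestrict x f.1) ≃* H₃ f)) :
    ∃ φ : centralizerIn G x ≃*
        (∀ f : GenDivisorsIn σ x (Phi1 σ), Gf f.1) × (∀ f, H₂ f) × (∀ f, H₃ f),
      ∀ y f v, (((φ y).1 f : kerEval x f.1 ≃ₗ[F] kerEval x f.1) v : V) = (y : V ≃ₗ[F] V) v := by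
  classical
  obtain ⟨ψ, hψ⟩ := exists_glue (genPoly σ x) (isInternal_genPoly hβ hx hs) G
    (fun i => Gf (genPoly σ x i)) hG
  have e₁ : ∀ f : GenDivisorsIn σ x (Phi1 σ),
      ∃ e : centralizerIn (Gf f.1) (selfRestrict x f.1) ≃* Gf f.1,
        ∀ z, (e z : kerEval x f.1 ≃ₗ[F] kerEval x f.1) = z := fun f =>
    ⟨MulEquiv.subgroupCongr (centralizerIn_eq_of_phi1 f.2.1 _), fun _ => rfl⟩
  choose E₁ hE₁ using e₁
  let E₂ := fun f => (e₂ f).some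
  let E₃ := fun f => (e₃ f).some
  let split : (∀ i, centralizerIn (Gf (genPoly σ x i)) (selfRestrict x (genPoly σ x i))) ≃*
      (∀ f : GenDivisorsIn σ x (Phi1 σ), Gf f.1) × (∀ f, H₂ f) × (∀ f, H₃ f) :=
    { toFun := fun z => (fun f => E₁ f (z (Sum.inl f)), fun f => E₂ f (z (Sum.inr (Sum.inl f))),
        fun f => E₃ f (z (Sum.inr (Sum.inr f))))
      invFun := fun z i => match i with
        | Sum.inl f => (E₁ f).symm (z.1 f)
        | Sum.inr (Sum.inl f) => (E₂ f).symm (z.2.1 f)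
        | Sum.inr (Sum.inr f) => (E₃ f).symm (z.2.2 f)
      left_inv := by
        intro z
        funext i
        rcases i with f | f | f
        exacts [(E₁ f).symm_apply_apply _, (E₂ f).symm_apply_apply _, (E₃ f).symm_apply_apply _]
      right_inv := by
        intro z
        refine Prod.ext (funext fun f => ?_) (Prod.ext (funext fun f => ?_) (funext fun f => ?_))
        exacts [(E₁ f).apply_symm_apply _, (E₂ f).apply_symm_apply _, (E₃ f).apply_symm_apply _]
      map_mul' := by
        intro z w
        refine Prod.ext (funext fun f => ?_) (Prod.ext (funext fun f => ?_) (funext fun f => ?_))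
        exacts [map_mul (E₁ f) _ _, map_mul (E₂ f) _ _, map_mul (E₃ f) _ _] }
  refine ⟨ψ.trans split, fun y f v => ?_⟩
  exact (congrArg (fun t : kerEval x f.1 ≃ₗ[F] kerEval x f.1 => (t v : V)) (hE₁ f _)).trans
    (hψ y (Sum.inl f) v)

end Glue

end ClassicalGroups

namespace ClassicalGroups

open Polynomial

/-! ### The action of `F[t]/(g)` and its commutant -/

section FieldAction

variable {F W : Type*} [Field F] [AddCommGroup W] [Module F W]

theorem card_adjoinRoot [Finite F] {g : F[X]} (hg : g.Monic) :
    Nat.card (AdjoinRoot g) = Nat.card F ^ g.natDegree := by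
  have : Module.Finite F (AdjoinRoot g) := (AdjoinRoot.powerBasis' hg).finite
  rw [Module.natCard_eq_pow_finrank (K := F) (V := AdjoinRoot g)]
  congr 1
  exact finrank_quotient_span_eq_natDegree

/-- An irreducible `g` annihilating `a` turns `W` into a vector space over `F[t]/(g)`. That field is
transported to an arbitrary `L` of the same size, so that a Galois field can be substituted. -/
theorem exists_field_action [Finite F] {a : Module.End F W} {g : F[X]} (hg : g.Monic)
    (hi : Irreducible g) (ha : aeval a g = 0) (L : Type*) [Field L] [Finite L]
    (hL : Nat.card L = Nat.card F ^ g.natDegree) :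
    ∃ (e : AdjoinRoot g ≃+* L) (φ : L →+* Module.End F W),
      ∀ q : F[X], φ (e (AdjoinRoot.mk g q)) = aeval a q := by
  have : Fact (Irreducible g) := ⟨hi⟩
  have : Module.Finite F (AdjoinRoot g) := (AdjoinRoot.powerBasis' hg).finite
  have : Finite (AdjoinRoot g) := Module.finite_of_finite F
  have := Fintype.ofFinite (AdjoinRoot g)
  have := Fintype.ofFinite L
  let e : AdjoinRoot g ≃+* L := FiniteField.ringEquivOfCardEq (by
    rw [Fintype.card_eq_nat_card, Fintype.card_eq_nat_card, hL, card_adjoinRoot hg])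
  let φ₀ : AdjoinRoot g →+* Module.End F W :=
    Ideal.Quotient.lift (Ideal.span {g}) (aeval a : F[X] →ₐ[F] Module.End F W).toRingHom (by
      intro q hq
      obtain ⟨r, rfl⟩ := Ideal.mem_span_singleton.1 hq
      simp [ha])
  refine ⟨e, φ₀.comp e.symm.toRingHom, fun q => ?_⟩
  change φ₀ (e.symm (e _)) = _
  rw [RingEquiv.symm_apply_apply]
  rfl

/-- The algebra structure on `L` given by an isomorphism with `F[t] / (g)`. -/
noncomputable abbrev fieldAlgebra {L : Type*} [Field L] {g : F[X]} (e : AdjoinRoot g ≃+* L) : Algebra F L :=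
  (e.toRingHom.comp (AdjoinRoot.of g)).toAlgebra

/-- The module structure given by a ring homomorphism to the endomorphisms. -/
noncomputable abbrev fieldModule {L : Type*} [Field L] (φ : L →+* Module.End F W) : Module L W :=
  Module.compHom W φ

theorem fieldAction_tower {L : Type*} [Field L] {g : F[X]} {a : Module.End F W}
    (e : AdjoinRoot g ≃+* L) (φ : L →+* Module.End F W)
    (h : ∀ q : F[X], φ (e (AdjoinRoot.mk g q)) = aeval a q) :
    letI := fieldAlgebra e
    letI := fieldModule φ
    IsScalarTower F L W := by
  let := fieldAlgebra e
  let := fieldModule φ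
  refine ⟨fun c l w => ?_⟩
  rw [Algebra.smul_def]
  change φ (e (AdjoinRoot.mk g (C c)) * l) w = c • φ l w
  rw [map_mul, h, aeval_C, Module.End.mul_apply, Module.algebraMap_end_apply]

theorem commute_fieldAction {L : Type*} [Field L] {g : F[X]} {a : Module.End F W}
    (e : AdjoinRoot g ≃+* L) (φ : L →+* Module.End F W)
    (h : ∀ q : F[X], φ (e (AdjoinRoot.mk g q)) = aeval a q) {z : Module.End F W}
    (hz : Commute z a) (l : L) : Commute z (φ l) := by
  obtain ⟨b, rfl⟩ := e.surjective l
  obtain ⟨q, rfl⟩ := AdjoinRoot.mk_surjective b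
  rw [h]
  induction q using Polynomial.induction_on' with
  | add f g hf hg => rw [map_add]; exact hf.add_right hg
  | monomial n c =>
    rw [aeval_monomial]
    exact (Algebra.commute_algebraMap_right c _).mul_right (hz.pow_right n)

theorem finrank_fieldModule [Finite F] [FiniteDimensional F W] {L : Type*} [Field L] [Finite L]
    {g : F[X]} {a : Module.End F W} (hL : Nat.card L = Nat.card F ^ g.natDegree)
    (hd : 0 < g.natDegree)
    (e : AdjoinRoot g ≃+* L) (φ : L →+* Module.End F W)
    (h : ∀ q : F[X], φ (e (AdjoinRoot.mk g q)) = aeval a q) {m : ℕ}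
    (hm : m * g.natDegree = Module.finrank F W) :
    letI := fieldModule φ
    Module.Finite L W ∧ Module.finrank L W = m := by
  let := fieldAlgebra e
  let := fieldModule φ
  have := fieldAction_tower e φ h
  have hfin : Module.Finite L W := Module.Finite.of_restrictScalars_finite F L W
  have : Module.Finite F L := Module.Finite.of_finite
  refine ⟨hfin, ?_⟩
  have h1 : Module.finrank F L = g.natDegree := by
    rw [Module.natCard_eq_pow_finrank (K := F) (V := L)] at hL
    exact Nat.pow_right_injective Finite.one_lt_card hL
  have h2 := Module.finrank_mul_finrank F L W
  rw [h1, ← hm, mul_comm] at h2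
  exact Nat.eq_of_mul_eq_mul_right hd h2

/-- Since `F[t]/(g)` is generated by `F` and the class of `t`, commuting with `a` is the same as
being `L`-linear. -/
theorem centralizer_equiv_GL [Finite F] [FiniteDimensional F W] {a : W ≃ₗ[F] W} {g : F[X]}
    (hg : g.Monic) (hi : Irreducible g) (ha : aeval (a : Module.End F W) g = 0)
    (L : Type*) [Field L] [Finite L] (hL : Nat.card L = Nat.card F ^ g.natDegree) {m : ℕ}
    (hm : m * g.natDegree = Module.finrank F W) :
    Nonempty (Subgroup.centralizer ({a} : Set (W ≃ₗ[F] W)) ≃* GL (Fin m) L) := by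
  obtain ⟨e, φ, h⟩ := exists_field_action hg hi ha L hL
  obtain ⟨hfin, hrank⟩ := finrank_fieldModule hL hi.natDegree_pos e φ h hm
  let := fieldAlgebra e
  let := fieldModule φ
  have := fieldAction_tower e φ h
  let b : Module.Basis (Fin m) L W := Module.finBasisOfFinrankEq L W hrank
  let E : (Module.End L W)ˣ ≃* GL (Fin m) L :=
    Units.mapEquiv (LinearMap.toMatrixAlgEquiv b).toMulEquiv
  have hcomm : ∀ y : Subgroup.centralizer ({a} : Set (W ≃ₗ[F] W)), ∀ (l : L) (w : W),
      (y : W ≃ₗ[F] W) (l • w) = l • (y : W ≃ₗ[F] W) w := by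
    intro y l w
    have hy : Commute ((y : W ≃ₗ[F] W) : Module.End F W) (a : Module.End F W) := by
      ext w
      exact LinearEquiv.congr_fun (comm_of_mem_centralizer y.2) w
    exact LinearMap.congr_fun (commute_fieldAction e φ h hy l).eq w
  let R : Subgroup.centralizer ({a} : Set (W ≃ₗ[F] W)) ≃* (W ≃ₗ[L] W) :=
    { toFun := fun y =>
        { toFun := (y : W ≃ₗ[F] W), map_add' := map_add (y : W ≃ₗ[F] W), map_smul' := hcomm y,
          invFun := (y : W ≃ₗ[F] W).symm,
          left_inv := (y : W ≃ₗ[F] W).left_inv, right_inv := (y : W ≃ₗ[F] W).right_inv }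
      invFun := fun z => ⟨z.restrictScalars F, mem_centralizer_of_comm (by
        ext w
        have haw : ∀ w, a w = e (AdjoinRoot.mk g X) • w := fun w => by
          change _ = φ _ w
          rw [h, aeval_X]
          rfl
        change z (a w) = a (z w)
        rw [haw, haw, map_smul])⟩
      left_inv := fun _ => rfl
      right_inv := fun _ => rfl
      map_mul' := fun _ _ => rfl }
  exact ⟨R.trans ((LinearMap.GeneralLinearGroup.generalLinearEquiv L W).symm.trans E)⟩

end FieldAction

/-! ### Isometries from normal operators -/

section NormalIsometry

variable {F V : Type*} [Field F] [AddCommGroup V] [Module F V] {σ : F →+* F} {ε : F}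
  {β : V →ₗ[F] V →ₛₗ[σ] F} {x : V ≃ₗ[F] V}

theorem isAdj_comm_isometry (hβ : IsEpsHermitian ε β) (hx : x ∈ isometryGroup β)
    {a a' : Module.End F V} (ha : IsAdj β a a') (hax : Commute a (x : Module.End F V)) :
    Commute a' (x : Module.End F V) := by
  ext v
  refine sub_eq_zero.1 (hβ.nondeg_right _ fun u => ?_)
  rw [map_sub, sub_eq_zero, Module.End.mul_apply, Module.End.mul_apply, ← ha]
  have h1 := isAdj_of_isometry (inv_mem hx)
  rw [inv_inv] at h1
  rw [← h1 u (a' v), ← ha]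
  have h2 := LinearMap.congr_fun hax.eq (x⁻¹ u)
  simp only [Module.End.mul_apply, LinearEquiv.coe_coe] at h2
  rw [← LinearEquiv.mul_apply, mul_inv_cancel] at h2
  have h3 := hx (a (x⁻¹ u)) v
  rw [← h2] at h3
  exact h3

/-- The isometry is `y = a a'⁻¹`: if `a` and `a'` commute then `β(a u, a v) = β(u, a' a v) = β(u, a
a' v) = β(a' u, a' v)`. All isometries constructed below, other than reflections and their products,
arise in this way. -/
theorem exists_normal_isometry [Finite F] [FiniteDimensional F V] (hβ : IsEpsHermitian ε β)
    (hx : x ∈ isometryGroup β) {a : V ≃ₗ[F] V} {a' : Module.End F V}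
    (ha : IsAdj β (a : Module.End F V) a') (hn : Commute (a : Module.End F V) a')
    (hax : Commute (a : Module.End F V) (x : Module.End F V)) :
    ∃ y : V ≃ₗ[F] V, y ∈ centralizerIn (isometryGroup β) x ∧ ∀ v, y (a' v) = a v := by
  have hinj : Function.Injective a' := by
    refine (injective_iff_map_eq_zero a').2 fun v hv => hβ.nondeg_right v fun u => ?_
    have h1 := ha (a⁻¹ u) v
    rw [hv, map_zero, LinearEquiv.coe_coe, ← LinearEquiv.mul_apply, mul_inv_cancel] at h1
    exact h1
  let A := LinearEquiv.ofInjectiveEndo a' hinj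
  have hA : ∀ v, A v = a' v := fun v => rfl
  let y : V ≃ₗ[F] V := A.symm.trans a
  have hy : ∀ v, y (a' v) = a v := fun v => by
    change a (A.symm (A v)) = a v
    rw [LinearEquiv.symm_apply_apply]
  have hsurj : Function.Surjective a' := A.surjective
  have ha'x := isAdj_comm_isometry hβ hx ha hax
  refine ⟨y, mem_centralizerIn.2 ⟨?_, ?_⟩, hy⟩
  · ext v
    obtain ⟨w, rfl⟩ := hsurj v
    have h1 : x (a' w) = a' (x w) := (LinearMap.congr_fun ha'x.eq w).symm
    have h2 : a (x w) = x (a w) := LinearMap.congr_fun hax.eq w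
    rw [LinearEquiv.mul_apply, LinearEquiv.mul_apply, h1, hy, hy, h2]
  · intro u v
    obtain ⟨u, rfl⟩ := hsurj u
    obtain ⟨v, rfl⟩ := hsurj v
    rw [hy, hy, hβ.isAdj_symm ha u (a' v)]
    have h1 : a (a' v) = a' (a v) := LinearMap.congr_fun hn.eq v
    rw [LinearEquiv.coe_coe, h1]
    exact ha u (a v)

end NormalIsometry

end ClassicalGroups

namespace ClassicalGroups

open Polynomial

/-! ### The factors of linear type -/

section Phi2

variable {F V : Type*} [Field F] [AddCommGroup V] [Module F V] {σ : F →+* F} {ε : F}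
  {β : V →ₗ[F] V →ₛₗ[σ] F} {x : V ≃ₗ[F] V}

theorem aeval_selfRestrict (x : V ≃ₗ[F] V) (f q : F[X]) (v : kerEval x f) :
    (aeval (selfRestrict x f : Module.End F (kerEval x f)) q v : V) =
      aeval (x : Module.End F V) q (v : V) := by
  induction q using Polynomial.induction_on' with
  | add p q hp hq => simp only [map_add, LinearMap.add_apply, Submodule.coe_add, hp, hq]
  | monomial n c =>
    simp only [aeval_monomial, Module.End.mul_apply, Module.algebraMap_end_apply,
      Submodule.coe_smul]
    congr 1
    induction n with
    | zero => rfl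
    | succ n ih =>
      rw [pow_succ', pow_succ', Module.End.mul_apply, Module.End.mul_apply, ← ih]
      rfl

theorem aeval_selfRestrict_self (x : V ≃ₗ[F] V) (f : F[X]) :
    aeval (selfRestrict x f : Module.End F (kerEval x f)) f = 0 := by
  ext v
  rw [aeval_selfRestrict]
  exact v.2

theorem finrank_kerEval_selfRestrict (x : V ≃ₗ[F] V) {f g : F[X]} (h : g ∣ f) :
    Module.finrank F (kerEval (selfRestrict x f) g) = Module.finrank F (kerEval x g) := by
  have hle : kerEval x g ≤ kerEval x f := by
    obtain ⟨q, rfl⟩ := h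
    intro v hv
    rw [kerEval, LinearMap.mem_ker, mul_comm, map_mul, Module.End.mul_apply,
      LinearMap.mem_ker.1 hv, map_zero]
  rw [← (Submodule.comapSubtypeEquivOfLe hle).finrank_eq]
  have : kerEval (selfRestrict x f) g = (kerEval x g).comap (kerEval x f).subtype := by
    ext v
    change aeval (selfRestrict x f : Module.End F (kerEval x f)) g v = 0 ↔
      aeval (x : Module.End F V) g (v : V) = 0
    rw [← aeval_selfRestrict, Submodule.coe_eq_zero]
  rw [this]

theorem selfRestrict_mem_isometryGroup (hx : x ∈ isometryGroup β) (f : F[X]) :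
    selfRestrict x f ∈ isometryGroup (β.domRestrict₁₂ (kerEval x f) (kerEval x f)) :=
  fun u v => hx u v

variable [Finite F] [FiniteDimensional F V]

/-- The kernels of `g(x)` and `g*(x)` are totally isotropic, complementary and in duality.
Restriction to `ker g(x)` is therefore injective on the centralizer; it is surjective because every
automorphism of `ker g(x)` commuting with `x` extends by the contragredient. -/
theorem phi2_equiv (hβ : IsEpsHermitian ε β) (hx : x ∈ isometryGroup β) {g : F[X]}
    (g1 : g.Monic) (g2 : g.coeff 0 ≠ 0) (g3 : Irreducible g) (g4 : g ≠ dualPoly σ g)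
    (hker : aeval (x : Module.End F V) (g * dualPoly σ g) = 0) {m : ℕ}
    (hm : m * g.natDegree = Module.finrank F (kerEval x g))
    (L : Type*) [Field L] [Finite L] (hL : Nat.card L = Nat.card F ^ g.natDegree) :
    Nonempty (centralizerIn (isometryGroup β) x ≃* GL (Fin m) L) := by
  have g1' : (dualPoly σ g).Monic := dualPoly_monic g2
  have g2' := dualPoly_coeff_zero_ne (σ := σ) g1 g2
  have g3' := dualPoly_irreducible hβ.invol g1 g2 g3
  have hdd := dualPoly_dualPoly hβ.invol g1 g2
  have hco : IsCoprime g (dualPoly σ g) := g3.coprime_iff_not_dvd.2 fun hd =>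
    g4 (eq_of_monic_of_associated g1 g1' (g3.associated_of_dvd g3' hd))
  have hcompl : IsCompl (kerEval x g) (kerEval x (dualPoly σ g)) := by
    refine ⟨disjoint_ker_aeval_of_isCoprime _ hco, codisjoint_iff.2 ?_⟩
    rw [kerEval, kerEval, sup_ker_aeval_eq_ker_aeval_mul_of_coprime _ hco, hker, LinearMap.ker_zero]
  have hiso : ∀ u ∈ kerEval x g, ∀ v ∈ kerEval x g, β v u = 0 := fun u hu v hv =>
    kerEval_orthogonal hβ hx g2' hco.symm (by rwa [hdd]) hv
  have hiso' : ∀ u ∈ kerEval x (dualPoly σ g), ∀ v ∈ kerEval x (dualPoly σ g), β v u = 0 :=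
    fun u hu v hv => kerEval_orthogonal hβ hx g2 hco hu hv
  have hzero : ∀ w ∈ kerEval x (dualPoly σ g), (∀ u ∈ kerEval x g, β u w = 0) → w = 0 := by
    intro w hw h
    refine hβ.nondeg_right w fun u => ?_
    obtain ⟨a, ha, b, hb, rfl⟩ := Submodule.mem_sup.1
      (hcompl.sup_eq_top ▸ Submodule.mem_top : u ∈ _)
    rw [map_add, LinearMap.add_apply, h a ha, hiso' w hw b hb, add_zero]
  let ρ : centralizerIn (isometryGroup β) x →* Subgroup.centralizer
      ({selfRestrict x g} : Set (kerEval x g ≃ₗ[F] kerEval x g)) :=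
    { toFun := fun y => ⟨kerRestrict x g ⟨y, y.2.1⟩, mem_centralizer_of_comm (by
        rw [selfRestrict, ← map_mul, ← map_mul]
        congr 1
        exact Subtype.ext (comm_of_mem_centralizer y.2.1))⟩
      map_one' := rfl
      map_mul' := fun _ _ => rfl }
  have hρ : ∀ y v, ((ρ y : kerEval x g ≃ₗ[F] kerEval x g) v : V) = (y : V ≃ₗ[F] V) v :=
    fun _ _ => rfl
  have hinj : Function.Injective ρ := by
    intro y z hyz
    have hg : ∀ v ∈ kerEval x g, (y : V ≃ₗ[F] V) v = (z : V ≃ₗ[F] V) v := by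
      intro v hv
      have h1 := hρ y ⟨v, hv⟩
      rw [hyz] at h1
      exact h1.symm
    refine Subtype.ext (LinearEquiv.ext fun v => ?_)
    obtain ⟨a, ha, b, hb, rfl⟩ := Submodule.mem_sup.1
      (hcompl.sup_eq_top ▸ Submodule.mem_top : v ∈ _)
    rw [map_add, map_add, hg a ha]
    congr 1
    refine sub_eq_zero.1 (hzero _ (Submodule.sub_mem _
      (kerEval_invariant x _ (mem_centralizerIn.1 y.2).1 hb)
      (kerEval_invariant x _ (mem_centralizerIn.1 z.2).1 hb)) fun u hu => ?_)
    have hu' : (y : V ≃ₗ[F] V)⁻¹ u ∈ kerEval x g :=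
      kerEval_invariant x _ (mem_centralizerIn.1 (inv_mem y.2)).1 hu
    have hyu : (y : V ≃ₗ[F] V) ((y : V ≃ₗ[F] V)⁻¹ u) = u := by
      rw [← LinearEquiv.mul_apply, mul_inv_cancel]; rfl
    have h1 := (mem_centralizerIn.1 y.2).2 ((y : V ≃ₗ[F] V)⁻¹ u) b
    have h2 := (mem_centralizerIn.1 z.2).2 ((y : V ≃ₗ[F] V)⁻¹ u) b
    rw [← hg _ hu', hyu] at h2
    rw [hyu] at h1
    rw [map_sub, h1, h2, sub_self]
  have hsurj : Function.Surjective ρ := by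
    intro z
    let D := Submodule.prodEquivOfIsCompl _ _ hcompl
    -- Extend `z` by the identity on `ker g*(x)`. The adjoint of this operator is the identity on
    -- `ker g(x)` and preserves `ker g*(x)`, so the two commute and the quotient `a a'⁻¹` restricts
    -- to `z`.
    let a : V ≃ₗ[F] V := D.symm.trans (((z : kerEval x g ≃ₗ[F] kerEval x g).prodCongr
      (LinearEquiv.refl F _)).trans D)
    have ha1 : ∀ v : kerEval x g, a v = (z : kerEval x g ≃ₗ[F] kerEval x g) v := by
      intro v
      simp [a, D]
    have ha2 : ∀ v : kerEval x (dualPoly σ g), a v = v := by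
      intro v
      simp [a, D]
    obtain ⟨a', ha'⟩ := hβ.exists_isAdj (a : Module.End F V)
    have ha'1 : ∀ v ∈ kerEval x g, a' v = v := by
      intro v hv
      refine sub_eq_zero.1 (hβ.nondeg_right _ fun u => ?_)
      obtain ⟨b, hb, c, hc, rfl⟩ := Submodule.mem_sup.1
        (hcompl.sup_eq_top ▸ Submodule.mem_top : u ∈ _)
      rw [map_sub, ← ha', map_add, map_add, LinearMap.add_apply, map_add, LinearMap.add_apply,
        hiso v hv b hb, LinearEquiv.coe_coe, ha1 ⟨b, hb⟩, ha2 ⟨c, hc⟩,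
        hiso v hv _ (Submodule.coe_mem _), sub_self]
    have ha'2 : ∀ v ∈ kerEval x (dualPoly σ g), a' v ∈ kerEval x (dualPoly σ g) := by
      intro v hv
      obtain ⟨b, hb, c, hc, hbc⟩ := Submodule.mem_sup.1
        (hcompl.sup_eq_top ▸ Submodule.mem_top : a' v ∈ _)
      have hb0 : b = 0 := by
        refine hβ.nondeg_right b fun u => ?_
        obtain ⟨d, hd, e, he, rfl⟩ := Submodule.mem_sup.1
          (hcompl.sup_eq_top ▸ Submodule.mem_top : u ∈ _)
        have h1 : β e (a' v) = 0 := by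
          rw [← ha', LinearEquiv.coe_coe, ha2 ⟨e, he⟩]
          exact hiso' v hv e he
        rw [← hbc, map_add, hiso' c hc e he, add_zero] at h1
        rw [map_add, LinearMap.add_apply, h1, hiso b hb d hd, add_zero]
      rw [← hbc, hb0, zero_add]
      exact hc
    have hn : Commute (a : Module.End F V) a' := by
      ext v
      obtain ⟨b, hb, c, hc, rfl⟩ := Submodule.mem_sup.1
        (hcompl.sup_eq_top ▸ Submodule.mem_top : v ∈ _)
      simp only [Module.End.mul_apply, map_add, LinearEquiv.coe_coe]
      rw [ha'1 b hb, ha1 ⟨b, hb⟩, ha'1 _ (Submodule.coe_mem _), ha2 ⟨c, hc⟩,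
        ha2 ⟨a' c, ha'2 c hc⟩]
    have hax : Commute (a : Module.End F V) (x : Module.End F V) := by
      ext v
      obtain ⟨b, hb, c, hc, rfl⟩ := Submodule.mem_sup.1
        (hcompl.sup_eq_top ▸ Submodule.mem_top : v ∈ _)
      simp only [Module.End.mul_apply, map_add, LinearEquiv.coe_coe]
      rw [ha2 ⟨c, hc⟩, ha2 ⟨x c, kerEval_invariant x _ rfl hc⟩, ha1 ⟨b, hb⟩,
        ha1 ⟨x b, kerEval_invariant x _ rfl hb⟩]
      congr 1
      exact congrArg Subtype.val
        (LinearEquiv.congr_fun (comm_of_mem_centralizer z.2) (⟨b, hb⟩ : kerEval x g))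
    obtain ⟨y, hy, hya⟩ := exists_normal_isometry hβ hx ha' hn hax
    refine ⟨⟨y, hy⟩, Subtype.ext (LinearEquiv.ext fun v => Subtype.ext ?_)⟩
    rw [hρ, ← ha1, ← hya, ha'1 v v.2]
  obtain ⟨e⟩ := centralizer_equiv_GL g1 g3 (aeval_selfRestrict_self x g) L hL hm
  exact ⟨(MulEquiv.ofBijective ρ ⟨hinj, hsurj⟩).trans e⟩

end Phi2

end ClassicalGroups

namespace ClassicalGroups

open Polynomial

/-! ### Involutions and norms of finite fields -/

section FiniteFieldInvolution

variable {p : ℕ} [Fact p.Prime] {a : ℕ}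

/-- Automorphisms are powers `Frob^n` with `n < 2a`. An involutive one has `2a ∣ 2n`, so `n` is `0`
or `a`, and `0` is excluded by non-triviality. -/
theorem involution_eq_frobenius (ha : 0 < a) (τ : GaloisField p (2 * a) →+* GaloisField p (2 * a))
    (hτ : ∀ l, τ (τ l) = l) (hne : ∃ l, τ l ≠ l) :
    τ = iterateFrobenius (GaloisField p (2 * a)) p a := by
  let L := GaloisField p (2 * a)
  have hfin : Module.finrank (ZMod p) L = 2 * a := GaloisField.finrank p (by omega)
  let T : L ≃ₐ[ZMod p] L := AlgEquiv.ofRingEquiv (f := RingEquiv.ofRingHom τ τ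
    (RingHom.ext hτ) (RingHom.ext hτ)) fun c =>
      RingHom.congr_fun (Subsingleton.elim (τ.comp (algebraMap (ZMod p) L)) (algebraMap _ _)) c
  have hT : ∀ l, T l = τ l := fun _ => rfl
  let fr := FiniteField.frobeniusAlgEquivOfAlgebraic (ZMod p) L
  have hfr : ∀ (n : ℕ) l, (fr ^ n) l = l ^ p ^ n := by
    intro n l
    rw [AlgEquiv.coe_pow, FiniteField.coe_frobeniusAlgEquivOfAlgebraic, ZMod.card, pow_iterate]
  obtain ⟨⟨n, hn⟩, hnT⟩ :=
    (FiniteField.bijective_frobeniusAlgEquivOfAlgebraic_pow (ZMod p) L).2 T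
  change fr ^ n = T at hnT
  rw [hfin] at hn
  have h1 : fr ^ (2 * n) = 1 := by
    rw [mul_comm 2 n, pow_mul, hnT]
    ext l
    rw [sq, AlgEquiv.mul_apply, hT, hT, hτ]
    rfl
  have h2 := orderOf_dvd_of_pow_eq_one h1
  rw [FiniteField.orderOf_frobeniusAlgEquivOfAlgebraic, hfin] at h2
  have h3 : a ∣ n := Nat.dvd_of_mul_dvd_mul_left two_pos h2
  obtain ⟨c, rfl⟩ := h3
  have hc : c < 2 := by
    by_contra hc
    have : a * 2 ≤ a * c := Nat.mul_le_mul_left a (by omega)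
    omega
  have hc1 : c = 1 := by
    by_contra hc1
    obtain rfl : c = 0 := by omega
    obtain ⟨l, hl⟩ := hne
    rw [mul_zero, pow_zero] at hnT
    exact hl (by rw [← hT, ← hnT]; rfl)
  ext l
  rw [← hT, ← hnT, hfr, hc1, mul_one, iterateFrobenius_def]

/-- Write `c = g^i` for a generator `g` of order `(p^a - 1)(p^a + 1)`. From `c^(p^a - 1) = 1` it
follows that `p^a + 1` divides `i`, and `d = g^(i / (p^a + 1))` works. -/
theorem exists_norm_eq (ha : 0 < a) (c : GaloisField p (2 * a)) (hc : c ≠ 0)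
    (h : c ^ p ^ a = c) : ∃ d, d * d ^ p ^ a = c := by
  let L := GaloisField p (2 * a)
  have hp := (Fact.out : p.Prime).one_lt
  have hq : 1 < p ^ a := Nat.one_lt_pow ha.ne' hp
  obtain ⟨g, hg⟩ := IsCyclic.exists_generator (α := Lˣ)
  obtain ⟨i, hi⟩ := (mem_powers_iff_mem_zpowers).2 (hg (Units.mk0 c hc))
  have hord : orderOf g = (p ^ a - 1) * (p ^ a + 1) := by
    rw [orderOf_eq_card_of_forall_mem_zpowers hg, Nat.card_units,
      GaloisField.card p (2 * a) (by omega), mul_comm 2 a, pow_mul]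
    zify [hq.le, Nat.one_le_pow 2 (p ^ a) (by omega)]
    ring
  have hi' : g ^ i = Units.mk0 c hc := hi
  have h1 : g ^ (i * (p ^ a - 1)) = 1 := by
    rw [pow_mul, hi']
    ext
    have h2 : c ^ (p ^ a - 1) * c = c := by
      rw [← pow_succ, Nat.sub_add_cancel hq.le, h]
    simpa [hc] using h2
  have h3 := orderOf_dvd_of_pow_eq_one h1
  rw [hord, mul_comm] at h3
  obtain ⟨j, hj⟩ := Nat.dvd_of_mul_dvd_mul_right (by omega) h3
  refine ⟨((g ^ j : Lˣ) : L), ?_⟩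
  have h4 := congrArg Units.val hi'
  rw [hj, Units.val_mk0] at h4
  rw [← h4, ← pow_succ', mul_comm (p ^ a + 1) j, pow_mul]
  rfl

end FiniteFieldInvolution

/-! ### Orthonormal bases of hermitian forms -/

section Orthonormal

variable {L W : Type*} [Field L] [AddCommGroup W] [Module L W] {τ : L →+* L}
  {h : W →ₗ[L] W →ₛₗ[τ] L}

/-- The form is non-zero on the orthogonal complement of the given family, and a non-zero hermitian
form with non-trivial involution has an anisotropic vector. Its value is fixed by `τ`, so its
inverse is a norm and the vector can be scaled to length one. -/
theorem exists_orthonormal_extend (hh : IsEpsHermitian 1 h) (hτ : ∃ l, τ l ≠ l)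
    (hnorm : ∀ c, c ≠ 0 → τ c = c → ∃ d, d * τ d = c) {m : ℕ} {e : Fin m → W}
    (he : ∀ i j, h (e i) (e j) = if i = j then 1 else 0)
    {v : W} (hv : v - ∑ i, h v (e i) • e i ≠ 0) :
    ∃ w : W, h w w = 1 ∧ ∀ i, h w (e i) = 0 := by
  let P : W →ₗ[L] W := LinearMap.id - ∑ i, (h.flip (e i)).smulRight (e i)
  have hP : ∀ u, P u = u - ∑ i, h u (e i) • e i := by
    intro u
    simp [P, LinearMap.sum_apply]
  have hPe : ∀ u j, h (P u) (e j) = 0 := by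
    intro u j
    rw [hP]
    simp [he]
  have hsymm : ∀ u v, h v u = τ (h u v) := fun u v => by rw [hh.symm u v, one_mul]
  obtain ⟨u, hu⟩ : ∃ u, h (P u) (P u) ≠ 0 := by
    by_contra! h0
    have hpol : ∀ u v, h (P u) (P v) + τ (h (P u) (P v)) = 0 := by
      intro u v
      have h1 := h0 (u + v)
      simp only [map_add, LinearMap.add_apply, h0, zero_add, add_zero] at h1
      rw [hsymm (P u) (P v), add_comm] at h1
      exact h1
    obtain ⟨l, hl⟩ := hτ
    have hall : ∀ u v, h (P u) (P v) = 0 := by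
      intro u v
      -- Polarizing gave `h + τ(h) = 0` on all projected pairs. Comparing it for `u` and `l • u`
      -- yields `(l - τ l) h = 0` with `l ≠ τ l`.
      have h1 := hpol (l • u) v
      rw [map_smul, map_smul, LinearMap.smul_apply, smul_eq_mul, map_mul,
        eq_neg_of_add_eq_zero_right (hpol u v)] at h1
      have h2 : (l - τ l) * h (P u) (P v) = 0 := by linear_combination h1
      exact (mul_eq_zero.1 h2).resolve_left (sub_ne_zero.2 (Ne.symm hl))
    refine hv ?_
    rw [← hP]
    refine hh.nondeg _ fun w => ?_
    have h3 := hall v w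
    rw [hP w, map_sub, map_sum] at h3
    simpa [LinearMap.map_smulₛₗ, hPe] using h3
  obtain ⟨d, hd⟩ := hnorm (h (P u) (P u))⁻¹ (inv_ne_zero hu) (by rw [map_inv₀, ← hsymm])
  refine ⟨d • P u, ?_, fun i => ?_⟩
  · simp only [LinearMap.map_smulₛₗ, LinearMap.smul_apply, RingHom.id_apply, smul_eq_mul]
    rw [← mul_assoc, mul_comm (τ d), hd, inv_mul_cancel₀ hu]
  · rw [map_smul, LinearMap.smul_apply, hPe, smul_zero]

theorem exists_orthonormal_basis [FiniteDimensional L W] (hh : IsEpsHermitian 1 h)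
    (hτ : ∃ l, τ l ≠ l) (hnorm : ∀ c, c ≠ 0 → τ c = c → ∃ d, d * τ d = c) :
    ∃ b : Module.Basis (Fin (Module.finrank L W)) L W,
      ∀ i j, h (b i) (b j) = if i = j then 1 else 0 := by
  have hlin : ∀ (m : ℕ) (e : Fin m → W), (∀ i j, h (e i) (e j) = if i = j then 1 else 0) →
      LinearIndependent L e := by
    intro m e he
    refine linearIndependent_of_gram h e ?_
    have : (Matrix.of fun i j => h (e i) (e j)) = 1 := by
      ext i j
      rw [Matrix.of_apply, he, Matrix.one_apply]
    rw [this, Matrix.det_one]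
    exact one_ne_zero
  obtain ⟨m, ⟨e, he⟩, hm⟩ : ∃ m : ℕ, (∃ e : Fin m → W, ∀ i j, h (e i) (e j) =
      if i = j then 1 else 0) ∧
      ¬ ∃ e : Fin (m + 1) → W, ∀ i j, h (e i) (e j) = if i = j then 1 else 0 := by
    by_contra! hcon
    have hall : ∀ m : ℕ, ∃ e : Fin m → W, ∀ i j, h (e i) (e j) = if i = j then 1 else 0 := by
      intro m
      induction m with
      | zero => exact ⟨Fin.elim0, fun i => i.elim0⟩
      | succ m ih => exact hcon m ih
    obtain ⟨e, he⟩ := hall (Module.finrank L W + 1)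
    have := (hlin _ e he).fintype_card_le_finrank
    simp at this
  have hp : ∀ v, v - ∑ i, h v (e i) • e i = 0 := by
    intro v
    by_contra hv
    obtain ⟨w, hw, hwe⟩ := exists_orthonormal_extend hh hτ hnorm he hv
    refine hm ⟨Fin.cons w e, fun i j => ?_⟩
    refine Fin.cases ?_ (fun i => ?_) i <;> refine Fin.cases ?_ (fun j => ?_) j
    · simp [hw]
    · simp [hwe, (Fin.succ_ne_zero j).symm]
    · simp [hh.symm w, hwe]
    · simp [he]
  let b : Module.Basis (Fin m) L W := Module.Basis.mk (hlin m e he) (by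
    intro v _
    rw [sub_eq_zero.1 (hp v)]
    exact Submodule.sum_mem _ fun i _ => Submodule.smul_mem _ _ (Submodule.subset_span ⟨i, rfl⟩))
  have hmd : Module.finrank L W = m := by
    rw [Module.finrank_eq_card_basis b, Fintype.card_fin]
  rw [hmd]
  exact ⟨b, fun i j => by simpa [b] using he i j⟩

end Orthonormal

/-! ### Lifting a form to a hermitian form over an extension field -/

section HermitianLift

variable {F L V : Type*} [Field F] [Field L] [Algebra F L] [AddCommGroup V]
  [Module F V] [Module L V] [IsScalarTower F L V] {σ : F →+* F} {ε : F}
  {β : V →ₗ[F] V →ₛₗ[σ] F} {τ : L →+* L}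

theorem trace_involution (hσ : ∀ c, σ (σ c) = c) (hτ : ∀ l, τ (τ l) = l)
    (hc : ∀ c, τ (algebraMap F L c) = algebraMap F L (σ c)) (l : L) :
    Algebra.trace F L (τ l) = σ (Algebra.trace F L l) := by
  let e₁ : F ≃+* F := RingEquiv.ofRingHom σ σ (RingHom.ext hσ) (RingHom.ext hσ)
  let e₂ : L ≃+* L := RingEquiv.ofRingHom τ τ (RingHom.ext hτ) (RingHom.ext hτ)
  have h := Algebra.trace_eq_of_equiv_equiv e₁ e₂ (RingHom.ext fun c => (hc c).symm) l
  rw [h]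
  exact (hσ _).symm

variable [Finite F] [Finite L]

/-- Non-degeneracy of the trace form yields a unique `s(u, v)` in `L` with `Tr(l s(u, v)) = β(l u,
v)`; it is sesquilinear and ε-hermitian for `τ`. Scaling by a suitable `δ` removes the sign. As `β`
and the lift determine each other, `L`-homogeneous maps preserve both or neither. -/
theorem exists_hermitian_lift (hβ : IsEpsHermitian ε β) (hτ : ∀ l, τ (τ l) = l)
    (hne : ∃ l, τ l ≠ l) (hc : ∀ c, τ (algebraMap F L c) = algebraMap F L (σ c))
    (hadj : ∀ (l : L) u v, β (l • u) v = β u (τ l • v)) :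
    ∃ h : V →ₗ[L] V →ₛₗ[τ] L, IsEpsHermitian 1 h ∧
      ∀ z : V → V, (∀ (l : L) v, z (l • v) = l • z v) →
        ((∀ u v, h (z u) (z v) = h u v) ↔ ∀ u v, β (z u) (z v) = β u v) := by
  have hfin : Module.Finite F L := Module.Finite.of_finite
  have hnd := traceForm_nondegenerate F L
  have hex : ∀ u v, ∃ s : L, ∀ l : L, Algebra.trace F L (l * s) = β (l • u) v := by
    intro u v
    let g : Module.Dual F L := (β.flip v) ∘ₗ ((LinearMap.toSpanSingleton L V u).restrictScalars F)
    obtain ⟨s, hs⟩ := ((Algebra.traceForm F L).toDual hnd).surjective g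
    refine ⟨s, fun l => ?_⟩
    have h1 := LinearMap.congr_fun hs l
    rw [LinearMap.BilinForm.toDual_def, Algebra.traceForm_apply, mul_comm] at h1
    exact h1
  choose s hs using hex
  have huniq : ∀ {r r' : L}, (∀ l : L, Algebra.trace F L (l * r) = Algebra.trace F L (l * r')) →
      r = r' := by
    intro r r' hr
    refine sub_eq_zero.1 (hnd.1 _ fun l => ?_)
    rw [Algebra.traceForm_apply, mul_comm, mul_sub, map_sub, hr, sub_self]
  have hs_symm : ∀ u v, s v u = algebraMap F L ε * τ (s u v) := by
    intro u v
    refine huniq fun l => ?_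
    have h1 : l * (algebraMap F L ε * τ (s u v)) = ε • τ (τ l * s u v) := by
      rw [map_mul, hτ, Algebra.smul_def]
      ring
    rw [hs, hβ.symm u, h1, LinearMap.map_smul (Algebra.trace F L), trace_involution hβ.invol hτ hc, hs, hadj, hτ, smul_eq_mul]
  have hε0 : algebraMap F L ε ≠ 0 := by simpa using hβ.eps_ne_zero
  have hετ : algebraMap F L ε * τ (algebraMap F L ε) = 1 := by
    rw [hc, ← map_mul, hβ.eps, map_one]
  -- Hilbert 90 by hand: `c + τ(ε) τ(c)` always has the required behaviour. If it vanished for every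
  -- `c`, then `c = 1` would give `τ(ε) = -1`, and `τ` would be the identity.
  obtain ⟨δ, hδ0, hδ⟩ : ∃ δ : L, δ ≠ 0 ∧ τ δ = algebraMap F L ε * δ := by
    have hc : ∀ c : L, τ (c + τ (algebraMap F L ε) * τ c) =
        algebraMap F L ε * (c + τ (algebraMap F L ε) * τ c) := by
      intro c
      rw [map_add, map_mul, hτ, hτ, mul_add, ← mul_assoc, hετ, one_mul, add_comm]
    by_contra! hno
    have hz : ∀ c : L, c + τ (algebraMap F L ε) * τ c = 0 := fun c => by
      by_contra h0
      exact hno _ h0 (hc c)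
    obtain ⟨l, hl⟩ := hne
    have h1 := hz 1
    rw [map_one, mul_one] at h1
    have h2 := hz l
    rw [eq_neg_of_add_eq_zero_right h1] at h2
    exact hl (by linear_combination -h2)
  let h : V →ₗ[L] V →ₛₗ[τ] L := LinearMap.mk₂'ₛₗ (RingHom.id L) τ (fun u v => δ * s u v)
    (fun u u' v => by
      rw [← mul_add]
      congr 1
      refine huniq fun l => ?_
      rw [mul_add, map_add, hs, hs, hs, smul_add, map_add, LinearMap.add_apply])
    (fun c u v => by
      rw [RingHom.id_apply, smul_eq_mul, mul_left_comm]
      congr 1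
      refine huniq fun l => ?_
      rw [hs, ← mul_assoc, hs, mul_smul])
    (fun u v v' => by
      rw [← mul_add]
      congr 1
      refine huniq fun l => ?_
      rw [mul_add, map_add, hs, hs, hs, map_add])
    (fun c u v => by
      rw [smul_eq_mul, mul_left_comm]
      congr 1
      refine huniq fun l => ?_
      rw [hs, ← mul_assoc, hs, mul_comm l, mul_smul, hadj, hadj, hadj, hτ])
  have hh : ∀ u v, h u v = δ * s u v := fun _ _ => rfl
  refine ⟨h, ⟨hτ, by simp, fun u v => ?_, fun u hu => ?_⟩, fun z hz => ?_⟩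
  · rw [hh, hh, hs_symm u v, map_mul, hδ]
    ring
  · refine hβ.nondeg u fun v => ?_
    have h1 := hu v
    rw [hh, mul_eq_zero] at h1
    have h2 := hs u v 1
    rw [h1.resolve_left hδ0, mul_zero, map_zero, one_smul] at h2
    exact h2.symm
  · constructor
    · intro H u v
      have h1 := H u v
      rw [hh, hh] at h1
      have h2 := hs (z u) (z v) 1
      rw [mul_left_cancel₀ hδ0 h1, hs, one_smul, one_smul] at h2
      exact h2.symm
    · intro H u v
      rw [hh, hh]
      congr 1
      refine huniq fun l => ?_
      rw [hs, hs, ← hz, H]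

end HermitianLift

end ClassicalGroups

namespace ClassicalGroups

open Polynomial

/-! ### The factors of unitary type -/

section Phi3

variable {F : Type*} [Field F] {σ : F →+* F}

/-- If `r` is the image of `t`, self-duality of `f` says that `r⁻¹` is a root of `f^σ`. So `σ` on
the constants together with `t ↦ r⁻¹` factors through `F[t]/(f)`. -/
theorem exists_dual_involution {f : F[X]} (h0 : f.coeff 0 ≠ 0) (hf : f = dualPoly σ f)
    {L : Type*} [Field L] (e : AdjoinRoot f ≃+* L) :
    ∃ τ : L →+* L, (∀ c, τ (e (AdjoinRoot.mk f (C c))) = e (AdjoinRoot.mk f (C (σ c)))) ∧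
      e (AdjoinRoot.mk f X) * τ (e (AdjoinRoot.mk f X)) = 1 := by
  let ψ : F →+* L := e.toRingHom.comp (AdjoinRoot.of f)
  let r : L := e (AdjoinRoot.mk f X)
  have hev : ∀ q : F[X], eval₂ ψ r q = e (AdjoinRoot.mk f q) := by
    intro q
    have : eval₂RingHom ψ r = e.toRingHom.comp (AdjoinRoot.mk f) := by
      apply Polynomial.ringHom_ext
      · intro c
        simp [ψ]
      · simp [r]
    exact RingHom.congr_fun this q
  have hr : eval₂ ψ r f = 0 := by rw [hev, AdjoinRoot.mk_self, map_zero]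
  have hr0 : r ≠ 0 := by
    intro h
    rw [h, eval₂_at_zero] at hr
    exact h0 (by simpa using hr)
  have hrev : eval₂ ψ r (f.map σ).reverse = 0 := by
    rw [hf, dualPoly, eval₂_mul, eval₂_C, mul_eq_zero] at hr
    exact hr.resolve_left ((map_ne_zero ψ).2 (inv_ne_zero ((map_ne_zero σ).2 h0)))
  have hinv : eval₂ (ψ.comp σ) r⁻¹ f = 0 := by
    rw [← eval₂_map]
    let : Invertible r⁻¹ := ⟨r, mul_inv_cancel₀ hr0, inv_mul_cancel₀ hr0⟩
    exact (eval₂_reverse_eq_zero_iff ψ r⁻¹ (f.map σ)).1 hrev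
  refine ⟨(AdjoinRoot.lift (ψ.comp σ) r⁻¹ hinv).comp e.symm.toRingHom, fun c => ?_, ?_⟩
  · change AdjoinRoot.lift (ψ.comp σ) r⁻¹ hinv (e.symm (e _)) = _
    rw [RingEquiv.symm_apply_apply, AdjoinRoot.lift_mk, eval₂_C]
    rfl
  · change _ * AdjoinRoot.lift (ψ.comp σ) r⁻¹ hinv (e.symm (e _)) = _
    rw [RingEquiv.symm_apply_apply, AdjoinRoot.lift_mk, eval₂_X]
    exact mul_inv_cancel₀ hr0

theorem dual_involution_invol (hσ : ∀ a, σ (σ a) = a) {f : F[X]} {L : Type*} [Field L]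
    (e : AdjoinRoot f ≃+* L) {τ : L →+* L}
    (hc : ∀ c, τ (e (AdjoinRoot.mk f (C c))) = e (AdjoinRoot.mk f (C (σ c))))
    (hX : e (AdjoinRoot.mk f X) * τ (e (AdjoinRoot.mk f X)) = 1) (l : L) : τ (τ l) = l := by
  obtain ⟨b, rfl⟩ := e.surjective l
  obtain ⟨q, rfl⟩ := AdjoinRoot.mk_surjective b
  have : (τ.comp τ).comp (e.toRingHom.comp (AdjoinRoot.mk f)) =
      e.toRingHom.comp (AdjoinRoot.mk f) := by
    apply Polynomial.ringHom_ext
    · intro c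
      change τ (τ (e (AdjoinRoot.mk f (C c)))) = e (AdjoinRoot.mk f (C c))
      rw [hc, hc, hσ]
    · change τ (τ (e (AdjoinRoot.mk f X))) = e (AdjoinRoot.mk f X)
      have h1 := congrArg τ hX
      rw [map_mul, map_one] at h1
      rw [eq_inv_of_mul_eq_one_right hX, map_inv₀, eq_inv_of_mul_eq_one_right hX, inv_inv]
  exact RingHom.congr_fun this q

/-- If the involution were trivial then `r² = 1`, and the irreducible `f` would divide `t - 1` or `t
+ 1`, contrary to its degree. -/
theorem dual_involution_ne {f : F[X]} (hi : Irreducible f) (hd : 1 < f.natDegree) {L : Type*}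
    [Field L] (e : AdjoinRoot f ≃+* L) {τ : L →+* L}
    (hX : e (AdjoinRoot.mk f X) * τ (e (AdjoinRoot.mk f X)) = 1) : ∃ l, τ l ≠ l := by
  by_contra! hcon
  rw [hcon, ← map_mul, ← map_mul, ← map_one e, e.injective.eq_iff, ← map_one (AdjoinRoot.mk f),
    AdjoinRoot.mk_eq_mk] at hX
  have h1 : (X * X - 1 : F[X]) = (X - C 1) * (X - C (-1)) := by
    rw [C_neg, C_1]; ring
  rw [h1] at hX
  rcases hi.prime.dvd_or_dvd hX with h | h <;>
  · have := natDegree_le_of_dvd h (X_sub_C_ne_zero _)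
    rw [natDegree_X_sub_C] at this
    omega

variable {V : Type*} [AddCommGroup V] [Module F V] {ε : F} {β : V →ₗ[F] V →ₛₗ[σ] F} {x : V ≃ₗ[F] V}

/-- For constants this is sesquilinearity, for `t` it says that the adjoint of `x` is `x⁻¹`. Sums
and products follow, the order reversal of adjoints being harmless in the commutative `L`. -/
theorem isAdj_fieldAction (hβ : IsEpsHermitian ε β) (hx : x ∈ isometryGroup β) {f : F[X]}
    {L : Type*} [Field L] (e : AdjoinRoot f ≃+* L) (φ : L →+* Module.End F V)
    (h : ∀ q : F[X], φ (e (AdjoinRoot.mk f q)) = aeval (x : Module.End F V) q) {τ : L →+* L}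
    (hc : ∀ c, τ (e (AdjoinRoot.mk f (C c))) = e (AdjoinRoot.mk f (C (σ c))))
    (hX : e (AdjoinRoot.mk f X) * τ (e (AdjoinRoot.mk f X)) = 1) (l : L) :
    IsAdj β (φ l) (φ (τ l)) := by
  obtain ⟨b, rfl⟩ := e.surjective l
  obtain ⟨q, rfl⟩ := AdjoinRoot.mk_surjective b
  have hC : ∀ c, IsAdj β (φ (e (AdjoinRoot.mk f (C c)))) (φ (τ (e (AdjoinRoot.mk f (C c))))) := by
    intro c u v
    rw [hc, h, h, aeval_C, aeval_C, Module.algebraMap_end_apply, Module.algebraMap_end_apply,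
      LinearMap.map_smulₛₗ, LinearMap.map_smulₛₗ, LinearMap.smul_apply, hβ.invol]
    rfl
  have hXadj : IsAdj β (φ (e (AdjoinRoot.mk f X))) (φ (τ (e (AdjoinRoot.mk f X)))) := by
    have h1 : φ (τ (e (AdjoinRoot.mk f X))) = ((x⁻¹ : V ≃ₗ[F] V) : Module.End F V) := by
      have h2 := congrArg φ hX
      rw [map_mul, map_one, h, aeval_X] at h2
      ext v
      have h3 := LinearMap.congr_fun h2 v
      rw [Module.End.mul_apply, Module.End.one_apply, LinearEquiv.coe_coe] at h3
      have h4 := congrArg (x⁻¹ : V ≃ₗ[F] V) h3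
      rw [← LinearEquiv.mul_apply, inv_mul_cancel] at h4
      exact h4
    rw [h1, h, aeval_X]
    exact isAdj_of_isometry hx
  have hmul : ∀ l l' : L, IsAdj β (φ l) (φ (τ l)) → IsAdj β (φ l') (φ (τ l')) →
      IsAdj β (φ (l * l')) (φ (τ (l * l'))) := by
    intro l l' h1 h2 u v
    rw [map_mul, Module.End.mul_apply, h1, h2, mul_comm l, map_mul, map_mul, Module.End.mul_apply]
  induction q using Polynomial.induction_on with
  | C c => exact hC c
  | add p q hp hq =>
    intro u v
    simp only [map_add, LinearMap.add_apply]
    rw [hp, hq]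
  | monomial n c ih =>
    rw [pow_succ, ← mul_assoc, map_mul, map_mul]
    exact hmul _ _ ih hXadj

theorem stdForm_equivFun {L : Type*} [Field L] [Module L V] {τ : L →+* L}
    {H : V →ₗ[L] V →ₛₗ[τ] L} {m : ℕ} (b : Module.Basis (Fin m) L V)
    (hb : ∀ i j, H (b i) (b j) = if i = j then 1 else 0) (u v : V) :
    stdForm m τ (b.equivFun u) (b.equivFun v) = H u v := by
  conv_rhs => rw [← b.sum_repr u, ← b.sum_repr v]
  simp only [map_sum, LinearMap.map_smulₛₗ, LinearMap.sum_apply, LinearMap.smul_apply, hb,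
    smul_eq_mul, RingHom.id_apply, mul_ite, mul_one, mul_zero, Finset.sum_ite_eq', Finset.mem_univ, if_true]
  rw [Finset.sum_congr rfl fun i _ => mul_comm (τ (b.repr v i)) (b.repr u i)]
  rfl

/-- Commuting with `x` means being `L`-linear, and for such maps preserving `β` means preserving the
hermitian lift. Coordinates in an orthonormal basis turn the lift into the standard form. -/
theorem centralizer_equiv_stdForm [Finite F] [FiniteDimensional F V] (hβ : IsEpsHermitian ε β)
    {f : F[X]} {L : Type*} [Field L] [Finite L]
    (hL : Nat.card L = Nat.card F ^ f.natDegree) (hd : 0 < f.natDegree)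
    (e : AdjoinRoot f ≃+* L) (φ : L →+* Module.End F V)
    (h : ∀ q : F[X], φ (e (AdjoinRoot.mk f q)) = aeval (x : Module.End F V) q) {τ : L →+* L}
    (hc : ∀ c, τ (e (AdjoinRoot.mk f (C c))) = e (AdjoinRoot.mk f (C (σ c))))
    (hinv : ∀ l, τ (τ l) = l) (hne : ∃ l, τ l ≠ l) (hadj : ∀ l, IsAdj β (φ l) (φ (τ l)))
    (hnorm : ∀ c, c ≠ 0 → τ c = c → ∃ d, d * τ d = c) {m : ℕ}
    (hm : m * f.natDegree = Module.finrank F V) :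
    Nonempty (centralizerIn (isometryGroup β) x ≃* isometryGroup (stdForm m τ)) := by
  obtain ⟨hfin, hrank⟩ := finrank_fieldModule hL hd e φ h hm
  let := fieldAlgebra e
  let := fieldModule φ
  have htower := fieldAction_tower e φ h
  obtain ⟨H, hH, hiso⟩ := exists_hermitian_lift (L := L) hβ hinv hne hc (fun l u v => hadj l u v)
  obtain ⟨b', hb'⟩ := exists_orthonormal_basis hH hne hnorm
  obtain ⟨b, hb⟩ : ∃ b : Module.Basis (Fin m) L V,
      ∀ i j, H (b i) (b j) = if i = j then 1 else 0 := by
    rw [← hrank]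
    exact ⟨b', hb'⟩
  let E : V ≃ₗ[L] (Fin m → L) := b.equivFun
  have hE : ∀ u v, stdForm m τ (E u) (E v) = H u v := stdForm_equivFun b hb
  have hlin : ∀ y : centralizerIn (isometryGroup β) x, ∀ (l : L) (w : V),
      (y : V ≃ₗ[F] V) (l • w) = l • (y : V ≃ₗ[F] V) w := by
    intro y l w
    have hy : Commute ((y : V ≃ₗ[F] V) : Module.End F V) (x : Module.End F V) := by
      ext w
      exact LinearEquiv.congr_fun (mem_centralizerIn.1 y.2).1 w
    exact LinearMap.congr_fun (commute_fieldAction e φ h hy l).eq w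
  let lift : centralizerIn (isometryGroup β) x → (V ≃ₗ[L] V) := fun y =>
    { toFun := (y : V ≃ₗ[F] V), map_add' := map_add (y : V ≃ₗ[F] V), map_smul' := hlin y,
      invFun := (y : V ≃ₗ[F] V).symm,
      left_inv := (y : V ≃ₗ[F] V).left_inv, right_inv := (y : V ≃ₗ[F] V).right_inv }
  have hlift : ∀ y v, lift y v = (y : V ≃ₗ[F] V) v := fun _ _ => rfl
  let drop : ((Fin m → L) ≃ₗ[L] (Fin m → L)) → (V ≃ₗ[L] V) := fun z =>
    (E.trans z).trans E.symm
  have hdrop : ∀ z v, E (drop z v) = z (E v) := fun z v => E.apply_symm_apply _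
  refine ⟨{
    toFun := fun y => ⟨(E.symm.trans (lift y)).trans E, fun u v => ?_⟩
    invFun := fun z => ⟨(drop z).restrictScalars F, mem_centralizerIn.2 ⟨?_, ?_⟩⟩
    left_inv := fun y => Subtype.ext (LinearEquiv.ext fun v => ?_)
    right_inv := fun z => Subtype.ext (LinearEquiv.ext fun v => ?_)
    map_mul' := fun y z => Subtype.ext (LinearEquiv.ext fun v => ?_) }⟩
  · change stdForm m τ (E (lift y (E.symm u))) (E (lift y (E.symm v))) = _
    rw [hE, (hiso (lift y) (fun l w => map_smul (lift y) l w)).2 (mem_centralizerIn.1 y.2).2, ← hE,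
      LinearEquiv.apply_symm_apply, LinearEquiv.apply_symm_apply]
  · have haw : ∀ w, x w = e (AdjoinRoot.mk f X) • w := fun w => by
      change _ = φ _ w
      rw [h, aeval_X]
      rfl
    ext w
    change drop z (x w) = x (drop z w)
    rw [haw, haw, map_smul]
  · refine (hiso (drop z) (fun l w => map_smul (drop z) l w)).1 fun u v => ?_
    rw [← hE, hdrop, hdrop, z.2, hE]
  · change E.symm (E (lift y (E.symm (E v)))) = _
    rw [LinearEquiv.symm_apply_apply, LinearEquiv.symm_apply_apply, hlift]
  · change E (drop z (E.symm v)) = _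
    rw [hdrop, LinearEquiv.apply_symm_apply]
  · change E (lift (y * z) (E.symm v)) = E (lift y (E.symm (E (lift z (E.symm v)))))
    rw [LinearEquiv.symm_apply_apply]
    rfl

theorem phi3_equiv [Finite F] [FiniteDimensional F V] (hβ : IsEpsHermitian ε β)
    (hx : x ∈ isometryGroup β) {f : F[X]} (hf : f ∈ Phi3 σ)
    (hker : aeval (x : Module.End F V) f = 0) {m : ℕ}
    (hm : m * f.natDegree = Module.finrank F V) (p : ℕ) [Fact p.Prime] {a : ℕ} (ha : 0 < a)
    (hL : p ^ (2 * a) = Nat.card F ^ f.natDegree) :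
    Nonempty (centralizerIn (isometryGroup β) x ≃* Uq p m a) := by
  obtain ⟨f1, f2, f3, f4, f5⟩ := hf
  have hL' : Nat.card (GaloisField p (2 * a)) = Nat.card F ^ f.natDegree := by
    rw [GaloisField.card p (2 * a) (by omega), hL]
  obtain ⟨e, φ, h⟩ := exists_field_action f1 f3 hker (GaloisField p (2 * a)) hL'
  obtain ⟨τ, hc, hX⟩ := exists_dual_involution f2 f4 e
  have hinv := dual_involution_invol hβ.invol e hc hX
  have hne := dual_involution_ne f3 f5 e hX
  have hadj := isAdj_fieldAction hβ hx e φ h hc hX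
  have hτ := involution_eq_frobenius ha τ hinv hne
  have key := centralizer_equiv_stdForm hβ hL' f3.natDegree_pos e φ h hc hinv hne hadj
    (fun c hc0 hcτ => by
      rw [hτ, iterateFrobenius_def] at hcτ
      obtain ⟨d, hd⟩ := exists_norm_eq ha c hc0 hcτ
      exact ⟨d, by rw [hτ, iterateFrobenius_def, hd]⟩) hm
  rw [hτ] at key
  exact key

end Phi3

end ClassicalGroups

namespace ClassicalGroups

open Polynomial

/-! ### Degrees and coprimality of members of Φ -/

section Degrees

variable {F : Type*} [Field F]

/-- When `σ` is trivial the involution is an `F`-automorphism of order two of `F[t]/(f)`, and two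
divides the order of the Galois group, which is `deg f`. -/
theorem even_natDegree_of_phi3 [Finite F] {f : F[X]} (hf : f ∈ Phi3 (RingHom.id F)) :
    Even f.natDegree := by
  obtain ⟨f1, f2, f3, f4, f5⟩ := hf
  have : Fact (Irreducible f) := ⟨f3⟩
  have : Module.Finite F (AdjoinRoot f) := (AdjoinRoot.powerBasis' f1).finite
  have : Finite (AdjoinRoot f) := Module.finite_of_finite F
  obtain ⟨τ, hc, hX⟩ := exists_dual_involution f2 f4 (RingEquiv.refl (AdjoinRoot f))
  have hinv := dual_involution_invol (fun _ => rfl) (RingEquiv.refl (AdjoinRoot f)) hc hX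
  obtain ⟨l, hl⟩ := dual_involution_ne f3 f5 (RingEquiv.refl (AdjoinRoot f)) hX
  let T : AdjoinRoot f ≃ₐ[F] AdjoinRoot f := AlgEquiv.ofRingEquiv (f := RingEquiv.ofRingHom τ τ
    (RingHom.ext hinv) (RingHom.ext hinv)) hc
  have hT : orderOf T = 2 := by
    refine orderOf_eq_prime ?_ fun h => hl ?_
    · ext b
      rw [sq, AlgEquiv.mul_apply]
      exact hinv _
    · exact AlgEquiv.congr_fun h l
  have h1 := orderOf_dvd_natCard T
  rw [hT, IsGalois.card_aut_eq_finrank] at h1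
  have h2 : Module.finrank F (AdjoinRoot f) = f.natDegree := finrank_quotient_span_eq_natDegree
  rw [h2] at h1
  exact even_iff_two_dvd.2 h1

theorem X_sub_C_mem_phi1 {σ : F →+* F} {c : F} (hc : c * σ c = 1) : (X - C c : F[X]) ∈ Phi1 σ := by
  have hc0 : c ≠ 0 := left_ne_zero_of_mul_eq_one hc
  have hs0 : σ c ≠ 0 := right_ne_zero_of_mul_eq_one hc
  refine ⟨monic_X_sub_C c, by simpa using hc0, irreducible_X_sub_C c, ?_, natDegree_X_sub_C c⟩
  have h1 : (X - C c : F[X]).map σ = X - C (σ c) := by simp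
  have h2 : (C (σ c) : F[X]).reflect 1 = C (σ c) * X := by
    have h := reflect_C (σ c) 1
    rwa [pow_one] at h
  rw [dualPoly, h1, reverse, natDegree_X_sub_C, reflect_sub, reflect_one_X, h2, coeff_sub,
    coeff_X_zero, coeff_C_zero, zero_sub, map_neg, inv_neg, map_neg, mul_sub, mul_one, ← mul_assoc,
    neg_mul, ← C_mul, inv_mul_cancel₀ hs0, C_1, eq_comm, ← eq_inv_of_mul_eq_one_left hc]
  ring

/-- Used to invert `x - 1` on the Φ₂ and Φ₃ pieces. -/
theorem isCoprime_X_sub_one {σ : F →+* F} (hσ : ∀ a, σ (σ a) = a) {f : F[X]}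
    (hf : f ∈ Phi2 σ ∨ f ∈ Phi3 σ) : IsCoprime f (X - C 1) := by
  refine IsPhi.isCoprime hσ (Or.inr hf) (Or.inl (X_sub_C_mem_phi1 (by rw [map_one, mul_one]))) ?_
  rintro rfl
  rcases hf with hf | hf
  · exact not_isPhi2Factor_of_irreducible (irreducible_X_sub_C 1) hf
  · exact absurd hf.2.2.2.2 (by rw [natDegree_X_sub_C]; exact lt_irrefl 1)

end Degrees

/-! ### Quadratic forms and their polar forms -/

section Quadratic

variable {F V : Type*} [Field F] [AddCommGroup V] [Module F V]

theorem polar_of_isometry {Q : QuadraticForm F V} {y : V ≃ₗ[F] V} (hy : y ∈ quadIsometryGroup Q)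
    (u v : V) : QuadraticMap.polar Q (y u) (y v) = QuadraticMap.polar Q u v := by
  have hy' : ∀ v, Q (y v) = Q v := hy
  simp only [QuadraticMap.polar, ← map_add, hy']

theorem mem_isometryGroup_polarBilin {Q : QuadraticForm F V} {y : V ≃ₗ[F] V}
    (hy : y ∈ quadIsometryGroup Q) :
    y ∈ isometryGroup (σ := RingHom.id F) Q.polarBilin := polar_of_isometry hy

/-- `Q(xu - u) = 2 Q(u) - β(xu, u) = β(u, u) - β(xu, u)` for the polar form `β`, so on the image of
`x - 1` the values of `Q` depend only on `β` and `x`. The point of the argument is characteristic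
two. -/
theorem mem_quadIsometryGroup_of_polar {Q : QuadraticForm F V} {x y : V ≃ₗ[F] V}
    (hx : x ∈ quadIsometryGroup Q)
    (hy : ∀ u v, QuadraticMap.polar Q (y u) (y v) = QuadraticMap.polar Q u v)
    (hyx : y * x = x * y) (h1 : ∀ v, ∃ u, v = x u - u) : y ∈ quadIsometryGroup Q := by
  have hsub : ∀ u v, Q (u - v) = Q u + Q v - QuadraticMap.polar Q u v := by
    intro u v
    have h := QuadraticMap.map_add Q u (-v)
    rw [QuadraticMap.map_neg, QuadraticMap.polar_neg_right, ← sub_eq_add_neg] at h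
    rw [h]
    ring
  intro v
  obtain ⟨u, rfl⟩ := h1 v
  have hcomm : y (x u) = x (y u) := LinearEquiv.congr_fun hyx u
  rw [map_sub, hsub, hsub, hy, hcomm, hx, hx]
  have h2 : ∀ w, Q w + Q w = QuadraticMap.polar Q w w := fun w => by
    rw [QuadraticMap.polar_self, two_nsmul]
  rw [h2, h2, hy]

end Quadratic

end ClassicalGroups

namespace ClassicalGroups

open Polynomial

/-! ### Assembling the structure theorem -/

section Structure

variable {F V : Type*} [Field F] [AddCommGroup V] [Module F V] {σ : F →+* F} {ε : F}
  {β : V →ₗ[F] V →ₛₗ[σ] F} {x : V ≃ₗ[F] V}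

theorem isSemisimple_of_orderOf_coprime [Finite F] [FiniteDimensional F V] {p k : ℕ}
    [Fact p.Prime] (hF : Nat.card F = p ^ k) (hx : (orderOf x).Coprime p) :
    Module.End.IsSemisimple (x : Module.End F V) := by
  have : Finite V := Module.finite_of_finite F
  have : Finite (V ≃ₗ[F] V) := DFunLike.finite _
  have hp : (p : F) = 0 := by
    have h1 : ((p ^ k : ℕ) : F) = 0 := by
      rw [← hF]
      let := Fintype.ofFinite F
      rw [Nat.card_eq_fintype_card]
      exact Nat.cast_card_eq_zero F
    rw [Nat.cast_pow] at h1
    exact eq_zero_of_pow_eq_zero h1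
  have hN : ((orderOf x : ℕ) : F) ≠ 0 := by
    intro h0
    have h2 := (Nat.isCoprime_iff_coprime.2 hx)
    obtain ⟨a, b, hab⟩ := h2
    have h3 := congrArg (Int.cast : ℤ → F) hab
    push_cast at h3
    rw [h0, hp, mul_zero, mul_zero, add_zero] at h3
    exact zero_ne_one h3
  exact isSemisimple_of_pow_eq_one hN (pow_orderOf_eq_one x)

theorem isEpsHermitian_kerEval (hβ : IsEpsHermitian ε β) (hx : x ∈ isometryGroup β)
    [FiniteDimensional F V]
    (hs : Module.End.IsSemisimple (x : Module.End F V)) {f : F[X]} (hf : IsPhi σ f) :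
    IsEpsHermitian ε (β.domRestrict₁₂ (kerEval x f) (kerEval x f)) :=
  hβ.restrict _ fun u hu h =>
    kerEval_nondeg hβ hx hs hf.coeff_zero_ne (hf.self_dual hβ.invol) u hu h

/-- The exponents are kept abstract: `h2` and `h3` only say that `p ^ a f` and `p ^ (2 * a f)` are
the orders of `F[t]/(g)` and `F[t]/(f)`. This covers both normalizations of `d_f`. -/
theorem exists_structure_equiv [Finite F] [FiniteDimensional F V] (hβ : IsEpsHermitian ε β)
    (hx : x ∈ isometryGroup β) (hs : Module.End.IsSemisimple (x : Module.End F V))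
    (G : Subgroup (V ≃ₗ[F] V)) (Gf : ∀ f : F[X], Subgroup (kerEval x f ≃ₗ[F] kerEval x f))
    (hG : ∀ y : Subgroup.centralizer ({x} : Set (V ≃ₗ[F] V)),
      (y : V ≃ₗ[F] V) ∈ G ↔ ∀ i, kerRestrict x (genPoly σ x i) y ∈ Gf (genPoly σ x i))
    (hGf : ∀ f, f ∈ Phi2 σ ∨ f ∈ Phi3 σ → centralizerIn (Gf f) (selfRestrict x f) =
      centralizerIn (isometryGroup (β.domRestrict₁₂ (kerEval x f) (kerEval x f)))
        (selfRestrict x f))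
    (p : ℕ) [Fact p.Prime] (a : F[X] → ℕ)
    (h2 : ∀ f g, IsPhi2Factor σ f g → p ^ a f = Nat.card F ^ g.natDegree)
    (h3 : ∀ f ∈ Phi3 σ, p ^ (2 * a f) = Nat.card F ^ f.natDegree) :
    ∃ φ : centralizerIn G x ≃*
        (∀ f : GenDivisorsIn σ x (Phi1 σ), Gf f.1) ×
        (∀ f : GenDivisorsIn σ x (Phi2 σ), GLq p (genMult σ x f.1 1) (a f.1)) ×
        (∀ f : GenDivisorsIn σ x (Phi3 σ), Uq p (genMult σ x f.1 1) (a f.1)),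
      ∀ y f v, (((φ y).1 f : kerEval x f.1 ≃ₗ[F] kerEval x f.1) v : V) = (y : V ≃ₗ[F] V) v := by
  have hne : ∀ {b d : ℕ}, p ^ b = Nat.card F ^ d → 0 < d → b ≠ 0 := by
    rintro b d h hd rfl
    rw [pow_zero] at h
    exact absurd h.symm (Nat.one_lt_pow hd.ne' Finite.one_lt_card).ne'
  refine exists_centralizer_equiv hβ hx hs G Gf hG _ _ (fun f => ?_) fun f => ?_
  · obtain ⟨g, hg, hm⟩ := exists_genMult_mul_natDegree hs f.2.1
    rw [hGf f.1 (Or.inl f.2.1)]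
    have hL := h2 f.1 g hg
    have hW := isEpsHermitian_kerEval hβ hx hs (Or.inr (Or.inl f.2.1) : IsPhi σ f.1)
    obtain ⟨g1, g2, g3, g4, g5⟩ := hg
    have ha := hne hL g3.natDegree_pos
    refine phi2_equiv hW (selfRestrict_mem_isometryGroup hx f.1) g1 g2 g3 g4 ?_ ?_ _ ?_
    · rw [← g5]
      exact aeval_selfRestrict_self x f.1
    · rw [hm, finrank_kerEval_selfRestrict x (g5 ▸ dvd_mul_right g _)]
    · rw [GaloisField.card p _ ha, hL]
  · rw [hGf f.1 (Or.inr f.2.1)]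
    have hf := f.2.1
    have hL := h3 f.1 hf
    have hW := isEpsHermitian_kerEval hβ hx hs (Or.inr (Or.inr f.2.1) : IsPhi σ f.1)
    have ha := hne hL hf.2.2.1.natDegree_pos
    refine phi3_equiv hW (selfRestrict_mem_isometryGroup hx f.1) hf
      (aeval_selfRestrict_self x f.1) ?_ p (by omega) hL
    exact genMult_mul_natDegree hs hf.1 hf.2.2.1

theorem natDegree_of_isPhi2Factor {f g : F[X]} (h : IsPhi2Factor σ f g) :
    f.natDegree = 2 * g.natDegree := by
  obtain ⟨g1, g2, g3, g4, rfl⟩ := h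
  rw [g1.natDegree_mul (dualPoly_monic g2), natDegree_dualPoly g2, two_mul]

theorem form_structure_equiv [Finite F] [FiniteDimensional F V] (hβ : IsEpsHermitian ε β)
    (hx : x ∈ isometryGroup β) (hs : Module.End.IsSemisimple (x : Module.End F V))
    (p : ℕ) [Fact p.Prime] (a : F[X] → ℕ)
    (h2 : ∀ f g, IsPhi2Factor σ f g → p ^ a f = Nat.card F ^ g.natDegree)
    (h3 : ∀ f ∈ Phi3 σ, p ^ (2 * a f) = Nat.card F ^ f.natDegree) :
    Nonempty (centralizerIn (isometryGroup β) x ≃*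
        (∀ f : GenDivisorsIn σ x (Phi1 σ),
          isometryGroup (β.domRestrict₁₂ (kerEval x f.1) (kerEval x f.1))) ×
        (∀ f : GenDivisorsIn σ x (Phi2 σ), GLq p (genMult σ x f.1 1) (a f.1)) ×
        (∀ f : GenDivisorsIn σ x (Phi3 σ), Uq p (genMult σ x f.1 1) (a f.1))) := by
  obtain ⟨φ, -⟩ := exists_structure_equiv hβ hx hs (isometryGroup β)
    (fun f => isometryGroup (β.domRestrict₁₂ (kerEval x f) (kerEval x f)))
    (mem_isometryGroup_iff_genPoly hβ hx hs) (fun _ _ => rfl) p a h2 h3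
  exact ⟨φ⟩

theorem isEpsHermitian_polarBilin {Q : QuadraticForm F V} (hQ : Q.polarBilin.Nondegenerate) :
    IsEpsHermitian (σ := RingHom.id F) 1 Q.polarBilin where
  invol _ := rfl
  eps := one_mul _
  symm u v := by
    rw [one_mul]
    exact QuadraticMap.polar_comm Q v u
  nondeg u hu := hQ.1 u hu

theorem quad_structure_equiv [Finite F] [FiniteDimensional F V] {Q : QuadraticForm F V}
    (hQ : Q.polarBilin.Nondegenerate) (hx : x ∈ quadIsometryGroup Q)
    (hs : Module.End.IsSemisimple (x : Module.End F V)) (p : ℕ) [Fact p.Prime] (a : F[X] → ℕ)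
    (h2 : ∀ f g, IsPhi2Factor (RingHom.id F) f g → p ^ a f = Nat.card F ^ g.natDegree)
    (h3 : ∀ f ∈ Phi3 (RingHom.id F), p ^ (2 * a f) = Nat.card F ^ f.natDegree) :
    ∃ φ : centralizerIn (quadIsometryGroup Q) x ≃*
        (∀ f : GenDivisorsIn (RingHom.id F) x (Phi1 (RingHom.id F)),
          quadIsometryGroup (Q.comp (kerEval x f.1).subtype)) ×
        (∀ f : GenDivisorsIn (RingHom.id F) x (Phi2 (RingHom.id F)),
          GLq p (genMult (RingHom.id F) x f.1 1) (a f.1)) ×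
        (∀ f : GenDivisorsIn (RingHom.id F) x (Phi3 (RingHom.id F)),
          Uq p (genMult (RingHom.id F) x f.1 1) (a f.1)),
      ∀ y f v, (((φ y).1 f : kerEval x f.1 ≃ₗ[F] kerEval x f.1) v : V) = (y : V ≃ₗ[F] V) v := by
  have hβ := isEpsHermitian_polarBilin hQ
  have hx' := mem_isometryGroup_polarBilin hx
  classical
  refine exists_structure_equiv hβ hx' hs (quadIsometryGroup Q)
    (fun f => quadIsometryGroup (Q.comp (kerEval x f).subtype)) (fun y => ?_) (fun f hf => ?_)
    p a h2 h3
  · refine ⟨fun hy i v => hy v, fun h v => ?_⟩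
    have hp : (y : V ≃ₗ[F] V) ∈ isometryGroup (σ := RingHom.id F) Q.polarBilin := by
      refine (mem_isometryGroup_iff_genPoly hβ hx' hs y).2 fun i u v => ?_
      exact polar_of_isometry (h i) u v
    have hv : v ∈ ⨆ i, kerEval x (genPoly (RingHom.id F) x i) := by
      rw [(isInternal_genPoly hβ hx' hs).submodule_iSup_eq_top]
      exact Submodule.mem_top
    induction hv using Submodule.iSup_induction' with
    | mem i v hv => exact h i ⟨v, hv⟩
    | zero => rw [map_zero]
    | add u v _ _ hu hv =>
      rw [map_add, QuadraticMap.map_add Q, QuadraticMap.map_add Q, hu, hv]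
      congr 1
      exact hp u v
  · ext y
    rw [mem_centralizerIn, mem_centralizerIn]
    refine and_congr_right fun hy => ⟨fun h => mem_isometryGroup_polarBilin h, fun h => ?_⟩
    -- Isometries of the polar form commuting with `x` preserve `Q` here, since the Bézout relation
    -- between `f` and `t - 1` exhibits every vector as a value of `x - 1`.
    refine mem_quadIsometryGroup_of_polar (x := selfRestrict x f) (fun v => hx v) h hy fun v => ?_
    obtain ⟨A, B, hAB⟩ := isCoprime_X_sub_one (fun _ => rfl) hf
    have h1 := congrArg (fun q => aeval (selfRestrict x f : Module.End F (kerEval x f)) q v) hAB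
    rw [mul_comm B] at h1
    simp only [map_add, map_mul, aeval_selfRestrict_self, mul_zero, zero_add,
      Module.End.mul_apply, map_one, Module.End.one_apply, map_sub, aeval_X,
      LinearMap.sub_apply] at h1
    exact ⟨_, h1.symm⟩

end Structure

end ClassicalGroups

namespace ClassicalGroups

open Polynomial

/-! ### The three types of sesquilinear forms -/

section ClassicalForms

variable {F V : Type*} [Field F] [AddCommGroup V] [Module F V]
  {σ : F →+* F} {p k : ℕ}

theorem eq_id_of_card [Finite F] (hσ : ∀ a, σ a = a ^ (p ^ k)) (hF : Nat.card F = p ^ k) :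
    σ = RingHom.id F := by
  let := Fintype.ofFinite F
  ext a
  rw [hσ, ← hF, Nat.card_eq_fintype_card, FiniteField.pow_card, RingHom.id_apply]

theorem IsClassicalForm.exists_isEpsHermitian [Finite F] (hσ : ∀ a, σ a = a ^ (p ^ k)) {T : FormType}
    {β : V →ₗ[F] V →ₛₗ[σ] F} (h : IsClassicalForm (p ^ k) T β) : ∃ ε, IsEpsHermitian ε β := by
  obtain ⟨hn, h⟩ := h
  have hid : Nat.card F = p ^ k → ∀ a, σ a = a := fun hF a => by rw [eq_id_of_card hσ hF]; rfl
  cases T with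
  | symplectic =>
    have hi := hid h.1
    refine ⟨-1, fun a => by rw [hi, hi], by rw [hi]; ring, fun u v => ?_, hn.1⟩
    have h1 := h.2 (u + v)
    rw [map_add, map_add β, LinearMap.add_apply, LinearMap.add_apply, h.2, h.2, zero_add,
      add_zero] at h1
    rw [hi, neg_one_mul]
    exact eq_neg_of_add_eq_zero_left h1
  | orthogonal =>
    have hi := hid h.1
    exact ⟨1, fun a => by rw [hi, hi], by rw [hi, one_mul],
      fun u v => by rw [hi, one_mul]; exact h.2.2 v u, hn.1⟩
  | unitary =>
    refine ⟨1, fun a => ?_, by rw [map_one, one_mul], fun u v => by rw [one_mul]; exact h.2 v u,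
      hn.1⟩
    let := Fintype.ofFinite F
    rw [hσ, hσ, ← pow_mul, ← sq, ← h.1, Nat.card_eq_fintype_card, FiniteField.pow_card]

theorem pow_half_natDegree_phi2 (hF : Nat.card F = p ^ k) {f g : F[X]}
    (h : IsPhi2Factor σ f g) : p ^ (k * (f.natDegree / 2)) = Nat.card F ^ g.natDegree := by
  rw [natDegree_of_isPhi2Factor h, Nat.mul_div_cancel_left _ two_pos, hF, pow_mul]

theorem pow_half_natDegree_phi3 [Finite F] (hF : Nat.card F = p ^ k) {f : F[X]}
    (h : f ∈ Phi3 (RingHom.id F)) :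
    p ^ (2 * (k * (f.natDegree / 2))) = Nat.card F ^ f.natDegree := by
  have h2 := Nat.mul_div_cancel' (even_natDegree_of_phi3 h).two_dvd
  rw [hF, ← pow_mul, mul_left_comm, h2]

theorem IsClassicalForm.structure_equiv [Finite F] [FiniteDimensional F V] [Fact p.Prime]
    (hσ : ∀ a, σ a = a ^ (p ^ k)) {x : V ≃ₗ[F] V} (hxp : (orderOf x).Coprime p) {T : FormType}
    {β : V →ₗ[F] V →ₛₗ[σ] F} (h : IsClassicalForm (p ^ k) T β) (hx : x ∈ isometryGroup β) :
    Nonempty (centralizerIn (isometryGroup β) x ≃*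
        (∀ f : GenDivisorsIn σ x (Phi1 σ),
          isometryGroup (β.domRestrict₁₂ (kerEval x f.1) (kerEval x f.1))) ×
        (∀ f : GenDivisorsIn σ x (Phi2 σ), GLq p (genMult σ x f.1 1) (k * T.d f.1)) ×
        (∀ f : GenDivisorsIn σ x (Phi3 σ), Uq p (genMult σ x f.1 1) (k * T.d f.1))) := by
  obtain ⟨ε, hβ⟩ := h.exists_isEpsHermitian hσ
  cases T with
  | symplectic =>
    have hF := h.2.1
    obtain rfl := eq_id_of_card hσ hF
    exact form_structure_equiv hβ hx (isSemisimple_of_orderOf_coprime hF hxp) p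
      (fun f => k * (f.natDegree / 2)) (fun f g => pow_half_natDegree_phi2 hF)
      (fun f => pow_half_natDegree_phi3 hF)
  | orthogonal =>
    have hF := h.2.1
    obtain rfl := eq_id_of_card hσ hF
    exact form_structure_equiv hβ hx (isSemisimple_of_orderOf_coprime hF hxp) p
      (fun f => k * (f.natDegree / 2)) (fun f g => pow_half_natDegree_phi2 hF)
      (fun f => pow_half_natDegree_phi3 hF)
  | unitary =>
    have hF : Nat.card F = p ^ (k * 2) := by rw [h.2.1, pow_mul]
    refine form_structure_equiv hβ hx (isSemisimple_of_orderOf_coprime hF hxp) p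
      (fun f => k * f.natDegree) (fun f g hfg => ?_) (fun f _ => ?_)
    · rw [natDegree_of_isPhi2Factor hfg, hF, ← pow_mul, mul_assoc]
    · rw [hF, ← pow_mul, mul_left_comm, mul_assoc, mul_left_comm]

end ClassicalForms

/-! ### Counting by a flip -/

section Counting

/-- Left multiplication by `z` exchanges the elements with and without `P`. As `P` need not define a
subgroup, multiplicativity of the spinor norm is not needed in characteristic two. -/
theorem card_eq_two_mul_card_of_flip {G : Type*} [Group G] [Finite G] (A : Subgroup G)
    {P : G → Prop} {z : G} (hz : z ∈ A) (hP : ∀ y ∈ A, P (z * y) ↔ ¬ P y) :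
    Nat.card A = 2 * Nat.card {y : G // y ∈ A ∧ P y} := by
  classical
  let e : {y : G // y ∈ A ∧ P y} ≃ {y : G // y ∈ A ∧ ¬ P y} :=
    { toFun := fun y => ⟨z * y, A.mul_mem hz y.2.1, fun h => (hP y y.2.1).1 h y.2.2⟩
      invFun := fun y => ⟨z⁻¹ * y, A.mul_mem (A.inv_mem hz) y.2.1, by
        by_contra h
        have h1 := (hP (z⁻¹ * y) (A.mul_mem (A.inv_mem hz) y.2.1)).2 h
        rw [mul_inv_cancel_left] at h1
        exact y.2.2 h1⟩
      left_inv := fun y => Subtype.ext (inv_mul_cancel_left z _)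
      right_inv := fun y => Subtype.ext (mul_inv_cancel_left z _) }
  let s : A ≃ {y : G // y ∈ A ∧ P y} ⊕ {y : G // y ∈ A ∧ ¬ P y} :=
    (Equiv.sumCompl (fun y : A => P y)).symm.trans
      (Equiv.sumCongr (Equiv.subtypeSubtypeEquivSubtypeInter (· ∈ A) P)
        (Equiv.subtypeSubtypeEquivSubtypeInter (· ∈ A) fun y => ¬ P y))
  rw [Nat.card_congr s, Nat.card_sum, ← Nat.card_congr e, two_mul]

end Counting

end ClassicalGroups

namespace ClassicalGroups

open Polynomial

/-! ### Determinants on orthogonal centralizers -/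

section Special

variable {F V : Type*} [Field F] [AddCommGroup V] [Module F V]

theorem mem_specialGroup {y : V ≃ₗ[F] V} :
    y ∈ specialGroup F V ↔ LinearMap.det (y : Module.End F V) = 1 := by
  rw [specialGroup, MonoidHom.mem_ker, Units.ext_iff, LinearEquiv.coe_det, Units.val_one]

theorem card_centralizerIn_special_of_det_eq_one {G : Subgroup (V ≃ₗ[F] V)} {x : V ≃ₗ[F] V}
    (h : ∀ y ∈ centralizerIn G x, LinearMap.det (y : Module.End F V) = 1) :
    Nat.card (centralizerIn (G ⊓ specialGroup F V) x) = Nat.card (centralizerIn G x) := by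
  congr 2
  ext y
  exact ⟨fun hy => ⟨hy.1, hy.2.1⟩, fun hy => ⟨hy.1, hy.2, mem_specialGroup.2 (h y hy)⟩⟩

variable [FiniteDimensional F V]

theorem det_sq_of_isometry {β : V →ₗ[F] V →ₗ[F] F} (hβ : IsEpsHermitian (σ := RingHom.id F) 1 β)
    {y : V ≃ₗ[F] V} (hy : y ∈ isometryGroup (σ := RingHom.id F) β) :
    LinearMap.det (y : Module.End F V) = 1 ∨ LinearMap.det (y : Module.End F V) = -1 := by
  have h1 := hβ.det_eq_of_isAdj (isAdj_of_isometry hy)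
  have h2 : LinearMap.det (y : Module.End F V) *
      LinearMap.det ((y⁻¹ : V ≃ₗ[F] V) : Module.End F V) = 1 := by
    rw [← map_mul, ← LinearMap.det_id (A := F) (M := V)]
    congr 1
    ext v
    exact y.apply_symm_apply v
  rw [RingHom.id_apply] at h1
  rw [← h1] at h2
  exact mul_self_eq_one_iff.1 h2

/-- The centralizer preserves `γ(u, v) = β(u, (x - x⁻¹)v)`. This is alternating because the adjoint
of `x` is `x⁻¹`, and non-degenerate because `x - x⁻¹ = x⁻¹(x² - 1)` is invertible, so the
centralizer lies in a symplectic group. -/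
theorem det_eq_one_of_isUnit_sq_sub_one {β : V →ₗ[F] V →ₗ[F] F}
    (hβ : IsEpsHermitian (σ := RingHom.id F) 1 β) {x y : V ≃ₗ[F] V}
    (hx : x ∈ isometryGroup (σ := RingHom.id F) β) (hu : IsUnit ((x : Module.End F V) ^ 2 - 1))
    (hy : y ∈ centralizerIn (isometryGroup (σ := RingHom.id F) β) x) :
    LinearMap.det (y : Module.End F V) = 1 := by
  obtain ⟨hyx, hy⟩ := mem_centralizerIn.1 hy
  have hyx' : ∀ v, y (x v) = x (y v) := LinearEquiv.congr_fun hyx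
  have hyi : ∀ v, y (x⁻¹ v) = x⁻¹ (y v) := by
    intro v
    have h : y * x⁻¹ = x⁻¹ * y := by rw [eq_inv_mul_iff_mul_eq, ← mul_assoc, ← hyx]; group
    exact LinearEquiv.congr_fun h v
  have hadj := isAdj_of_isometry hx
  have hsymm : ∀ u v, β v u = β u v := fun u v => by rw [hβ.symm u v, one_mul]; rfl
  let γ : V →ₗ[F] V →ₗ[F] F := β.compl₂ ((x : Module.End F V) - ((x⁻¹ : V ≃ₗ[F] V) : Module.End F V))
  have hγ : ∀ u v, γ u v = β u (x v) - β u (x⁻¹ v) := fun u v => by simp [γ]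
  refine det_eq_one_of_alternating γ (fun v => ?_) (fun u hu' => hβ.nondeg u fun v => ?_) y
    fun u v => ?_
  · have h1 : β (x v) v = β v (x⁻¹ v) := hadj v v
    rw [hγ, ← h1, hsymm, sub_self]
  · obtain ⟨w, hw⟩ := (Module.End.isUnit_iff _).1 hu |>.2 (x v)
    have h1 := hu' w
    rw [hγ, ← map_sub] at h1
    have h2 : x (x w - x⁻¹ w) = x v := by
      rw [← hw, map_sub, ← LinearEquiv.mul_apply x x⁻¹, mul_inv_cancel, sq]
      rfl
    rwa [x.injective h2] at h1
  · rw [hγ, hγ]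
    have h1 : ∀ u v, β (y u) (y v) = β u v := hy
    change β (y u) (x (y v)) - β (y u) (x⁻¹ (y v)) = _
    rw [← hyx', ← hyi, h1, h1]

end Special

/-! ### Reflections commuting with `x` -/

section Reflection

variable {F V : Type*} [Field F] [AddCommGroup V] [Module F V] {Q : QuadraticForm F V}

/-- The orthogonal reflection in a non-singular vector of a quadratic form. -/
noncomputable def reflection (Q : QuadraticForm F V) {v : V} (hv : Q v ≠ 0) : V ≃ₗ[F] V :=
  Module.reflection (x := v) (f := (Q v)⁻¹ • Q.polarBilin v) (by
    rw [LinearMap.smul_apply, QuadraticMap.polarBilin_apply_apply, QuadraticMap.polar_self,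
      smul_eq_mul, nsmul_eq_mul, mul_comm, mul_assoc, mul_inv_cancel₀ hv, mul_one]
    norm_num)

theorem reflection_apply {v : V} (hv : Q v ≠ 0) (t : V) :
    reflection Q hv t = t - ((Q v)⁻¹ * QuadraticMap.polar Q t v) • v := by
  rw [QuadraticMap.polar_comm]
  rfl

theorem map_sub_eq (Q : QuadraticForm F V) (u v : V) :
    Q (u - v) = Q u + Q v - QuadraticMap.polar Q u v := by
  rw [sub_eq_add_neg, QuadraticMap.map_add Q, QuadraticMap.map_neg, QuadraticMap.polar_neg_right,
    ← sub_eq_add_neg]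

theorem reflection_mem {v : V} (hv : Q v ≠ 0) : reflection Q hv ∈ quadIsometryGroup Q := by
  intro t
  rw [reflection_apply, map_sub_eq, QuadraticMap.map_smul, QuadraticMap.polar_smul_right,
    smul_eq_mul, smul_eq_mul]
  field_simp
  ring

theorem reflection_self {v : V} (hv : Q v ≠ 0) : reflection Q hv v = -v :=
  Module.reflection_apply_self _

theorem reflection_of_polar_eq_zero {v : V} (hv : Q v ≠ 0) {t : V}
    (ht : QuadraticMap.polar Q t v = 0) : reflection Q hv t = t := by
  rw [reflection_apply, ht, mul_zero, zero_smul, sub_zero]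

theorem reflection_mul_self {v : V} (hv : Q v ≠ 0) : reflection Q hv * reflection Q hv = 1 := by
  ext t
  exact Module.involutive_reflection _ t

theorem det_reflection [FiniteDimensional F V] {v : V} (hv : Q v ≠ 0) :
    LinearMap.det (reflection Q hv : Module.End F V) = -1 := by
  have h : (reflection Q hv : Module.End F V) =
      LinearMap.transvection ((Q v)⁻¹ • Q.polarBilin v) (-v) := by
    ext t
    rw [LinearMap.transvection.apply]
    simp [reflection, Module.reflection_apply, sub_eq_add_neg]
  rw [h, LinearMap.transvection.det, map_neg, LinearMap.smul_apply,
    QuadraticMap.polarBilin_apply_apply, QuadraticMap.polar_self, smul_eq_mul, nsmul_eq_mul]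
  field_simp
  norm_num

theorem reflection_mul_comm {x : V ≃ₗ[F] V} (hx : x ∈ quadIsometryGroup Q) {v : V} (hv : Q v ≠ 0)
    {c : F} (hxv : x v = c • v) (hc : c * c = 1) : reflection Q hv * x = x * reflection Q hv := by
  ext t
  rw [LinearEquiv.mul_apply, LinearEquiv.mul_apply, reflection_apply, reflection_apply, map_sub,
    map_smul, hxv, smul_smul]
  congr 2
  have h := polar_of_isometry hx t v
  rw [hxv, QuadraticMap.polar_smul_right, smul_eq_mul] at h
  rw [← h]
  linear_combination (-(Q v)⁻¹ * QuadraticMap.polar Q (x t) v) * hc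

theorem exists_nonsingular {M : Submodule F V} (hM : M ≠ ⊥)
    (hnd : ∀ u ∈ M, (∀ v ∈ M, QuadraticMap.polar Q u v = 0) → u = 0) :
    ∃ v ∈ M, Q v ≠ 0 := by
  by_contra! h
  obtain ⟨u, hu, hu0⟩ := Submodule.exists_mem_ne_zero_of_ne_bot hM
  refine hu0 (hnd u hu fun v hv => ?_)
  rw [QuadraticMap.polar, h _ (M.add_mem hu hv), h u hu, h v hv, sub_zero, sub_zero]

theorem mem_kerEval_X_sub_C {x : V ≃ₗ[F] V} {c : F} {v : V} :
    v ∈ kerEval x (X - C c) ↔ x v = c • v := by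
  rw [kerEval, LinearMap.mem_ker, map_sub, aeval_X, aeval_C, LinearMap.sub_apply, sub_eq_zero]
  rfl

/-- A symmetric form in odd characteristic comes from a quadratic form. -/
theorem exists_quadraticForm_of_symm (h2 : (2 : F) ≠ 0) {β : V →ₗ[F] V →ₗ[F] F}
    (hβ : ∀ u v, β u v = β v u) : ∃ Q : QuadraticForm F V, Q.polarBilin = β ∧
      quadIsometryGroup Q = isometryGroup (σ := RingHom.id F) β := by
  let Q : QuadraticForm F V := LinearMap.BilinMap.toQuadraticMap ((2 : F)⁻¹ • β)
  have hQ : Q.polarBilin = β := by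
    ext u v
    simp only [Q, QuadraticMap.polarBilin_apply_apply, LinearMap.BilinMap.polar_toQuadraticMap,
      LinearMap.smul_apply, smul_eq_mul]
    rw [hβ v u]
    field_simp
    ring
  refine ⟨Q, hQ, ?_⟩
  ext y
  refine ⟨fun h => hQ ▸ mem_isometryGroup_polarBilin h, fun h v => ?_⟩
  have h1 : β (y v) (y v) = β v v := h v v
  simp only [Q, LinearMap.BilinMap.toQuadraticMap_apply, LinearMap.smul_apply, h1]

variable [FiniteDimensional F V]

theorem polar_nondeg_kerEval (hQ : Q.polarBilin.Nondegenerate) {x : V ≃ₗ[F] V}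
    (hx : x ∈ quadIsometryGroup Q) (hs : Module.End.IsSemisimple (x : Module.End F V)) {c : F}
    (hc : c * c = 1) (u : V) (hu : u ∈ kerEval x (X - C c))
    (h : ∀ v ∈ kerEval x (X - C c), QuadraticMap.polar Q u v = 0) : u = 0 := by
  have hf : IsPhi (RingHom.id F) (X - C c) := Or.inl (X_sub_C_mem_phi1 hc)
  exact kerEval_nondeg (isEpsHermitian_polarBilin hQ) (mem_isometryGroup_polarBilin hx) hs
    hf.coeff_zero_ne (hf.self_dual fun _ => rfl) u hu h

/-- An eigenspace for `c` with `c² = 1` is non-degenerate, hence contains a non-singular vector, and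
the reflection in an eigenvector commutes with `x`. -/
theorem exists_reflection (hQ : Q.polarBilin.Nondegenerate) {x : V ≃ₗ[F] V}
    (hx : x ∈ quadIsometryGroup Q) (hs : Module.End.IsSemisimple (x : Module.End F V)) {c : F}
    (hc : c * c = 1) (hker : kerEval x (X - C c) ≠ ⊥) :
    ∃ (v : V) (hv : Q v ≠ 0), reflection Q hv ∈ centralizerIn (quadIsometryGroup Q) x := by
  obtain ⟨v, hvM, hv⟩ := exists_nonsingular hker (polar_nondeg_kerEval hQ hx hs hc)
  exact ⟨v, hv, mem_centralizerIn.2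
    ⟨reflection_mul_comm hx hv (mem_kerEval_X_sub_C.1 hvM) hc, reflection_mem hv⟩⟩

/-- If `x² v = v` with `v ≠ 0`, then either `x v = -v` or `x v + v` is a non-zero fixed vector. -/
theorem exists_kerEval_ne_bot {x : V ≃ₗ[F] V} (hu : ¬ IsUnit ((x : Module.End F V) ^ 2 - 1)) :
    ∃ c : F, c * c = 1 ∧ kerEval x (X - C c) ≠ ⊥ := by
  have h : LinearMap.ker ((x : Module.End F V) ^ 2 - 1) ≠ ⊥ := fun h => hu <| by
    have h1 := LinearMap.ker_eq_bot.1 h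
    exact (Module.End.isUnit_iff _).2 ⟨h1, LinearMap.injective_iff_surjective.1 h1⟩
  obtain ⟨v, hv, hv0⟩ := Submodule.exists_mem_ne_zero_of_ne_bot h
  have hv' : x (x v) = v := by
    rw [LinearMap.mem_ker, LinearMap.sub_apply, sq, sub_eq_zero] at hv
    exact hv
  by_cases h0 : x v + v = 0
  · refine ⟨-1, by ring, fun hb => hv0 ?_⟩
    rw [← Submodule.mem_bot F, ← hb, mem_kerEval_X_sub_C, neg_smul, one_smul]
    exact eq_neg_of_add_eq_zero_left h0
  · refine ⟨1, by ring, fun hb => h0 ?_⟩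
    rw [← Submodule.mem_bot F, ← hb, mem_kerEval_X_sub_C, one_smul, map_add, hv', add_comm]

theorem card_centralizerIn_quad_of_not_isUnit [Finite F] (h2 : (2 : F) ≠ 0)
    (hQ : Q.polarBilin.Nondegenerate)
    {x : V ≃ₗ[F] V} (hx : x ∈ quadIsometryGroup Q)
    (hs : Module.End.IsSemisimple (x : Module.End F V))
    (hu : ¬ IsUnit ((x : Module.End F V) ^ 2 - 1)) :
    Nat.card (centralizerIn (quadIsometryGroup Q) x) =
      2 * Nat.card (centralizerIn (quadIsometryGroup Q ⊓ specialGroup F V) x) := by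
  have : Finite V := Module.finite_of_finite F
  have : Finite (V ≃ₗ[F] V) := DFunLike.finite _
  obtain ⟨c, hc, hker⟩ := exists_kerEval_ne_bot hu
  obtain ⟨v, hv, hz⟩ := exists_reflection hQ hx hs hc hker
  rw [card_eq_two_mul_card_of_flip (centralizerIn (quadIsometryGroup Q) x)
    (P := fun y => y ∈ specialGroup F V) hz]
  · congr 1
    refine Nat.card_congr (Equiv.subtypeEquivRight fun y => ?_)
    exact ⟨fun h => ⟨h.1.1, h.1.2, h.2⟩, fun h => ⟨⟨h.1, h.2.1⟩, h.2.2⟩⟩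
  · intro y hy
    have h1 : (-1 : F) ≠ 1 := fun h => h2 (by linear_combination -h)
    rw [mem_specialGroup, mem_specialGroup]
    have h3 : ((reflection Q hv * y : V ≃ₗ[F] V) : Module.End F V) =
      (reflection Q hv : Module.End F V) * (y : Module.End F V) := rfl
    rw [h3, map_mul, det_reflection]
    rcases det_sq_of_isometry (isEpsHermitian_polarBilin hQ)
      (mem_isometryGroup_polarBilin hy.2) with h | h
    · rw [h, mul_one]
      simp [h1]
    · rw [h]
      simp [h1]

end Reflection

end ClassicalGroups

namespace ClassicalGroups

open Polynomial

/-! ### Prescribing the determinant of a polynomial in an irreducible operator -/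

section Determinants

variable {F W : Type*} [Field F] [AddCommGroup W] [Module F W]

theorem commute_aeval {a b : Module.End F W} (h : Commute b a) (q : F[X]) :
    Commute b (aeval a q) := by
  induction q using Polynomial.induction_on' with
  | add f g hf hg => rw [map_add]; exact hf.add_right hg
  | monomial n c =>
    rw [aeval_monomial]
    exact (Algebra.commute_algebraMap_right c _).mul_right (h.pow_right n)

variable [Finite F] [FiniteDimensional F W]

/-- A cyclic vector makes `W` one-dimensional over the field, so the determinant of multiplication
by a field element is its norm, and norms of finite fields are surjective. -/
theorem exists_det_aeval_eq_of_field_action {a : Module.End F W} {g : F[X]} (hg : g.Monic)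
    (hi : Irreducible g) (hker : aeval a g = 0) {w : W} (hw0 : w ≠ 0)
    (hspan : ∀ v, ∃ q : F[X], aeval a q w = v) (L : Type*) [Field L] [Finite L]
    (hL : Nat.card L = Nat.card F ^ g.natDegree) (c : F) :
    ∃ q : F[X], LinearMap.det (aeval a q) = c := by
  obtain ⟨e, φ, h⟩ := exists_field_action hg hi hker L hL
  let := fieldAlgebra e
  let := fieldModule φ
  have htower := fieldAction_tower e φ h
  have hrank : Module.finrank L W = 1 := by
    refine finrank_eq_one w hw0 fun v => ?_
    obtain ⟨q, rfl⟩ := hspan v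
    refine ⟨e (AdjoinRoot.mk g q), ?_⟩
    change φ (e (AdjoinRoot.mk g q)) w = _
    rw [h]
  have : Module.Finite F L := Module.Finite.of_finite
  have : Module.Finite L W := Module.Finite.of_restrictScalars_finite F _ W
  obtain ⟨l, hl⟩ := FiniteField.norm_surjective F L c
  obtain ⟨b, rfl⟩ := e.surjective l
  obtain ⟨q, rfl⟩ := AdjoinRoot.mk_surjective b
  refine ⟨q, ?_⟩
  let A : W →ₗ[L] W := e (AdjoinRoot.mk g q) • LinearMap.id
  have hA : A.restrictScalars F = aeval a q := by
    ext v
    rw [← h]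
    rfl
  rw [← hA, LinearMap.det_restrictScalars, LinearMap.det_smul, hrank, pow_one, LinearMap.det_id,
    mul_one, hl]

/-- The norm map is surjective on the field generated by an irreducible operator. -/
theorem exists_det_aeval_eq [Nontrivial W] {a : Module.End F W}
    (hmin : ∀ N : Submodule F W, (∀ v ∈ N, a v ∈ N) → N = ⊥ ∨ N = ⊤) (c : F) :
    ∃ q : F[X], LinearMap.det (aeval a q) = c := by
  obtain ⟨g, w, hg, hi, -, hw0, hw⟩ := exists_irreducible_kill (a := a) (T := ⊤)
    (fun _ _ => Submodule.mem_top) top_ne_bot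
  have hker : aeval a g = 0 := by
    rw [← LinearMap.ker_eq_top]
    refine (hmin _ fun v hv => ?_).resolve_left fun h => hw0 ?_
    · have h1 := LinearMap.congr_fun (commute_aeval (Commute.refl a) g).eq v
      rw [Module.End.mul_apply, LinearMap.mem_ker.1 hv, map_zero] at h1
      exact h1.symm
    · rw [← Submodule.mem_bot F, ← h]
      exact hw
  have : Fact (Irreducible g) := ⟨hi⟩
  have : Module.Finite F (AdjoinRoot g) := (AdjoinRoot.powerBasis' hg).finite
  have : Finite (AdjoinRoot g) := Module.finite_of_finite F
  refine exists_det_aeval_eq_of_field_action hg hi hker hw0 (fun v => ?_) (AdjoinRoot g)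
    (card_adjoinRoot hg) c
  let N : Submodule F W :=
    LinearMap.range (LinearMap.applyₗ w ∘ₗ (aeval a : F[X] →ₐ[F] Module.End F W).toLinearMap)
  have hN : N = ⊤ := by
    refine (hmin N ?_).resolve_left fun h0 => hw0 ?_
    · rintro _ ⟨q, rfl⟩
      exact ⟨X * q, by simp⟩
    · rw [← Submodule.mem_bot F, ← h0]
      exact ⟨1, by simp⟩
  have hv : v ∈ N := hN ▸ Submodule.mem_top
  exact hv

end Determinants

/-! ### Dual pairs of minimal invariant subspaces and operators on them -/

section NormalOperators

variable {F V : Type*} [Field F] [AddCommGroup V] [Module F V]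
  {σ : F →+* F} {ε : F} {β : V →ₗ[F] V →ₛₗ[σ] F} {x : V ≃ₗ[F] V}

theorem IsMinInvariant.disjoint_or_le {a : Module.End F V} {U : Submodule F V}
    (hU : IsMinInvariant a U) {N : Submodule F V} (hN : ∀ v ∈ N, a v ∈ N) :
    Disjoint U N ∨ U ≤ N := by
  rcases hU.min (U ⊓ N) inf_le_left fun v hv => ⟨hU.inv v hv.1, hN v hv.2⟩ with h | h
  · exact Or.inl (disjoint_iff.2 h)
  · exact Or.inr (inf_eq_left.1 h)

variable [FiniteDimensional F V]

theorem orth_invariant (hx : x ∈ isometryGroup β) {M : Submodule F V} (hM : ∀ v ∈ M, x v ∈ M)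
    {v : V} (hv : v ∈ orth β M) : x v ∈ orth β M := by
  intro u hu
  have h := hx (x⁻¹ u) v
  rw [← LinearEquiv.mul_apply, mul_inv_cancel] at h
  exact h.trans (hv _ (inv_mem_of_invariant hM hu))

theorem orth_orth_le [Finite F] (hβ : IsEpsHermitian ε β) (M : Submodule F V) : orth β (orth β M) ≤ M := by
  intro k hk
  by_contra hkM
  obtain ⟨l, hl, hkl⟩ := hβ.exists_orth_of_notMem hkM
  exact hkl (hβ.eq_zero_symm (hk l hl))

/-- A vector outside the sum would be separated from it by some `k` orthogonal to `U` and to the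
orthogonal complement of `U'`. Then `k` lies in `U'` and in the orthogonal complement of `U`, so `k
= 0`. -/
theorem isCompl_orth [Finite F] (hβ : IsEpsHermitian ε β) {U U' : Submodule F V}
    (h1 : Disjoint U (orth β U')) (h2 : Disjoint U' (orth β U)) : IsCompl U (orth β U') := by
  refine ⟨h1, codisjoint_iff.2 (Submodule.eq_top_iff'.2 fun v => ?_)⟩
  by_contra hv
  obtain ⟨k, hk, hvk⟩ := hβ.exists_orth_of_notMem hv
  have hk1 : k ∈ orth β U := fun u hu => hk u (Submodule.mem_sup_left hu)
  have hk2 : k ∈ U' := orth_orth_le hβ U' fun u hu => hk u (Submodule.mem_sup_right hu)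
  rw [Submodule.disjoint_def.1 h2 k hk2 hk1, map_zero] at hvk
  exact hvk rfl

/-- A pair of minimal invariant subspaces in duality, which are equal or totally isotropic. -/
structure IsDualPair (β : V →ₗ[F] V →ₛₗ[σ] F) (x : V ≃ₗ[F] V) (U U' : Submodule F V) : Prop where
  left : IsMinInvariant (x : Module.End F V) U
  right : IsMinInvariant (x : Module.End F V) U'
  disjoint_left : Disjoint U (orth β U')
  disjoint_right : Disjoint U' (orth β U)
  eq_or : U = U' ∨ (U ≤ orth β U ∧ U' ≤ orth β U')

/-- A minimal `U` in `T` is either non-degenerate, and paired with itself, or totally isotropic. In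
the latter case a minimal subspace of an invariant complement of the orthogonal space of `U` is
either non-degenerate or isotropic and dual to `U`. The last clause, applied to the image of `x² -
1`, keeps the pair away from the eigenvalues `1` and `-1`. -/
theorem exists_isDualPair (hβ : IsEpsHermitian ε β) (hx : x ∈ isometryGroup β)
    (hs : Module.End.IsSemisimple (x : Module.End F V)) {T : Submodule F V}
    (hT : ∀ v ∈ T, x v ∈ T) (hT0 : T ≠ ⊥) :
    ∃ U U', IsDualPair β x U U' ∧ ¬ U ≤ orth β T := by
  obtain ⟨U, hUT, hU⟩ := exists_isMinInvariant (a := (x : Module.End F V)) hT hT0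
  have horth : ∀ {M : Submodule F V}, (∀ v ∈ M, (x : Module.End F V) v ∈ M) →
    ∀ v ∈ orth β M, (x : Module.End F V) v ∈ orth β M := fun hM v hv => orth_invariant hx hM hv
  have hTU : orth β T ≤ orth β U := fun v hv u hu => hv u (hUT hu)
  rcases hU.disjoint_or_le (horth hU.inv) with hd | hle
  · refine ⟨U, U, ⟨hU, hU, hd, hd, Or.inl rfl⟩, fun h => hU.ne_bot ?_⟩
    exact disjoint_self.1 (hd.mono_right (h.trans hTU))
  · obtain ⟨Z, hZ, hZc⟩ := Module.End.isSemisimple_iff.1 hs (orth β U)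
      (fun v hv => horth hU.inv v hv)
    have hZ0 : Z ≠ ⊥ := by
      rintro rfl
      have htop : orth β U = ⊤ := by simpa using hZc.sup_eq_top
      refine hU.ne_bot ((Submodule.eq_bot_iff _).2 fun u hu => hβ.nondeg u fun v => ?_)
      have hv : v ∈ orth β U := htop ▸ Submodule.mem_top
      exact hv u hu
    obtain ⟨U', hUZ, hU'⟩ := exists_isMinInvariant (a := (x : Module.End F V)) hZ hZ0
    have hd' : Disjoint U' (orth β U) := hZc.symm.disjoint.mono_left hUZ
    have hn : ¬ U' ≤ orth β T := fun h => hU'.ne_bot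
      (disjoint_self.1 (hd'.mono_right (h.trans hTU)))
    rcases hU'.disjoint_or_le (horth hU'.inv) with hd | hle'
    · exact ⟨U', U', ⟨hU', hU', hd, hd, Or.inl rfl⟩, hn⟩
    · refine ⟨U', U, ⟨hU', hU, hd', ?_, Or.inr ⟨hle', hle⟩⟩, hn⟩
      refine (hU.disjoint_or_le (horth hU'.inv)).resolve_right fun h => hU'.ne_bot ?_
      have h1 : U' ≤ orth β U := fun v hv u hu => hβ.eq_zero_symm (h hu v hv)
      exact disjoint_self.1 (hd'.mono_right h1)

/-- The operator that is `q(x)` on the first member of a dual pair and `1` on the orthogonal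
complement of the second. -/
structure IsDualPairOperator (β : V →ₗ[F] V →ₛₗ[σ] F) (x : V ≃ₗ[F] V) (U U' : Submodule F V)
    (q : F[X]) (a a' : Module.End F V) : Prop where
  isAdj : IsAdj β a a'
  on_left : ∀ u ∈ U, a u = aeval (x : Module.End F V) q u
  on_orth : ∀ v ∈ orth β U', a v = v

variable {U U' : Submodule F V}

/-- Choose `q` so that `q(x)` has determinant `c` on `U`; the identity on the complement contributes
nothing. -/
theorem IsDualPair.exists_operator [Finite F] (h : IsDualPair β x U U') (hβ : IsEpsHermitian ε β)
    (c : F) :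
    ∃ q a a', IsDualPairOperator β x U U' q a a' ∧ LinearMap.det a = c := by
  have hinv := h.left.inv
  let b : Module.End F U := (x : Module.End F V).restrict hinv
  have : Nontrivial U := Submodule.nontrivial_iff_ne_bot.2 h.left.ne_bot
  have hb : ∀ q : F[X], ∀ u : U, (aeval b q u : V) = aeval (x : Module.End F V) q u := by
    intro q u
    induction q using Polynomial.induction_on' with
    | add f g hf hg => simp [hf, hg]
    | monomial n c =>
      simp only [aeval_monomial, Module.End.mul_apply, Module.algebraMap_end_apply,
        Submodule.coe_smul]
      congr 1
      induction n with
      | zero => rfl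
      | succ n ih =>
        rw [pow_succ', pow_succ', Module.End.mul_apply, Module.End.mul_apply, ← ih]
        rfl
  obtain ⟨q, hq⟩ := exists_det_aeval_eq (a := b) (fun N hN => by
    have h1 := h.left.min (N.map U.subtype) (Submodule.map_subtype_le U N) (by
      rintro _ ⟨v, hv, rfl⟩
      exact ⟨b v, hN v hv, rfl⟩)
    refine h1.imp (fun h2 => ?_) fun h2 => ?_
    · refine Submodule.map_injective_of_injective U.injective_subtype ?_
      rw [h2, Submodule.map_bot]
    · refine Submodule.map_injective_of_injective U.injective_subtype ?_
      rw [h2, Submodule.map_subtype_top]) c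
  have hc := isCompl_orth hβ h.disjoint_left h.disjoint_right
  let a : Module.End F V := LinearMap.ofIsCompl hc (U.subtype ∘ₗ aeval b q) (orth β U').subtype
  have ha1 : ∀ u ∈ U, a u = aeval (x : Module.End F V) q u := fun u hu => by
    have h1 := LinearMap.ofIsCompl_apply_left hc (φ := U.subtype ∘ₗ aeval b q)
      (ψ := (orth β U').subtype) ⟨u, hu⟩
    exact h1.trans (hb q ⟨u, hu⟩)
  have ha2 : ∀ v ∈ orth β U', a v = v := fun v hv =>
    LinearMap.ofIsCompl_apply_right hc (φ := U.subtype ∘ₗ aeval b q)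
      (ψ := (orth β U').subtype) ⟨v, hv⟩
  obtain ⟨a', ha'⟩ := hβ.exists_isAdj a
  refine ⟨q, a, a', ⟨ha', ha1, ha2⟩, ?_⟩
  have hU1 : ∀ v ∈ U, a v ∈ U := fun v hv => by
    rw [ha1 v hv]
    exact aeval_mem_of_invariant hinv q hv
  have hU2 : ∀ v ∈ orth β U', a v ∈ orth β U' := fun v hv => by rwa [ha2 v hv]
  rw [det_prod_of_isCompl hc a hU1 hU2]
  have e1 : a.restrict hU1 = aeval b q := by
    ext u
    rw [hb]
    exact ha1 u u.2
  have e2 : a.restrict hU2 = LinearMap.id := by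
    ext v
    exact ha2 v v.2
  rw [e1, e2, LinearMap.det_id, mul_one, hq]

namespace IsDualPairOperator

variable [Finite F]

variable {q : F[X]} {a a' : Module.End F V}

theorem adj_on_orth (ho : IsDualPairOperator β x U U' q a a') (h : IsDualPair β x U U')
    (hβ : IsEpsHermitian ε β) {v : V} (hv : v ∈ orth β U) : a' v = v := by
  refine sub_eq_zero.1 (hβ.nondeg_right _ fun u => ?_)
  have hc := isCompl_orth hβ h.disjoint_left h.disjoint_right
  obtain ⟨s, hs, t, ht, rfl⟩ := Submodule.mem_sup.1 (hc.sup_eq_top ▸ Submodule.mem_top : u ∈ _)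
  have h1 : a s ∈ U := by
    rw [ho.on_left s hs]
    exact aeval_mem_of_invariant h.left.inv q hs
  rw [map_sub, ← ho.isAdj, map_add, ho.on_orth t ht, map_add, map_add, LinearMap.add_apply,
    LinearMap.add_apply, hv _ h1, hv _ hs, sub_self]

theorem sub_mem (ho : IsDualPairOperator β x U U' q a a') (h : IsDualPair β x U U')
    (hβ : IsEpsHermitian ε β) (v : V) : a v - v ∈ U := by
  have hc := isCompl_orth hβ h.disjoint_left h.disjoint_right
  obtain ⟨s, hs, t, ht, rfl⟩ := Submodule.mem_sup.1 (hc.sup_eq_top ▸ Submodule.mem_top : v ∈ _)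
  rw [map_add, ho.on_orth t ht, ho.on_left s hs, add_sub_add_right_eq_sub]
  exact U.sub_mem (aeval_mem_of_invariant h.left.inv q hs) hs

theorem adj_sub_mem (ho : IsDualPairOperator β x U U' q a a')
    (hβ : IsEpsHermitian ε β) (v : V) : a' v - v ∈ U' := by
  refine orth_orth_le hβ U' fun u hu => ?_
  rw [map_sub, ← ho.isAdj, ho.on_orth u hu, sub_self]

theorem commute_self (ho : IsDualPairOperator β x U U' q a a') (h : IsDualPair β x U U')
    (hβ : IsEpsHermitian ε β) (hx : x ∈ isometryGroup β) : Commute a (x : Module.End F V) := by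
  have hc := isCompl_orth hβ h.disjoint_left h.disjoint_right
  have hq : ∀ v, aeval (x : Module.End F V) q (x v) = x (aeval (x : Module.End F V) q v) := by
    intro v
    exact (LinearMap.congr_fun (commute_aeval (Commute.refl (x : Module.End F V)) q).eq v).symm
  ext v
  obtain ⟨s, hs, t, ht, rfl⟩ := Submodule.mem_sup.1 (hc.sup_eq_top ▸ Submodule.mem_top : v ∈ _)
  have h1 := ho.on_left _ (h.left.inv s hs)
  have h2 := ho.on_orth _ (orth_invariant hx h.right.inv ht)
  simp only [Module.End.mul_apply, map_add, ho.on_left s hs, ho.on_orth t ht, LinearEquiv.coe_coe]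
  rw [h2, ← hq]
  congr 1

theorem adj_commute_self (ho : IsDualPairOperator β x U U' q a a') (h : IsDualPair β x U U')
    (hβ : IsEpsHermitian ε β) (hx : x ∈ isometryGroup β) : Commute a' (x : Module.End F V) := by
  have hax : ∀ v, a (x v) = x (a v) := LinearMap.congr_fun (ho.commute_self h hβ hx).eq
  ext v
  refine sub_eq_zero.1 (hβ.nondeg_right _ fun w => ?_)
  obtain ⟨u, rfl⟩ := x.surjective w
  simp only [Module.End.mul_apply, LinearEquiv.coe_coe]
  rw [map_sub, ← ho.isAdj, hax, hx, hx, ← ho.isAdj, sub_self]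

/-- If `U = U'`, then on `U` the operator `a` is a polynomial in `x`, with which `a'` commutes, and
both fix the complement. If both spaces are isotropic, `a` fixes the image of `a' - 1` and `a'`
fixes the image of `a - 1`, so both products equal `a + a' - 1`. -/
theorem commute_adj (ho : IsDualPairOperator β x U U' q a a') (h : IsDualPair β x U U')
    (hβ : IsEpsHermitian ε β) (hx : x ∈ isometryGroup β) : Commute a a' := by
  have hxa := ho.adj_commute_self h hβ hx
  ext v
  simp only [Module.End.mul_apply]
  rcases h.eq_or with rfl | ⟨hU, hU'⟩
  · have hc := isCompl_orth hβ h.disjoint_left h.disjoint_right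
    obtain ⟨s, hs, t, ht, rfl⟩ := Submodule.mem_sup.1 (hc.sup_eq_top ▸ Submodule.mem_top : v ∈ _)
    have h1 : a' s ∈ U := by
      have h2 := U.add_mem (ho.adj_sub_mem hβ s) hs
      rwa [sub_add_cancel] at h2
    have h3 : Commute (aeval (x : Module.End F V) q) a' := (commute_aeval hxa q).symm
    rw [map_add, map_add, map_add, map_add, ho.on_orth t ht, ho.adj_on_orth h hβ ht,
      ho.on_orth t ht, ho.on_left s hs, ho.on_left _ h1]
    congr 1
    exact LinearMap.congr_fun h3.eq s
  · have h1 := ho.on_orth _ (hU' (ho.adj_sub_mem hβ v))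
    have h2 := ho.adj_on_orth h hβ (hU (ho.sub_mem h hβ v))
    rw [map_sub, sub_eq_sub_iff_add_eq_add] at h1 h2
    rw [← sub_eq_zero] at h1 h2 ⊢
    have h3 : a (a' v) - a' (a v) = (a (a' v) + v - (a' v + a v)) - (a' (a v) + v - (a v + a' v)) := by
      abel
    rw [h3, h1, h2, sub_self]

end IsDualPairOperator

end NormalOperators

end ClassicalGroups

namespace ClassicalGroups

open Polynomial

/-! ### Determinants on unitary centralizers -/

section Unitary

variable {F V : Type*} [Field F] [AddCommGroup V] [Module F V] [FiniteDimensional F V]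
  {σ : F →+* F} {ε : F} {β : V →ₗ[F] V →ₛₗ[σ] F} {x : V ≃ₗ[F] V}

theorem IsDualPairOperator.exists_isometry [Finite F] {U U' : Submodule F V} {q : F[X]}
    {a a' : Module.End F V} (ho : IsDualPairOperator β x U U' q a a') (h : IsDualPair β x U U')
    (hβ : IsEpsHermitian ε β) (hx : x ∈ isometryGroup β) (ha : LinearMap.det a ≠ 0) :
    ∃ y : V ≃ₗ[F] V, y ∈ centralizerIn (isometryGroup β) x ∧ ∀ v, y (a' v) = a v :=
  exists_normal_isometry (a := LinearMap.equivOfDetNeZero a ha) hβ hx ho.isAdj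
    (ho.commute_adj h hβ hx) (ho.commute_self h hβ hx)

/-- For `y = a a'⁻¹` with `det a = c`, the adjoint has determinant `σ(c)`, whence `det y = c /
σ(c)`. -/
theorem exists_isometry_det_eq [Finite F] (hβ : IsEpsHermitian ε β) (hx : x ∈ isometryGroup β)
    (hs : Module.End.IsSemisimple (x : Module.End F V)) (hV : 0 < Module.finrank F V) {c : F}
    (hc : c ≠ 0) : ∃ y ∈ centralizerIn (isometryGroup β) x,
      LinearMap.det (y : Module.End F V) * σ c = c := by
  have : Nontrivial V := Module.finrank_pos_iff.1 hV
  obtain ⟨U, U', h, -⟩ := exists_isDualPair hβ hx hs (T := ⊤) (fun _ _ => Submodule.mem_top)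
    top_ne_bot
  obtain ⟨q, a, a', ho, hd⟩ := h.exists_operator hβ c
  obtain ⟨y, hy, hya⟩ := ho.exists_isometry h hβ hx (by rwa [hd])
  refine ⟨y, hy, ?_⟩
  have h1 : (y : Module.End F V) * a' = a := LinearMap.ext hya
  have h2 := congrArg LinearMap.det h1
  rw [map_mul, hd] at h2
  rw [← hd, hβ.det_eq_of_isAdj ho.isAdj, hβ.invol, h2, ← hd, hβ.det_eq_of_isAdj ho.isAdj]

theorem det_mul_map_det (hβ : IsEpsHermitian ε β) {y : V ≃ₗ[F] V} (hy : y ∈ isometryGroup β) :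
    LinearMap.det (y : Module.End F V) * σ (LinearMap.det (y : Module.End F V)) = 1 := by
  have h1 := hβ.det_eq_of_isAdj (isAdj_of_isometry hy)
  have h2 : LinearMap.det (y : Module.End F V) *
      LinearMap.det ((y⁻¹ : V ≃ₗ[F] V) : Module.End F V) = 1 := by
    rw [← map_mul, ← LinearMap.det_id (A := F) (M := V)]
    congr 1
    ext v
    exact y.apply_symm_apply v
  have h3 := congrArg σ h1
  rw [hβ.invol] at h3
  rw [h3, h2]

/-- The determinants lie in the `(r + 1)`-torsion of the cyclic group `Fˣ` of order `(r - 1)(r + 1)`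
and contain all `(r - 1)`-th powers. Both subgroups have order `r + 1`. -/
theorem card_centralizerIn_unitary [Finite F] {r : ℕ} (hσ : ∀ a, σ a = a ^ r) (hF : Nat.card F = r ^ 2)
    (hβ : IsEpsHermitian ε β) (hx : x ∈ isometryGroup β)
    (hs : Module.End.IsSemisimple (x : Module.End F V)) (hV : 0 < Module.finrank F V) :
    Nat.card (centralizerIn (isometryGroup β) x) =
      (r + 1) * Nat.card (centralizerIn (isometryGroup β ⊓ specialGroup F V) x) := by
  have : Finite V := Module.finite_of_finite F
  have : Finite (V ≃ₗ[F] V) := DFunLike.finite _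
  have hr : 1 < r := by
    by_contra! h
    have h1 : 1 < Nat.card F := Finite.one_lt_card
    rw [hF] at h1
    interval_cases r <;> simp at h1
  have hcard : Nat.card Fˣ = (r - 1) * (r + 1) := by
    rw [Nat.card_units, hF]
    zify [hr.le, Nat.one_le_pow 2 r (by omega)]
    ring
  let D : centralizerIn (isometryGroup β) x →* Fˣ :=
    (LinearEquiv.det : (V ≃ₗ[F] V) →* Fˣ).comp (centralizerIn (isometryGroup β) x).subtype
  have hD : ∀ y, (D y : F) = LinearMap.det (y.1 : Module.End F V) := fun y =>
    LinearEquiv.coe_det _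
  have h1 : D.range ≤ (powMonoidHom (r + 1) : Fˣ →* Fˣ).ker := by
    rintro _ ⟨y, rfl⟩
    rw [MonoidHom.mem_ker, powMonoidHom_apply, Units.ext_iff, Units.val_pow_eq_pow_val, hD,
      pow_succ', ← hσ, det_mul_map_det hβ y.2.2, Units.val_one]
  have h2 : (powMonoidHom (r - 1) : Fˣ →* Fˣ).range ≤ D.range := by
    rintro _ ⟨c, rfl⟩
    -- The inverse is used because `c⁻¹ / σ(c⁻¹) = c^(r - 1)`.
    obtain ⟨y, hy, hyc⟩ := exists_isometry_det_eq hβ hx hs hV (Units.ne_zero c⁻¹)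
    refine ⟨⟨y, hy⟩, ?_⟩
    rw [powMonoidHom_apply, Units.ext_iff, hD]
    rw [hσ] at hyc
    have hc0 := Units.ne_zero c
    obtain ⟨s, rfl⟩ : ∃ s, r = s + 1 := ⟨r - 1, by omega⟩
    rw [Units.val_inv_eq_inv_val, inv_pow, mul_inv_eq_iff_eq_mul₀ (pow_ne_zero _ hc0)] at hyc
    rw [hyc, Nat.add_sub_cancel, Units.val_pow_eq_pow_val, pow_succ', inv_mul_cancel_left₀ hc0]
  have h3 : Nat.card D.range = r + 1 := by
    apply le_antisymm
    · have h4 := Nat.card_le_card_of_injective _ (Subgroup.inclusion_injective h1)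
      rwa [IsCyclic.card_powMonoidHom_ker, hcard,
        Nat.gcd_eq_right (Dvd.intro_left _ rfl)] at h4
    · have h4 := Nat.card_le_card_of_injective _ (Subgroup.inclusion_injective h2)
      rwa [IsCyclic.card_powMonoidHom_range, hcard,
        Nat.gcd_eq_right (Dvd.intro _ rfl), Nat.mul_div_cancel_left _ (by omega)] at h4
  have h4 : Nat.card D.ker = Nat.card (centralizerIn (isometryGroup β ⊓ specialGroup F V) x) :=
    Nat.card_congr
      { toFun := fun y => ⟨y.1.1, y.1.2.1, y.1.2.2, y.2⟩
        invFun := fun y => ⟨⟨y.1, y.2.1, y.2.2.1⟩, y.2.2.2⟩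
        left_inv := fun _ => rfl
        right_inv := fun _ => rfl }
  rw [Subgroup.card_eq_card_quotient_mul_card_subgroup D.ker, h4,
    Nat.card_congr (QuotientGroup.quotientKerEquivRange D).toEquiv, h3]

end Unitary

/-! ### Orders of centralizers in the special groups -/

section SpecialCounts

variable {F V : Type*} [Field F] [AddCommGroup V] [Module F V] [FiniteDimensional F V]
  {σ : F →+* F} {p k : ℕ} [Fact p.Prime] {x : V ≃ₗ[F] V}

theorem two_ne_zero_of_odd_card [Finite F] (ho : Odd (Nat.card F)) : (2 : F) ≠ 0 := by
  let := Fintype.ofFinite F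
  refine Ring.two_ne_zero fun h => ?_
  have h1 := FiniteField.even_card_of_char_two h
  rw [← Nat.card_eq_fintype_card] at h1
  exact Nat.not_even_iff_odd.2 ho (Nat.even_iff.2 h1)

theorem two_eq_zero_of_even_card [Finite F] (ho : Even (Nat.card F)) : (2 : F) = 0 := by
  let := Fintype.ofFinite F
  have h1 := FiniteField.even_card_iff_char_two (F := F)
  rw [← Nat.card_eq_fintype_card] at h1
  have := (ringChar.eq_iff (R := F) (p := 2)).1 (h1.2 (Nat.even_iff.1 ho))
  exact CharTwo.two_eq_zero

theorem IsClassicalForm.special_counts [Finite F] (hσ : ∀ a, σ a = a ^ (p ^ k))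
    (hxp : (orderOf x).Coprime p) {T : FormType} {β : V →ₗ[F] V →ₛₗ[σ] F}
    (h : IsClassicalForm (p ^ k) T β) (hx : x ∈ isometryGroup β) :
    (T = .unitary → 0 < Module.finrank F V →
      Nat.card (centralizerIn (isometryGroup β) x) =
        (p ^ k + 1) * Nat.card (centralizerIn (isometryGroup β ⊓ specialGroup F V) x)) ∧
    (T = .orthogonal → ¬ IsUnit ((x : Module.End F V) ^ 2 - 1) →
      Nat.card (centralizerIn (isometryGroup β) x) =
        2 * Nat.card (centralizerIn (isometryGroup β ⊓ specialGroup F V) x)) ∧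
    (T = .symplectic ∨ T = .orthogonal ∧ IsUnit ((x : Module.End F V) ^ 2 - 1) →
      Nat.card (centralizerIn (isometryGroup β ⊓ specialGroup F V) x) =
        Nat.card (centralizerIn (isometryGroup β) x)) := by
  obtain ⟨ε, hβ⟩ := h.exists_isEpsHermitian hσ
  cases T with
  | symplectic =>
    obtain rfl := eq_id_of_card hσ h.2.1
    refine ⟨(fun h => by cases h), (fun h => by cases h), fun _ => ?_⟩
    refine card_centralizerIn_special_of_det_eq_one fun y hy => ?_
    exact det_eq_one_of_alternating β h.2.2 hβ.nondeg y hy.2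
  | orthogonal =>
    have hF := h.2.1
    obtain rfl := eq_id_of_card hσ hF
    have hβ' : IsEpsHermitian (σ := RingHom.id F) 1 β :=
      ⟨fun _ => rfl, one_mul _, fun u v => by rw [one_mul]; exact h.2.2.2 v u, hβ.nondeg⟩
    refine ⟨(fun h => by cases h), fun _ hu => ?_, fun hu => ?_⟩
    · have h2 := two_ne_zero_of_odd_card (hF ▸ h.2.2.1)
      obtain ⟨Q, hQ, hG⟩ := exists_quadraticForm_of_symm h2 h.2.2.2
      rw [← hG] at hx ⊢
      exact card_centralizerIn_quad_of_not_isUnit h2 (hQ ▸ h.1) hx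
        (isSemisimple_of_orderOf_coprime hF hxp) hu
    · rcases hu with hu | hu
      · cases hu
      · exact card_centralizerIn_special_of_det_eq_one fun y hy =>
          det_eq_one_of_isUnit_sq_sub_one hβ' hx hu.2 hy
  | unitary =>
    refine ⟨fun _ hV => ?_, (fun h => by cases h), fun h => ?_⟩
    · have hF : Nat.card F = p ^ (k * 2) := by rw [h.2.1, pow_mul]
      exact card_centralizerIn_unitary hσ h.2.1 hβ hx (isSemisimple_of_orderOf_coprime hF hxp) hV
    · rcases h with h | h
      · cases h
      · cases h.1

theorem quad_special_count_of_isUnit {Q : QuadraticForm F V} (hQ : Q.polarBilin.Nondegenerate)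
    (hx : x ∈ quadIsometryGroup Q)
    (h : (2 : F) = 0 ∨ IsUnit ((x : Module.End F V) ^ 2 - 1)) :
    Nat.card (centralizerIn (quadIsometryGroup Q ⊓ specialGroup F V) x) =
      Nat.card (centralizerIn (quadIsometryGroup Q) x) := by
  have hβ := isEpsHermitian_polarBilin hQ
  refine card_centralizerIn_special_of_det_eq_one fun y hy => ?_
  have hy' := mem_isometryGroup_polarBilin hy.2
  rcases h with h | h
  · rcases det_sq_of_isometry hβ hy' with h1 | h1
    · exact h1
    · rw [h1]
      linear_combination -h
  · exact det_eq_one_of_isUnit_sq_sub_one hβ (mem_isometryGroup_polarBilin hx) h ⟨hy.1, hy'⟩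

end SpecialCounts

end ClassicalGroups

namespace ClassicalGroups

open Polynomial

/-! ### The Wall form and its behaviour under reflections -/

section WallForm

variable {F V : Type*} [Field F] [AddCommGroup V] [Module F V] {Q : QuadraticForm F V}
  {y : V ≃ₗ[F] V}

theorem sub_mem_imOneSub (y : V ≃ₗ[F] V) (w : V) : w - y w ∈ imOneSub y := ⟨w, rfl⟩

theorem polar_eq_zero_of_fixed (hy : y ∈ quadIsometryGroup Q) {k u : V} (hk : y k = k)
    (hu : u ∈ imOneSub y) : QuadraticMap.polar Q k u = 0 := by
  obtain ⟨w, rfl⟩ := hu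
  change QuadraticMap.polar Q k (w - y w) = 0
  rw [QuadraticMap.polar_sub_right, sub_eq_zero, ← polar_of_isometry hy k w, hk]

/-- The Wall form as a bilinear map. -/
noncomputable def wallBilin (Q : QuadraticForm F V) (hy : y ∈ quadIsometryGroup Q) :
    imOneSub y →ₗ[F] imOneSub y →ₗ[F] F :=
  LinearMap.mk₂ F (wallForm Q y)
    (fun u u' v => by
      obtain ⟨w, hw⟩ := exists_of_mem_imOneSub u
      obtain ⟨w', hw'⟩ := exists_of_mem_imOneSub u'
      rw [wallForm_eq Q y hy u v w hw, wallForm_eq Q y hy u' v w' hw',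
        wallForm_eq Q y hy (u + u') v (w + w') (by
          rw [map_add, Submodule.coe_add, ← hw, ← hw']; abel), QuadraticMap.polar_add_left])
    (fun c u v => by
      obtain ⟨w, hw⟩ := exists_of_mem_imOneSub u
      rw [wallForm_eq Q y hy u v w hw, wallForm_eq Q y hy (c • u) v (c • w) (by
          rw [map_smul, Submodule.coe_smul, ← hw, smul_sub]), QuadraticMap.polar_smul_left])
    (fun u v v' => by
      obtain ⟨w, hw⟩ := exists_of_mem_imOneSub u
      rw [wallForm_eq Q y hy u _ w hw, wallForm_eq Q y hy u _ w hw, wallForm_eq Q y hy u _ w hw,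
        Submodule.coe_add, QuadraticMap.polar_add_right])
    (fun c u v => by
      obtain ⟨w, hw⟩ := exists_of_mem_imOneSub u
      rw [wallForm_eq Q y hy u _ w hw, wallForm_eq Q y hy u _ w hw,
        Submodule.coe_smul, QuadraticMap.polar_smul_right])

theorem wallBilin_apply (hy : y ∈ quadIsometryGroup Q) {u : imOneSub y} (v : imOneSub y) {w : V}
    (hw : w - y w = u) : wallBilin Q hy u v = QuadraticMap.polar Q w v :=
  wallForm_eq Q y hy u v w hw

/-- With `polar_eq_zero_of_fixed` this identifies the orthogonal complement of `V_y` with the fixed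
space of `y`, which makes the Wall form non-degenerate. -/
theorem fixed_of_polar_eq_zero (hQ : Q.polarBilin.Nondegenerate) (hy : y ∈ quadIsometryGroup Q)
    {k : V} (hk : ∀ u ∈ imOneSub y, QuadraticMap.polar Q k u = 0) : y k = k := by
  rw [eq_comm, ← sub_eq_zero]
  refine hQ.1 _ fun w => ?_
  obtain ⟨u, rfl⟩ := y.surjective w
  have h1 : QuadraticMap.polar Q k (u - y u) = 0 := hk _ (sub_mem_imOneSub y u)
  rw [QuadraticMap.polar_sub_right] at h1
  rw [QuadraticMap.polarBilin_apply_apply, QuadraticMap.polar_sub_left, polar_of_isometry hy]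
  linear_combination -h1

theorem wallBilin_nondeg (hQ : Q.polarBilin.Nondegenerate) (hy : y ∈ quadIsometryGroup Q)
    (u : imOneSub y) (hu : ∀ v, wallBilin Q hy u v = 0) : u = 0 := by
  obtain ⟨w, hw⟩ := exists_of_mem_imOneSub u
  have h1 : y w = w := fixed_of_polar_eq_zero hQ hy fun v hv => by
    rw [← wallBilin_apply hy ⟨v, hv⟩ hw]
    exact hu _
  rw [h1, sub_self] at hw
  exact Subtype.ext hw.symm

/-- `d` is a discriminant of the Wall form of `y`. -/
def HasWallDisc (Q : QuadraticForm F V) (y : V ≃ₗ[F] V) (d : F) : Prop :=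
  ∃ (n : ℕ) (b : Module.Basis (Fin n) F (imOneSub y)) (w : Fin n → V),
    (∀ i, w i - y (w i) = b i) ∧
    d = (Matrix.of fun i j => QuadraticMap.polar Q (w i) (b j : V)).det

theorem hasWallDisc_of_basis {ι : Type*} [Fintype ι] [DecidableEq ι]
    (b : Module.Basis ι F (imOneSub y)) (w : ι → V) (hw : ∀ i, w i - y (w i) = b i) :
    HasWallDisc Q y (Matrix.of fun i j => QuadraticMap.polar Q (w i) (b j : V)).det := by
  let e := Fintype.equivFin ι
  refine ⟨_, b.reindex e, fun i => w (e.symm i), fun i => ?_, ?_⟩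
  · rw [hw, Module.Basis.reindex_apply]
  · rw [← Matrix.det_submatrix_equiv_self e.symm]
    congr 1
    ext i j
    simp

theorem exists_hasWallDisc [FiniteDimensional F V] (Q : QuadraticForm F V) (y : V ≃ₗ[F] V) :
    ∃ d, HasWallDisc Q y d :=
  ⟨_, hasWallDisc_of_basis (Module.finBasis F (imOneSub y)) _
    fun i => (exists_of_mem_imOneSub (Module.finBasis F (imOneSub y) i)).choose_spec⟩

theorem HasWallDisc.eq_det_wallBilin {n : ℕ} (hy : y ∈ quadIsometryGroup Q)
    {b : Module.Basis (Fin n) F (imOneSub y)} {w : Fin n → V} (hw : ∀ i, w i - y (w i) = b i) :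
    (Matrix.of fun i j => QuadraticMap.polar Q (w i) (b j : V)) =
      Matrix.of fun i j => wallBilin Q hy (b i) (b j) := by
  ext i j
  exact (wallBilin_apply hy (b j) (hw i)).symm

theorem det_gram_ne_zero_of_nondeg {ι : Type*} [Fintype ι] [DecidableEq ι]
    {B : V →ₗ[F] V →ₗ[F] F} (hB : ∀ u, (∀ v, B u v = 0) → u = 0) (b : Module.Basis ι F V) :
    (Matrix.of fun i j => B (b i) (b j)).det ≠ 0 := by
  intro h0
  obtain ⟨v, hv, hv0⟩ := Matrix.exists_vecMul_eq_zero_iff.2 h0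
  refine hv ?_
  have h1 : ∑ i, v i • b i = 0 := by
    refine hB _ fun u => ?_
    rw [← LinearMap.zero_apply (σ₁₂ := RingHom.id F) (M₂ := F) u]
    refine LinearMap.congr_fun (b.ext fun j => ?_) u
    have h2 := congrFun hv0 j
    simpa [Matrix.vecMul, dotProduct] using h2
  funext i
  exact Fintype.linearIndependent_iff.1 b.linearIndependent v h1 i

theorem HasWallDisc.ne_zero (hQ : Q.polarBilin.Nondegenerate) (hy : y ∈ quadIsometryGroup Q) {d : F}
    (hd : HasWallDisc Q y d) : d ≠ 0 := by
  obtain ⟨n, b, w, hw, rfl⟩ := hd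
  rw [HasWallDisc.eq_det_wallBilin hy hw]
  exact det_gram_ne_zero_of_nondeg (wallBilin_nondeg hQ hy) b

/-- Any basis of `V_y` with any preimages may be used, since the discriminant changes only by a
non-zero square. -/
theorem spinorNorm_eq_zero_iff [FiniteDimensional F V] (h2 : (2 : F) ≠ 0)
    (hy : y ∈ quadIsometryGroup Q) {d : F} (hd : HasWallDisc Q y d) :
    spinorNorm Q y = 0 ↔ IsSquare d := by
  obtain ⟨n, b, w, hw, rfl⟩ := hd
  rw [HasWallDisc.eq_det_wallBilin hy hw]
  obtain ⟨e, he, h1⟩ := gram_det_basis_change (wallBilin Q hy) b (Module.finBasis F (imOneSub y))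
  have h3 : IsSquare (Matrix.of fun i j => wallForm Q y (Module.finBasis F (imOneSub y) i)
      (Module.finBasis F (imOneSub y) j)).det ↔
      IsSquare (Matrix.of fun i j => wallBilin Q hy (b i) (b j)).det := by
    change IsSquare (Matrix.of fun i j => wallBilin Q hy (Module.finBasis F (imOneSub y) i)
      (Module.finBasis F (imOneSub y) j)).det ↔ _
    rw [h1]
    refine ⟨fun ⟨r, hr⟩ => ⟨e⁻¹ * r, ?_⟩, fun ⟨r, hr⟩ => ⟨e * r, ?_⟩⟩
    · field_simp
      linear_combination hr
    · linear_combination e ^ 2 * hr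
  rw [← h3]
  unfold spinorNorm
  rw [if_neg h2]
  split_ifs with h <;> simp [h]

/-! ### Products with reflections -/

/-- A `y`-fixed vector `k` not orthogonal to `v` shows that the new space is `V_y` plus the line of
`v`. As `k` is orthogonal to `V_y`, the new Gram matrix is block triangular with last diagonal entry
`Q(v)`. -/
theorem HasWallDisc.reflection_mul (hQ : Q.polarBilin.Nondegenerate)
    [Finite F] [FiniteDimensional F V]
    (hy : y ∈ quadIsometryGroup Q) {v : V} (hv : Q v ≠ 0) (hvy : v ∉ imOneSub y) {d : F}
    (hd : HasWallDisc Q y d) : HasWallDisc Q (reflection Q hv * y) (d * Q v) ∧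
      Module.finrank F (imOneSub (reflection Q hv * y)) = Module.finrank F (imOneSub y) + 1 := by
  obtain ⟨n, b, w, hw, rfl⟩ := hd
  obtain ⟨k₀, hk₀, hk₀v⟩ := (isEpsHermitian_polarBilin hQ).exists_orth_of_notMem hvy
  obtain ⟨k, hk, hkv⟩ : ∃ k, y k = k ∧ QuadraticMap.polar Q k v = Q v := by
    have h1 : y k₀ = k₀ := fixed_of_polar_eq_zero hQ hy fun u hu => by
      rw [QuadraticMap.polar_comm]
      exact hk₀ u hu
    -- This scaling makes `k` a preimage of exactly `v` under `1 - r y`, where `r` is the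
    -- reflection.
    refine ⟨(Q v / QuadraticMap.polar Q v k₀) • k₀, by rw [map_smul, h1], ?_⟩
    rw [QuadraticMap.polar_smul_left, QuadraticMap.polar_comm Q k₀, smul_eq_mul]
    exact div_mul_cancel₀ _ hk₀v
  have hz : ∀ t, t - (reflection Q hv * y) t =
      (t - y t) + ((Q v)⁻¹ * QuadraticMap.polar Q (y t) v) • v := by
    intro t
    rw [LinearEquiv.mul_apply, reflection_apply]
    abel
  have hzk : k - (reflection Q hv * y) k = v := by
    rw [hz, hk, sub_self, zero_add, hkv, inv_mul_cancel₀ hv, one_smul]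
  -- Each old preimage is corrected by a multiple of `k`, so that it remains a preimage of the same
  -- basis vector `b i` for the product with the reflection.
  let w' : Fin n ⊕ Unit → V :=
    Sum.elim (fun i => w i - ((Q v)⁻¹ * QuadraticMap.polar Q (y (w i)) v) • k) fun _ => k
  let u' : Fin n ⊕ Unit → V := Sum.elim (fun i => (b i : V)) fun _ => v
  have hwu : ∀ i, w' i - (reflection Q hv * y) (w' i) = u' i := by
    rintro (i | i)
    · simp only [w', u', Sum.elim_inl]
      rw [map_sub, map_smul, sub_sub_sub_comm, ← smul_sub, hzk, hz, hw]
      abel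
    · exact hzk
  have hli : LinearIndependent F u' := by
    have hv0 : v ≠ 0 := fun h => hv (by rw [h, QuadraticMap.map_zero])
    have hb : LinearIndependent F fun i => (b i : V) :=
      b.linearIndependent.map' (imOneSub y).subtype (Submodule.ker_subtype _)
    have hu : LinearIndependent F fun _ : Unit => v := LinearIndependent.of_subsingleton () hv0
    refine hb.sum_type hu ?_
    have h1 : Submodule.span F (Set.range fun i => (b i : V)) ≤ imOneSub y :=
      Submodule.span_le.2 (by rintro _ ⟨i, rfl⟩; exact (b i).2)
    have h3 : Set.range (fun _ : Unit => v) = {v} := Set.range_const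
    refine Disjoint.mono_left h1 ?_
    rwa [h3, Submodule.disjoint_span_singleton' hv0]
  have hspan : Submodule.span F (Set.range u') = imOneSub (reflection Q hv * y) := by
    apply le_antisymm
    · rw [Submodule.span_le]
      rintro _ ⟨i, rfl⟩
      rw [← hwu]
      exact sub_mem_imOneSub _ _
    · rintro _ ⟨t, rfl⟩
      change t - (reflection Q hv * y) t ∈ _
      rw [hz]
      refine add_mem ?_ (Submodule.smul_mem _ _ (Submodule.subset_span ⟨Sum.inr (), rfl⟩))
      have h1 := congrArg Subtype.val (b.sum_repr ⟨_, sub_mem_imOneSub y t⟩)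
      change _ = t - y t at h1
      rw [← h1, Submodule.coe_sum]
      exact sum_mem fun i _ => Submodule.smul_mem _ _ (Submodule.subset_span ⟨Sum.inl i, rfl⟩)
  let b' : Module.Basis (Fin n ⊕ Unit) F (imOneSub (reflection Q hv * y)) :=
    (Module.Basis.span hli).map (LinearEquiv.ofEq _ _ hspan)
  have hb' : ∀ i, (b' i : V) = u' i := fun i => by
    simp [b', Module.Basis.span_apply]
  constructor
  · have h1 := hasWallDisc_of_basis (Q := Q) b' w' fun i => by rw [hb', hwu]
    have hkb : ∀ j, QuadraticMap.polar Q k (b j : V) = 0 := fun j =>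
      polar_eq_zero_of_fixed hy hk (b j).2
    have h3 : (Matrix.of fun i j => QuadraticMap.polar Q (w' i) (b' j : V)) =
        Matrix.fromBlocks (Matrix.of fun i j => QuadraticMap.polar Q (w i) (b j : V))
          (Matrix.of fun i _ => QuadraticMap.polar Q (w' (Sum.inl i)) v) 0
          (Matrix.of fun _ _ : Unit => Q v) := by
      ext (i | i) (j | j)
      · simp [hb', w', u', QuadraticMap.polar_sub_left, QuadraticMap.polar_smul_left, hkb]
      · simp [hb', u']
      · simp [hb', w', u', hkb]
      · simp [hb', w', u', hkv]
    rw [h3, Matrix.det_fromBlocks_zero₂₁, Matrix.det_unique (n := Unit)] at h1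
    exact h1
  · rw [Module.finrank_eq_card_basis b', Module.finrank_eq_card_basis b, Fintype.card_sum,
      Fintype.card_unit]

/-- If `v = u - y u`, then the polar value of `u` and `v` is `Q(v)`, so `u` is fixed by the product
and is not orthogonal to `v`. This reduces the case `v ∈ V_y` to the previous lemma with the two
isometries interchanged. -/
theorem notMem_imOneSub_reflection_mul (hy : y ∈ quadIsometryGroup Q) {v : V} (hv : Q v ≠ 0)
    (hvy : v ∈ imOneSub y) : v ∉ imOneSub (reflection Q hv * y) := by
  obtain ⟨u, hu⟩ := exists_of_mem_imOneSub ⟨v, hvy⟩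
  have hu' : u - y u = v := hu
  have hyu : y u = u - v := by rw [← hu']; abel
  have h1 : QuadraticMap.polar Q u v = Q v := by
    have h : Q (y u) = Q u := hy u
    rw [hyu, map_sub_eq] at h
    linear_combination -h
  have h2 : (reflection Q hv * y) u = u := by
    rw [LinearEquiv.mul_apply, hyu, map_sub, reflection_self, reflection_apply, h1,
      inv_mul_cancel₀ hv, one_smul]
    abel
  intro h
  have h3 := polar_eq_zero_of_fixed
    ((quadIsometryGroup Q).mul_mem (reflection_mem hv) hy) h2 h
  exact hv (h1.symm.trans h3)

end WallForm

end ClassicalGroups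

namespace ClassicalGroups

open Polynomial

/-! ### Parity of `dim V_y` in characteristic two -/

section CharacteristicTwo

/-- An isometry is conjugate to its inverse transpose, and in characteristic two its determinant is
one, so its characteristic polynomial is self-reciprocal. In odd size the coefficients of index `i`
and `n - i` would cancel in pairs at `1`, making `1 - A` singular. -/
theorem even_card_of_isometry_matrix {F ι : Type*} [Field F] [Fintype ι] [DecidableEq ι]
    (h2 : (2 : F) = 0) {G A : Matrix ι ι F} (hG : G.det ≠ 0) (hA : A.transpose * G * A = G)
    (h1 : (1 - A).det ≠ 0) : Even (Fintype.card ι) := by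
  by_contra hodd
  have hn1 : (-1 : F) = 1 := by linear_combination -h2
  have hdet : A.det = 1 := by
    have h := congrArg Matrix.det hA
    rw [Matrix.det_mul, Matrix.det_mul, Matrix.det_transpose, mul_comm A.det, mul_assoc] at h
    have h3 : A.det * A.det = 1 := mul_left_cancel₀ hG (by rw [h, mul_one])
    rcases mul_self_eq_one_iff.1 h3 with h | h
    · exact h
    · rw [h, hn1]
  have hGu : IsUnit G.det := hG.isUnit
  have hAu : IsUnit A.det := by rw [hdet]; exact isUnit_one
  have hinv : A⁻¹ = G⁻¹ * A.transpose * G := by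
    refine Matrix.inv_eq_left_inv ?_
    rw [mul_assoc, mul_assoc, ← mul_assoc A.transpose, hA, Matrix.nonsing_inv_mul _ hGu]
  have hchar : A⁻¹.charpoly = A.charpoly := by
    rw [hinv, Matrix.charpoly_mul_comm, ← mul_assoc, Matrix.mul_nonsing_inv _ hGu, one_mul,
      Matrix.charpoly_transpose]
  have hrev : A.charpoly.reverse = A.charpoly := by
    have h := Matrix.charpoly_inv A ((Matrix.isUnit_iff_isUnit_det A).2 hAu)
    have h3 : (-1 : F[X]) = 1 := by rw [← C_1, ← C_neg, hn1]
    rw [hchar, hdet, Ring.inverse_one, C_1, mul_one, h3, one_pow, one_mul,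
      ← Matrix.reverse_charpoly] at h
    exact h.symm
  have hdeg : A.charpoly.natDegree = Fintype.card ι := Matrix.charpoly_natDegree_eq_dim A
  have hcoeff : ∀ i ≤ Fintype.card ι,
      A.charpoly.coeff (Fintype.card ι - i) = A.charpoly.coeff i := by
    intro i hi
    conv_rhs => rw [← hrev]
    rw [coeff_reverse, revAt_le (by rwa [hdeg]), hdeg]
  have heval : A.charpoly.eval 1 = 0 := by
    rw [eval_eq_sum_range, hdeg]
    simp only [one_pow, mul_one]
    refine Finset.sum_involution (fun i _ => Fintype.card ι - i) (fun i hi => ?_) (fun i hi _ => ?_)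
      (fun i hi => ?_) fun i hi => ?_
    · rw [hcoeff i (Finset.mem_range_succ_iff.1 hi)]
      linear_combination A.charpoly.coeff i * h2
    · intro h
      have hi' := Finset.mem_range_succ_iff.1 hi
      -- A fixed point `i = n - i` of the pairing would make the size `n` even.
      exact hodd ⟨i, by omega⟩
    · exact Finset.mem_range_succ_iff.2 (Nat.sub_le _ _)
    · exact Nat.sub_sub_self (Finset.mem_range_succ_iff.1 hi)
  rw [Matrix.eval_charpoly, map_one] at heval
  exact h1 heval

variable {F V : Type*} [Field F] [AddCommGroup V] [Module F V]
  {Q : QuadraticForm F V} {x y : V ≃ₗ[F] V}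


theorem map_imOneSub_restrict (y : V ≃ₗ[F] V) {M : Submodule F V} {z : M ≃ₗ[F] M}
    (hz : ∀ v : M, (z v : V) = y v) :
    (imOneSub z).map M.subtype = M.map ((1 : Module.End F V) - (y : Module.End F V)) := by
  ext v
  constructor
  · rintro ⟨_, ⟨w, rfl⟩, rfl⟩
    refine ⟨w, w.2, ?_⟩
    change (w : V) - y w = (w : V) - z w
    rw [hz]
  · rintro ⟨w, hw, rfl⟩
    refine ⟨_, ⟨⟨w, hw⟩, rfl⟩, ?_⟩
    change w - (z ⟨w, hw⟩ : V) = w - y w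
    rw [hz]

variable [FiniteDimensional F V]

theorem even_finrank_of_isometry {U : Type*} [AddCommGroup U] [Module F U] [FiniteDimensional F U]
    (h2 : (2 : F) = 0) (B : LinearMap.BilinForm F U) (hB : ∀ u, (∀ v, B u v = 0) → u = 0)
    (a : Module.End F U) (ha : ∀ u v, B (a u) (a v) = B u v) (h1 : ∀ u, a u = u → u = 0) :
    Even (Module.finrank F U) := by
  let b := Module.finBasis F U
  have hcard := even_card_of_isometry_matrix h2 (G := LinearMap.BilinForm.toMatrix b B)
    (A := LinearMap.toMatrix b b a) ?_ ?_ ?_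
  · rwa [Fintype.card_fin] at hcard
  · have h := det_gram_ne_zero_of_nondeg hB b
    convert h using 2
    ext i j
    rw [LinearMap.BilinForm.toMatrix_apply, Matrix.of_apply]
  · rw [← LinearMap.BilinForm.toMatrix_comp b]
    congr 1
    ext u v
    exact ha u v
  · rw [← LinearMap.toMatrix_one b, ← map_sub, LinearMap.det_toMatrix]
    intro h
    refine (LinearMap.det_eq_zero_iff_ker_ne_bot.1 h) ((Submodule.eq_bot_iff _).2 fun u hu => ?_)
    exact h1 u (sub_eq_zero.1 hu).symm

/-- In characteristic two the spinor norm is trivial on the centralizer of an isometry without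
non-zero fixed vectors. -/
theorem even_finrank_imOneSub (h2 : (2 : F) = 0) (hQ : Q.polarBilin.Nondegenerate)
    (hx : x ∈ quadIsometryGroup Q) (hy : y ∈ quadIsometryGroup Q) (hyx : y * x = x * y)
    (h1 : ∀ v, x v = v → v = 0) : Even (Module.finrank F (imOneSub y)) := by
  have hyx' : ∀ v, y (x v) = x (y v) := LinearEquiv.congr_fun hyx
  have hinv : ∀ v ∈ imOneSub y, (x : Module.End F V) v ∈ imOneSub y := by
    rintro _ ⟨w, rfl⟩
    refine ⟨x w, ?_⟩
    change x w - y (x w) = x (w - y w)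
    rw [hyx', map_sub]
  -- Commuting with `y`, the isometry `x` preserves `V_y` and its non-degenerate Wall form, and it
  -- has no fixed vectors there.
  refine even_finrank_of_isometry h2 (wallBilin Q hy) (wallBilin_nondeg hQ hy)
    ((x : Module.End F V).restrict hinv) (fun u v => ?_)
    fun u hu => Subtype.ext (h1 u (congrArg Subtype.val hu))
  obtain ⟨w, hw⟩ := exists_of_mem_imOneSub u
  rw [wallBilin_apply hy v hw, wallBilin_apply hy _ (w := x w)]
  · exact polar_of_isometry hx w v
  · rw [hyx', ← map_sub, hw]
    rfl

/-- The restriction of a linear equivalence to an invariant subspace. -/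
noncomputable def restrictEquiv (y : V ≃ₗ[F] V) {M : Submodule F V} (hM : ∀ v ∈ M, y v ∈ M) :
    M ≃ₗ[F] M :=
  LinearEquiv.ofInjectiveEndo ((y : Module.End F V).restrict hM) fun _ _ huv =>
    Subtype.ext (y.injective (congrArg Subtype.val huv))

theorem restrictEquiv_apply (y : V ≃ₗ[F] V) {M : Submodule F V} (hM : ∀ v ∈ M, y v ∈ M) (v : M) :
    (restrictEquiv y hM v : V) = y v := rfl

theorem finrank_imOneSub_of_isCompl {y : V ≃ₗ[F] V} {M N : Submodule F V} (h : IsCompl M N)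
    {z : M ≃ₗ[F] M} {z' : N ≃ₗ[F] N} (hz : ∀ v : M, (z v : V) = y v)
    (hz' : ∀ v : N, (z' v : V) = y v) : Module.finrank F (imOneSub y) =
      Module.finrank F (imOneSub z) + Module.finrank F (imOneSub z') := by
  have h1 := map_imOneSub_restrict y hz
  have h2 := map_imOneSub_restrict y hz'
  have h3 : imOneSub y = (imOneSub z).map M.subtype ⊔ (imOneSub z').map N.subtype := by
    rw [h1, h2, ← Submodule.map_sup, h.sup_eq_top, Submodule.map_top]
    rfl
  have h4 : (imOneSub z).map M.subtype ⊓ (imOneSub z').map N.subtype = ⊥ :=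
    disjoint_iff.1 (h.disjoint.mono (Submodule.map_subtype_le _ _) (Submodule.map_subtype_le _ _))
  have h5 := Submodule.finrank_sup_add_finrank_inf_eq
    ((imOneSub z).map M.subtype) ((imOneSub z').map N.subtype)
  rw [h4, finrank_bot, add_zero, ← h3] at h5
  rw [h5]
  congr 1
  · exact (Submodule.equivMapOfInjective _ M.injective_subtype _).finrank_eq.symm
  · exact (Submodule.equivMapOfInjective _ N.injective_subtype _).finrank_eq.symm

/-- In characteristic two the spinor norm of an isometry that commutes with `x` is that of its
restriction to the fixed space of `x`. -/
theorem even_finrank_imOneSub_iff (h2 : (2 : F) = 0) (hQ : Q.polarBilin.Nondegenerate)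
    (hx : x ∈ quadIsometryGroup Q) (hs : Module.End.IsSemisimple (x : Module.End F V))
    (hy : y ∈ quadIsometryGroup Q) (hyx : y * x = x * y)
    {z : kerEval x (X - C 1) ≃ₗ[F] kerEval x (X - C 1)} (hz : ∀ v, (z v : V) = y v) :
    Even (Module.finrank F (imOneSub y)) ↔ Even (Module.finrank F (imOneSub z)) := by
  have hc := isCompl_ker_range hs (X - C 1 : F[X])
  set N := LinearMap.range (aeval (x : Module.End F V) (X - C 1 : F[X])) with hN
  have happ : ∀ v, aeval (x : Module.End F V) (X - C 1 : F[X]) v = x v - v := by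
    intro v
    rw [map_sub, aeval_X, C_1, map_one]
    rfl
  have hyx' : ∀ v, y (x v) = x (y v) := LinearEquiv.congr_fun hyx
  have hinv : ∀ {t : V ≃ₗ[F] V}, (∀ v, t (x v) = x (t v)) → ∀ v ∈ N, t v ∈ N := by
    rintro t ht _ ⟨w, rfl⟩
    refine ⟨t w, ?_⟩
    rw [happ, happ, map_sub, ht]
  let QN : QuadraticForm F N := Q.comp N.subtype
  have hQN : QN.polarBilin.Nondegenerate := by
    have hl : ∀ u : N, (∀ v : N, QuadraticMap.polar Q (u : V) v = 0) → u = 0 := by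
      rintro ⟨_, w, rfl⟩ hu
      refine Subtype.ext (hQ.1 _ fun v => ?_)
      obtain ⟨k, hk, t, ht, rfl⟩ :=
        Submodule.mem_sup.1
        (hc.sup_eq_top ▸ Submodule.mem_top : v ∈ _)
      rw [map_add]
      have h3 := hu ⟨t, ht⟩
      have hk' : x k = k := by
        have h := mem_kerEval_X_sub_C.1 hk
        rwa [one_smul] at h
      have h4 : QuadraticMap.polar Q (aeval (x : Module.End F V) (X - C 1 : F[X]) w) k = 0 := by
        rw [happ, QuadraticMap.polar_sub_left, ← polar_of_isometry hx w k, hk', sub_self]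
      change QuadraticMap.polar Q _ k + QuadraticMap.polar Q _ t = 0
      rw [h4, zero_add]
      exact h3
    refine ⟨fun u hu => hl u hu, fun u hu => hl u fun v => ?_⟩
    rw [QuadraticMap.polar_comm]
    exact hu v
  rw [finrank_imOneSub_of_isCompl hc hz (restrictEquiv_apply y (hinv hyx')), Nat.even_add]
  -- On the image of `x - 1`, a complement of the fixed space, `x` has no non-zero fixed vectors, so
  -- this summand does not affect the parity.
  have h3 : Even (Module.finrank F (imOneSub (restrictEquiv y (hinv hyx')))) := by
    refine even_finrank_imOneSub (x := restrictEquiv x (hinv fun _ => rfl)) h2 hQN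
      (fun v => hx v) (fun v => hy v) ?_ fun v hv => ?_
    · ext v
      exact hyx' v
    · refine Subtype.ext (Submodule.disjoint_def.1 hc.disjoint _ ?_ v.2)
      refine mem_kerEval_X_sub_C.2 ?_
      rw [one_smul]
      exact congrArg Subtype.val hv
  tauto

end CharacteristicTwo

end ClassicalGroups

namespace ClassicalGroups

open Polynomial

/-! ### Generation by reflections and multiplicativity of the spinor norm -/

section OddCharacteristic

variable {F V : Type*} [Field F] [AddCommGroup V] [Module F V] {Q : QuadraticForm F V}

theorem isSquare_mul_iff [Finite F] {a b : F} (ha : a ≠ 0) (hb : b ≠ 0) :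
    IsSquare (a * b) ↔ (IsSquare a ↔ IsSquare b) := by
  classical
  let := Fintype.ofFinite F
  rw [← quadraticChar_one_iff_isSquare ha, ← quadraticChar_one_iff_isSquare hb,
    ← quadraticChar_one_iff_isSquare (mul_ne_zero ha hb), map_mul]
  rcases quadraticChar_dichotomy ha with h | h <;> rcases quadraticChar_dichotomy hb with h' | h' <;>
    rw [h, h'] <;> norm_num

theorem mem_quadIsometryGroup_of_mem_isometryGroup (h2 : (2 : F) ≠ 0) {y : V ≃ₗ[F] V}
    (hy : y ∈ isometryGroup (σ := RingHom.id F) Q.polarBilin) : y ∈ quadIsometryGroup Q := by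
  intro v
  have h : QuadraticMap.polar Q (y v) (y v) = QuadraticMap.polar Q v v := hy v v
  rw [QuadraticMap.polar_self, QuadraticMap.polar_self, nsmul_eq_mul, nsmul_eq_mul] at h
  exact mul_left_cancel₀ h2 (by exact_mod_cast h)

theorem det_gram_comp_left {ι : Type*} [Fintype ι] [DecidableEq ι] (B : LinearMap.BilinForm F V)
    (f : Module.End F V) (b : Module.Basis ι F V) :
    (Matrix.of fun i j => B (f (b i)) (b j)).det =
      LinearMap.det f * (Matrix.of fun i j => B (b i) (b j)).det := by
  have h : ∀ C : LinearMap.BilinForm F V, (Matrix.of fun i j => C (b i) (b j)) =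
      LinearMap.BilinForm.toMatrix b C := fun C => by
    ext i j
    rw [LinearMap.BilinForm.toMatrix_apply, Matrix.of_apply]
  rw [h B, ← LinearMap.det_toMatrix b, ← Matrix.det_transpose (LinearMap.toMatrix b b f),
    ← Matrix.det_mul, ← LinearMap.BilinForm.toMatrix_compLeft, ← h]
  rfl

variable [FiniteDimensional F V]

theorem exists_orthogonal_basis_of_nondeg (h2 : (2 : F) ≠ 0) (hQ : Q.polarBilin.Nondegenerate) :
    ∃ b : Module.Basis (Fin (Module.finrank F V)) F V,
      (∀ i j, i ≠ j → QuadraticMap.polar Q (b i) (b j) = 0) ∧ ∀ i, Q (b i) ≠ 0 := by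
  have : Invertible (2 : F) := invertibleOfNonzero h2
  obtain ⟨b, hb⟩ := LinearMap.BilinForm.exists_orthogonal_basis (B := Q.polarBilin)
    ⟨fun u v => QuadraticMap.polar_comm Q u v⟩
  have hb' : ∀ i j, i ≠ j → QuadraticMap.polar Q (b i) (b j) = 0 := fun i j hij => hb hij
  refine ⟨b, hb', fun i hi => b.ne_zero i (hQ.1 _ fun v => ?_)⟩
  rw [← LinearMap.zero_apply (σ₁₂ := RingHom.id F) (M₂ := F) v]
  refine LinearMap.congr_fun (b.ext fun j => ?_) v
  rw [LinearMap.zero_apply, QuadraticMap.polarBilin_apply_apply]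
  by_cases hij : i = j
  · rw [← hij, QuadraticMap.polar_self, hi, smul_zero]
  · exact hb' i j hij

/-- Every isometry is a product of reflections. -/
theorem isometry_induction (h2 : (2 : F) ≠ 0) (hQ : Q.polarBilin.Nondegenerate)
    {P : (V ≃ₗ[F] V) → Prop} (one : P 1)
    (mul : ∀ (v : V) (hv : Q v ≠ 0) (y : V ≃ₗ[F] V), y ∈ quadIsometryGroup Q → P y →
      P (reflection Q hv * y)) {z : V ≃ₗ[F] V} (hz : z ∈ quadIsometryGroup Q) : P z := by
  obtain ⟨b, hb, hb0⟩ := exists_orthogonal_basis_of_nondeg h2 hQ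
  -- Induction on the number `m` of initial vectors of an orthogonal basis that may still be moved;
  -- each step fixes one more vector, at the cost of one or two reflections.
  have key : ∀ m : ℕ, ∀ z ∈ quadIsometryGroup Q, 
      (∀ i : Fin (Module.finrank F V), m ≤ (i : ℕ) → z (b i) = b i) → P z := by
    intro m
    induction m with
    | zero =>
      intro z _ h
      have h1 : z = 1 := by
        apply LinearEquiv.toLinearMap_injective
        exact b.ext fun i => h i (Nat.zero_le _)
      rwa [h1]
    | succ m ih =>
      intro z hz h
      by_cases hm : m < Module.finrank F V
      swap
      · exact ih z hz fun i hi => absurd i.2 (by omega)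
      set u := b ⟨m, hm⟩ with hu
      have hzu : Q (z u) = Q u := hz u
      have hui : ∀ i : Fin (Module.finrank F V), m + 1 ≤ (i : ℕ) →
          QuadraticMap.polar Q (b i) u = 0 ∧ QuadraticMap.polar Q (b i) (z u) = 0 := by
        intro i hi
        have h1 : QuadraticMap.polar Q (b i) u = 0 := hb i _ fun h => by
          rw [h] at hi
          exact absurd hi (by simp)
        refine ⟨h1, ?_⟩
        rw [← h1, ← polar_of_isometry hz (b i) u, h i hi]
      have hcase : ∀ y ∈ quadIsometryGroup Q, y u = u →
          (∀ i : Fin (Module.finrank F V), m + 1 ≤ (i : ℕ) → y (b i) = b i) → P y := by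
        intro y hy hyu hyi
        refine ih y hy fun i hi => ?_
        rcases Nat.eq_or_lt_of_le hi with hi | hi
        · have : i = ⟨m, hm⟩ := Fin.ext hi.symm
          rw [this]
          exact hyu
        · exact hyi i hi
      -- The values of `Q` at `zu - u` and `zu + u` add up to `4 Q(u) ≠ 0`. In the singular case,
      -- reflecting in `zu + u` sends `zu` to `-u`, and the reflection in `u` corrects the sign.
      by_cases hQ1 : Q (z u - u) = 0
      · have hQ2 : Q (z u + u) ≠ 0 := by
          intro hQ2
          rw [map_sub_eq, hzu] at hQ1
          rw [QuadraticMap.map_add Q, hzu] at hQ2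
          have h4 : 2 * (2 * Q u) = 0 := by linear_combination hQ1 + hQ2
          exact hb0 _ ((mul_eq_zero.1 ((mul_eq_zero.1 h4).resolve_left h2)).resolve_left h2)
        have hQu : Q u ≠ 0 := hb0 _
        have hrec : z = reflection Q hQ2 * (reflection Q hQu *
            (reflection Q hQu * (reflection Q hQ2 * z))) := by
          rw [← mul_assoc (reflection Q hQu), reflection_mul_self, one_mul, ← mul_assoc,
            reflection_mul_self, one_mul]
        have hmem : reflection Q hQu * (reflection Q hQ2 * z) ∈ quadIsometryGroup Q :=
          mul_mem (reflection_mem _) (mul_mem (reflection_mem _) hz)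
        rw [hrec]
        refine mul _ _ _ (mul_mem (reflection_mem _) hmem) (mul _ _ _ hmem
          (hcase _ hmem ?_ fun i hi => ?_))
        · have h5 : reflection Q hQ2 (z u) = -u := by
            have h6 : QuadraticMap.polar Q (z u) (z u + u) = Q (z u + u) := by
              rw [QuadraticMap.polar_add_right, QuadraticMap.polar_self, QuadraticMap.map_add Q,
                hzu, two_nsmul]
            rw [reflection_apply, h6, inv_mul_cancel₀ hQ2, one_smul]
            abel
          rw [LinearEquiv.mul_apply, LinearEquiv.mul_apply, h5, map_neg, reflection_self, neg_neg]
        · obtain ⟨h6, h7⟩ := hui i hi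
          rw [LinearEquiv.mul_apply, LinearEquiv.mul_apply, h i hi,
            reflection_of_polar_eq_zero hQ2, reflection_of_polar_eq_zero hQu h6]
          rw [QuadraticMap.polar_add_right, h6, h7, add_zero]
      · have hrec : z = reflection Q hQ1 * (reflection Q hQ1 * z) := by
          rw [← mul_assoc, reflection_mul_self, one_mul]
        have hmem : reflection Q hQ1 * z ∈ quadIsometryGroup Q := mul_mem (reflection_mem _) hz
        rw [hrec]
        refine mul _ _ _ hmem (hcase _ hmem ?_ fun i hi => ?_)
        · have h6 : QuadraticMap.polar Q (z u) (z u - u) = Q (z u - u) := by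
            rw [QuadraticMap.polar_sub_right, QuadraticMap.polar_self, map_sub_eq,
              hzu, two_nsmul]
          rw [LinearEquiv.mul_apply, reflection_apply, h6, inv_mul_cancel₀ hQ1, one_smul]
          abel
        · obtain ⟨h6, h7⟩ := hui i hi
          rw [LinearEquiv.mul_apply, h i hi, reflection_of_polar_eq_zero hQ1]
          rw [QuadraticMap.polar_sub_right, h6, h7, sub_zero]
  exact key (Module.finrank F V) z hz fun i hi => absurd i.2 (by omega)

theorem spinorNorm_one (h2 : (2 : F) ≠ 0) (Q : QuadraticForm F V) : spinorNorm Q 1 = 0 := by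
  have hsub : Subsingleton (imOneSub (1 : V ≃ₗ[F] V)) := by
    refine ⟨fun u v => ?_⟩
    obtain ⟨w, hw⟩ := exists_of_mem_imOneSub u
    obtain ⟨w', hw'⟩ := exists_of_mem_imOneSub v
    refine Subtype.ext (hw.symm.trans (Eq.trans ?_ hw'))
    simp
  have h := hasWallDisc_of_basis (Q := Q) (y := (1 : V ≃ₗ[F] V))
    (Module.Basis.empty (imOneSub (1 : V ≃ₗ[F] V)) (ι := Fin 0)) 0 (fun i => i.elim0)
  rw [spinorNorm_eq_zero_iff h2 (one_mem _) h, Matrix.det_isEmpty]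
  exact IsSquare.one

variable [Finite F] {y z : V ≃ₗ[F] V}

/-- If `v` lies in `V_y` it does not lie in the space of the product. The discriminant formula is
then applied to the product, whose further product with the reflection is `y` again. -/
theorem spinorNorm_reflection_mul (h2 : (2 : F) ≠ 0) (hQ : Q.polarBilin.Nondegenerate)
    (hy : y ∈ quadIsometryGroup Q) {v : V} (hv : Q v ≠ 0) :
    spinorNorm Q (reflection Q hv * y) = 0 ↔ (IsSquare (Q v) ↔ spinorNorm Q y = 0) := by
  have hsy := mul_mem (reflection_mem hv) hy
  by_cases hvy : v ∈ imOneSub y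
  · obtain ⟨d, hd⟩ := exists_hasWallDisc Q (reflection Q hv * y)
    obtain ⟨h3, -⟩ := hd.reflection_mul hQ hsy hv (notMem_imOneSub_reflection_mul hy hv hvy)
    rw [← mul_assoc, reflection_mul_self, one_mul] at h3
    rw [spinorNorm_eq_zero_iff h2 hsy hd, spinorNorm_eq_zero_iff h2 hy h3,
      isSquare_mul_iff (hd.ne_zero hQ hsy) hv]
    tauto
  · obtain ⟨d, hd⟩ := exists_hasWallDisc Q y
    obtain ⟨h3, -⟩ := hd.reflection_mul hQ hy hv hvy
    rw [spinorNorm_eq_zero_iff h2 hsy h3, spinorNorm_eq_zero_iff h2 hy hd,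
      isSquare_mul_iff (hd.ne_zero hQ hy) hv]
    tauto

theorem spinorNorm_reflection_mul_of_two_eq_zero (h2 : (2 : F) = 0)
    (hQ : Q.polarBilin.Nondegenerate) (hy : y ∈ quadIsometryGroup Q) {v : V} (hv : Q v ≠ 0) :
    spinorNorm Q (reflection Q hv * y) = 0 ↔ ¬ spinorNorm Q y = 0 := by
  have hsy := mul_mem (reflection_mem hv) hy
  rw [spinorNorm, spinorNorm, if_pos h2, if_pos h2, ZMod.natCast_eq_zero_iff_even,
    ZMod.natCast_eq_zero_iff_even]
  by_cases hvy : v ∈ imOneSub y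
  · obtain ⟨d, hd⟩ := exists_hasWallDisc Q (reflection Q hv * y)
    obtain ⟨-, h3⟩ := hd.reflection_mul hQ hsy hv (notMem_imOneSub_reflection_mul hy hv hvy)
    rw [← mul_assoc, reflection_mul_self, one_mul] at h3
    rw [h3, Nat.even_add_one, not_not]
  · obtain ⟨d, hd⟩ := exists_hasWallDisc Q y
    obtain ⟨-, h3⟩ := hd.reflection_mul hQ hy hv hvy
    rw [h3, Nat.even_add_one]

/-- Induction on the number of reflections in `z`. Since the values lie in a group of order two,
additivity is expressed by an equivalence of vanishing statements. -/
theorem spinorNorm_mul (h2 : (2 : F) ≠ 0) (hQ : Q.polarBilin.Nondegenerate)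
    (hz : z ∈ quadIsometryGroup Q) (hy : y ∈ quadIsometryGroup Q) :
    spinorNorm Q (z * y) = 0 ↔ (spinorNorm Q z = 0 ↔ spinorNorm Q y = 0) := by
  revert y
  refine isometry_induction h2 hQ (P := fun z => ∀ {y}, y ∈ quadIsometryGroup Q →
    (spinorNorm Q (z * y) = 0 ↔ (spinorNorm Q z = 0 ↔ spinorNorm Q y = 0)))
    (fun {y} _ => ?_) (fun v hv t ht h {y} hy => ?_) hz
  · have h1 := spinorNorm_one h2 Q
    have h3 : (1 : V ≃ₗ[F] V) * y = y := one_mul y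
    rw [h3]
    tauto
  · have h1 := spinorNorm_reflection_mul h2 hQ (mul_mem ht hy) hv
    have h3 := spinorNorm_reflection_mul h2 hQ ht hv
    have h4 := h hy
    have h5 : reflection Q hv * t * y = reflection Q hv * (t * y) := mul_assoc _ _ _
    rw [h5, h1, h3, h4]
    exact iff_assoc.symm

end OddCharacteristic

end ClassicalGroups

namespace ClassicalGroups

open Polynomial

/-! ### The Wall discriminant of `a a'⁻¹` -/

section WallDiscriminant

variable {F V : Type*} [Field F] [AddCommGroup V] [Module F V] [FiniteDimensional F V]
  {Q : QuadraticForm F V}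

/-- The Wall discriminant of `z` with `z a' = a`, where `a'` is adjoint to `a` and fixes the kernel
of `a' - a`. -/
theorem exists_hasWallDisc_of_isAdj (hQ : Q.polarBilin.Nondegenerate) {a a' : Module.End F V}
    (ha : IsAdj (σ := RingHom.id F) Q.polarBilin a a') (hd : LinearMap.det a' ≠ 0)
    (hR : ∀ v, a' v = a v → a' v = v) {z : V ≃ₗ[F] V} (hz : ∀ v, z (a' v) = a v) :
    ∃ s, s ≠ 0 ∧ IsSquare s ∧ HasWallDisc Q z (LinearMap.det a' * s) := by
  let D : Module.End F V := a' - a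
  let R : Submodule F V := LinearMap.ker D
  have hDR : ∀ v ∈ R, a' v = v := fun v hv => hR v (sub_eq_zero.1 hv)
  -- With `D = a' - a`, adjointness makes the form pairing `u` with `D v` alternating; its radical
  -- is `R = ker D`, so it descends to a non-degenerate form on `V ⧸ R`.
  let δ : V →ₗ[F] V →ₗ[F] F := Q.polarBilin.compl₂ D
  have hδ : ∀ u v, δ u v = QuadraticMap.polar Q u (D v) := fun u v => rfl
  have halt : ∀ v, δ v v = 0 := by
    intro v
    have h : QuadraticMap.polar Q (a v) v = QuadraticMap.polar Q v (a' v) := ha v v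
    have h1 : D v = a' v - a v := rfl
    rw [hδ, h1, QuadraticMap.polar_sub_right, ← h, QuadraticMap.polar_comm Q v, sub_self]
  have hδR : ∀ v ∈ R, ∀ u, δ u v = 0 := by
    intro v hv u
    rw [hδ, LinearMap.mem_ker.1 hv, QuadraticMap.polar_zero_right]
  have hδR' : R ≤ LinearMap.ker δ := fun v hv => LinearMap.mem_ker.2 <| LinearMap.ext fun u => by
    rw [alternating_swap halt u v, hδR v hv, neg_zero, LinearMap.zero_apply]
  let δ₁ : V ⧸ R →ₗ[F] V →ₗ[F] F := R.liftQ δ hδR'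
  have hδ₁ : R ≤ LinearMap.ker δ₁.flip := fun v hv => LinearMap.mem_ker.2 <|
    LinearMap.ext fun u => by
      obtain ⟨u, rfl⟩ := R.mkQ_surjective u
      exact hδR v hv u
  let B : V ⧸ R →ₗ[F] V ⧸ R →ₗ[F] F := (R.liftQ δ₁.flip hδ₁).flip
  have hB : ∀ u v, B (R.mkQ u) (R.mkQ v) = δ u v := fun u v => rfl
  have hBalt : ∀ v, B v v = 0 := fun v => by
    obtain ⟨v, rfl⟩ := R.mkQ_surjective v
    exact halt v
  have hBnd : ∀ u, (∀ v, B u v = 0) → u = 0 := by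
    intro u hu
    obtain ⟨u, rfl⟩ := R.mkQ_surjective u
    refine (Submodule.Quotient.mk_eq_zero R).2 (LinearMap.mem_ker.2 (hQ.2 _ fun v => ?_))
    have h := hu (R.mkQ v)
    rw [hB, alternating_swap halt v u, neg_eq_zero] at h
    exact h
  have hinv : R ≤ R.comap a' := fun v hv => by
    rw [Submodule.mem_comap, hDR v hv]
    exact hv
  -- By hypothesis `a'` is the identity on `R`, so the whole determinant is seen on the quotient.
  have hdet : LinearMap.det (R.mapQ R a' hinv) = LinearMap.det a' := by
    rw [LinearMap.det_eq_det_mul_det R a' hinv]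
    have h : a'.restrict hinv = LinearMap.id := by
      ext v
      exact hDR v v.2
    rw [h, LinearMap.det_id, one_mul]
  have hsurj : Function.Surjective a' := (LinearMap.equivOfDetNeZero a' hd).surjective
  -- From `z a' = a` it follows that `(1 - z) a' = D`, and `a'` is bijective.
  have hrange : LinearMap.range D = imOneSub z := by
    ext v
    constructor
    · rintro ⟨w, rfl⟩
      refine ⟨a' w, ?_⟩
      change a' w - z (a' w) = a' w - a w
      rw [hz]
    · rintro ⟨w, rfl⟩
      obtain ⟨t, rfl⟩ := hsurj w
      refine ⟨t, ?_⟩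
      change a' t - a t = a' t - z (a' t)
      rw [hz]
  let b := Module.finBasis F (V ⧸ R)
  choose t ht using fun i => R.mkQ_surjective (b i)
  let c : Module.Basis _ F (imOneSub z) :=
    b.map (D.quotKerEquivRange.trans (LinearEquiv.ofEq _ _ hrange))
  have hc : ∀ i, (c i : V) = D (t i) := fun i => by
    change (D.quotKerEquivRange (b i) : V) = _
    rw [← ht]
    rfl
  have hdisc := hasWallDisc_of_basis (Q := Q) c (fun i => a' (t i)) fun i => by
    rw [hc, hz]
    rfl
  -- Since `a' t` is a preimage of `D t` under `1 - z`, the Wall form is the alternating form with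
  -- `a'` applied to its first argument. This produces the factor `det a'` in front of a square.
  have hmat : (Matrix.of fun i j => QuadraticMap.polar Q (a' (t i)) (c j : V)) =
      Matrix.of fun i j => B (R.mapQ R a' hinv (b i)) (b j) := by
    ext i j
    rw [Matrix.of_apply, Matrix.of_apply, hc, ← ht, ← ht]
    rfl
  rw [hmat, det_gram_comp_left B, hdet] at hdisc
  exact ⟨_, det_gram_ne_zero_of_nondeg hBnd b, isSquare_det_gram_of_alternating B hBalt hBnd b,
    hdisc⟩

end WallDiscriminant

/-! ### An element of non-trivial spinor norm when `x² ≠ 1` -/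

section SpinorSurjective

variable {F V : Type*} [Field F] [AddCommGroup V] [Module F V] [FiniteDimensional F V] [Finite F]
  {Q : QuadraticForm F V} {x : V ≃ₗ[F] V}

/-- A self-adjoint operator commuting with an isometry `x` such that `x ^ 2 - 1` is injective has a
square determinant. -/
theorem isSquare_det_of_selfAdjoint {W : Type*} [AddCommGroup W] [Module F W]
    [FiniteDimensional F W] {β : W →ₗ[F] W →ₗ[F] F}
    (hβ : IsEpsHermitian (σ := RingHom.id F) 1 β) {x : W ≃ₗ[F] W}
    (hx : x ∈ isometryGroup (σ := RingHom.id F) β) (hx2 : ∀ v, x (x v) = v → v = 0)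
    {a : Module.End F W} (ha : ∀ u v, β (a u) v = β u (a v)) (hax : ∀ v, a (x v) = x (a v)) :
    IsSquare (LinearMap.det a) := by
  by_cases hd : LinearMap.det a = 0
  · rw [hd]
    exact IsSquare.zero
  have hsymm : ∀ u v, β v u = β u v := fun u v => by rw [hβ.symm u v, one_mul]; rfl
  have hadj : ∀ u v, β (x u) v = β u (x⁻¹ v) := isAdj_of_isometry hx
  have hxx : ∀ v, x (x⁻¹ v) = v := x.apply_symm_apply
  let δ : W →ₗ[F] W →ₗ[F] F :=
    β.compl₂ ((x : Module.End F W) - ((x⁻¹ : W ≃ₗ[F] W) : Module.End F W))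
  have hδ : ∀ u v, δ u v = β u (x v) - β u (x⁻¹ v) := fun u v => map_sub (β u) _ _
  have hnd : ∀ u, (∀ v, δ v u = 0) → u = 0 := by
    intro u hu
    refine hx2 u ?_
    have h : x u - x⁻¹ u = 0 := hβ.nondeg_right _ fun v => by
      rw [map_sub, ← hδ, hu]
    rw [sub_eq_zero.1 h, hxx]
  have halt : ∀ v, δ v v = 0 := by
    intro v
    rw [hδ, ← hadj, hsymm, sub_self]
  -- Both `δ` and its twist by the self-adjoint `a` are alternating and non-degenerate, so both
  -- discriminants are squares, and `det a` is their quotient.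
  let δ' : W →ₗ[F] W →ₗ[F] F := δ ∘ₗ a
  have halt' : ∀ v, δ' v v = 0 := by
    intro v
    change δ (a v) v = 0
    rw [hδ, ← hadj, ← hax, ha (x v), hsymm, sub_self]
  have hl : ∀ u, (∀ v, δ u v = 0) → u = 0 := fun u hu => hnd u fun v => by
    rw [alternating_swap halt, hu, neg_zero]
  have hl' : ∀ u, (∀ v, δ' u v = 0) → u = 0 := fun u hu =>
    (LinearMap.equivOfDetNeZero a hd).injective ((hl _ hu).trans (map_zero _).symm)
  let b := Module.finBasis F W
  have h1 := isSquare_det_gram_of_alternating δ halt hl b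
  have h2 := isSquare_det_gram_of_alternating δ' halt' hl' b
  have h3 : (Matrix.of fun i j => δ' (b i) (b j)).det =
      LinearMap.det a * (Matrix.of fun i j => δ (b i) (b j)).det := det_gram_comp_left δ a b
  rw [h3, isSquare_mul_iff hd (det_gram_ne_zero_of_nondeg hl b)] at h2
  exact h2.2 h1

theorem exists_nonsquare {F : Type*} [Field F] [Finite F] (h2 : (2 : F) ≠ 0) : ∃ c : F, ¬ IsSquare c :=
  FiniteField.exists_nonsquare fun h => h2 <| by
    have := (ringChar.eq_iff (R := F) (p := 2)).1 h
    exact CharTwo.two_eq_zero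

/-- Take `z = a a'⁻¹` with `det a = c` a non-square. Its determinant is one, as `a` and `a'` have
equal determinants, and its Wall discriminant is `c` times a square. The work lies in showing that
`a'` fixes every vector on which `a` and `a'` agree. -/
theorem exists_spinorNorm_ne_zero_of_range_ne_bot (h2 : (2 : F) ≠ 0)
    (hQ : Q.polarBilin.Nondegenerate) (hx : x ∈ quadIsometryGroup Q)
    (hs : Module.End.IsSemisimple (x : Module.End F V))
    (hT0 : LinearMap.range ((x : Module.End F V) ^ 2 - 1) ≠ ⊥) :
    ∃ z ∈ centralizerIn (quadIsometryGroup Q ⊓ specialGroup F V) x, spinorNorm Q z ≠ 0 := by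
  have hβ := isEpsHermitian_polarBilin hQ
  have hx' := mem_isometryGroup_polarBilin hx
  set T := LinearMap.range ((x : Module.End F V) ^ 2 - 1) with hT
  have happ : ∀ v, ((x : Module.End F V) ^ 2 - 1 : Module.End F V) v = x (x v) - v := fun v => by
    rw [sq]
    rfl
  obtain ⟨c, hc⟩ := exists_nonsquare h2
  have hc0 : c ≠ 0 := fun h => hc (h ▸ IsSquare.zero)
  obtain ⟨U, U', h, hUT⟩ := exists_isDualPair hβ hx' hs (T := T) (by
    rintro _ ⟨v, rfl⟩
    refine ⟨x v, ?_⟩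
    rw [happ, happ, map_sub]) hT0
  obtain ⟨q, a, a', ho, hd⟩ := h.exists_operator hβ c
  have hd' : LinearMap.det a' = c := by
    rw [← hd]
    exact (hβ.det_eq_of_isAdj ho.isAdj).symm
  obtain ⟨z, hz, hza⟩ := ho.exists_isometry h hβ hx' (by rwa [hd])
  have hzQ := mem_quadIsometryGroup_of_mem_isometryGroup h2 hz.2
  have hcomm : ∀ v, a (x v) = x (a v) := LinearMap.congr_fun (ho.commute_self h hβ hx').eq
  have hcomm' : ∀ v, a' (x v) = x (a' v) := LinearMap.congr_fun (ho.adj_commute_self h hβ hx').eq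
  have hzdet : LinearMap.det (z : Module.End F V) = 1 := by
    have h3 : (z : Module.End F V) * a' = a := LinearMap.ext hza
    have h4 := congrArg LinearMap.det h3
    rw [map_mul, hd, hd'] at h4
    exact mul_right_cancel₀ hc0 (by rw [h4, one_mul])
  have hR : ∀ v, a' v = a v → a' v = v := by
    intro v hv
    rcases h.eq_or with hUU | ⟨-, hU'⟩
    · subst hUU
      have hcompl := isCompl_orth hβ h.disjoint_left h.disjoint_right
      have hU1 : ∀ v ∈ U, a v ∈ U := fun v hv => by
        have := U.add_mem (ho.sub_mem h hβ v) hv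
        rwa [sub_add_cancel] at this
      -- By minimality `a` and `a'` agree on `U` only at zero or everywhere. In the second case `a`
      -- is self-adjoint on `U`, forcing the non-square `c` to be a square.
      rcases h.left.min (U ⊓ LinearMap.ker (a' - a)) inf_le_left (fun v hv =>
        ⟨h.left.inv v hv.1, by
          have h3 : a' v = a v := sub_eq_zero.1 hv.2
          change a' (x v) - a (x v) = 0
          rw [hcomm, hcomm', h3, sub_self]⟩) with h3 | h3
      · obtain ⟨s, hs, t, ht, rfl⟩ :=
          Submodule.mem_sup.1 (hcompl.sup_eq_top ▸ Submodule.mem_top : v ∈ _)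
        have ht1 := ho.on_orth t ht
        have ht2 := ho.adj_on_orth h hβ ht
        rw [map_add, map_add, ht1, ht2] at hv
        have hs0 : s ∈ U ⊓ LinearMap.ker (a' - a) :=
          ⟨hs, sub_eq_zero.2 (add_right_cancel hv)⟩
        rw [h3, Submodule.mem_bot] at hs0
        rw [hs0, zero_add, ht2]
      · exfalso
        refine hc ?_
        have hself : ∀ v ∈ U, a' v = a v := fun v hv => sub_eq_zero.1 (h3.symm.le hv).2
        have hU2 : ∀ v ∈ orth (σ := RingHom.id F) Q.polarBilin U,
            a v ∈ orth (σ := RingHom.id F) Q.polarBilin U := fun v hv => by rwa [ho.on_orth v hv]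
        have hdU : LinearMap.det (a.restrict hU1) = c := by
          rw [← hd, det_prod_of_isCompl hcompl a hU1 hU2]
          have e2 : a.restrict hU2 = LinearMap.id := by
            ext v
            exact ho.on_orth v v.2
          rw [e2, LinearMap.det_id, mul_one]
        rw [← hdU]
        refine isSquare_det_of_selfAdjoint (x := restrictEquiv x h.left.inv)
          (hβ.restrict U fun u hu h4 => ?_) (fun u v => hx' u v) (fun v hv => ?_)
          (fun u v => ?_) fun v => Subtype.ext (hcomm v)
        · exact Submodule.disjoint_def.1 h.disjoint_left u hu
            fun v hv => hβ.eq_zero_symm (h4 v hv)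
        · have hv' : x (x v) = v := congrArg Subtype.val hv
          have hle := h.left.disjoint_or_le (N := LinearMap.ker ((x : Module.End F V) ^ 2 - 1))
            fun v hv => by
              rw [LinearMap.mem_ker, happ, sub_eq_zero] at hv ⊢
              change x (x (x v)) = x v
              rw [hv]
          rcases hle with hdis | hle
          · refine Subtype.ext (Submodule.disjoint_def.1 hdis _ v.2 ?_)
            rw [LinearMap.mem_ker, happ, hv', sub_self]
          -- If `x² = 1` on `U`, then `U` is orthogonal to the image of `x² - 1`, which the choice
          -- of the pair excludes.
          · refine absurd (fun u hu => ?_) hUT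
            rintro _ ⟨t, rfl⟩
            have hu' : x (x u) = u := by
              have h5 := hle hu
              rwa [LinearMap.mem_ker, happ, sub_eq_zero] at h5
            have h6 := hx' (x t) (x u)
            rw [hx' t u, hu'] at h6
            rw [happ, map_sub, LinearMap.sub_apply, h6, sub_self]
        · have h5 := ho.isAdj u v
          rw [hself v v.2] at h5
          exact h5
    -- For isotropic partners, `a v = a' v` puts `a v - v` into `U ∩ U'`. As `U'` is its own
    -- orthogonal or smaller, this intersection is trivial.
    · have h3 := ho.sub_mem h hβ v
      rw [← hv] at h3
      exact sub_eq_zero.1 (Submodule.disjoint_def.1 h.disjoint_left _ h3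
        (hU' (ho.adj_sub_mem hβ v)))
  obtain ⟨s, hs0, hs1, hdisc⟩ := exists_hasWallDisc_of_isAdj hQ ho.isAdj (by rwa [hd']) hR hza
  refine ⟨z, ⟨hz.1, hzQ, mem_specialGroup.2 hzdet⟩, fun h3 => hc ?_⟩
  rw [spinorNorm_eq_zero_iff h2 hzQ hdisc, hd', isSquare_mul_iff hc0 hs0] at h3
  exact h3.2 hs1

end SpinorSurjective

end ClassicalGroups

namespace ClassicalGroups

open Polynomial

/-! ### An element of non-trivial spinor norm when `x² = 1` -/

section Involutions

variable {F V : Type*} [Field F] [AddCommGroup V] [Module F V]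
  {Q : QuadraticForm F V} {x : V ≃ₗ[F] V}

theorem exists_orthogonal_pair (h2 : (2 : F) ≠ 0) {M : Submodule F V}
    (hM : 2 ≤ Module.finrank F M)
    (hnd : ∀ u ∈ M, (∀ v ∈ M, QuadraticMap.polar Q u v = 0) → u = 0) :
    ∃ v ∈ M, ∃ w ∈ M, Q v ≠ 0 ∧ Q w ≠ 0 ∧ QuadraticMap.polar Q v w = 0 := by
  obtain ⟨v, hvM, hv⟩ := exists_nonsingular (M := M) (by
    rintro rfl
    rw [finrank_bot] at hM
    omega) hnd
  let N : Submodule F V := M ⊓ LinearMap.ker (Q.polarBilin v)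
  have hvv : QuadraticMap.polar Q v v ≠ 0 := by
    rw [QuadraticMap.polar_self, nsmul_eq_mul]
    exact mul_ne_zero (by exact_mod_cast h2) hv
  have hsplit : ∀ m ∈ M, ∃ c : F, m - c • v ∈ N := fun m hm => by
    refine ⟨QuadraticMap.polar Q v m / QuadraticMap.polar Q v v,
      M.sub_mem hm (M.smul_mem _ hvM), ?_⟩
    change QuadraticMap.polar Q v _ = 0
    rw [QuadraticMap.polar_sub_right, QuadraticMap.polar_smul_right, smul_eq_mul,
      div_mul_cancel₀ _ hvv, sub_self]
  have hN : N ≠ ⊥ := by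
    intro hN
    have hle : M ≤ Submodule.span F {v} := fun m hm => by
      obtain ⟨c, hc⟩ := hsplit m hm
      rw [hN, Submodule.mem_bot, sub_eq_zero] at hc
      rw [hc]
      exact Submodule.smul_mem _ _ (Submodule.mem_span_singleton_self v)
    have h3 := (Submodule.finrank_mono hle).trans (finrank_span_le_card ({v} : Set V))
    rw [Set.toFinset_singleton, Finset.card_singleton] at h3
    omega
  obtain ⟨w, hw, hw0⟩ := exists_nonsingular (Q := Q) hN fun u hu h => hnd u hu.1 fun m hm => by
    obtain ⟨c, hc⟩ := hsplit m hm
    have h3 := h _ hc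
    have h4 : QuadraticMap.polar Q v u = 0 := hu.2
    rwa [QuadraticMap.polar_sub_right, QuadraticMap.polar_smul_right,
      QuadraticMap.polar_comm Q u v, h4, smul_zero, sub_zero] at h3
  exact ⟨v, hvM, w, hw.1, hv, hw0, hw.2⟩

/-- `V` is the sum of the eigenspaces for `1` and `-1`. Two eigenspaces of dimension at most one are
possible only for `n ≤ 2`, and for `n = 2` they give determinant `-1`. -/
theorem exists_two_le_finrank_kerEval [FiniteDimensional F V] (h2 : (2 : F) ≠ 0) (hx2 : ∀ v, x (x v) = v)
    (hn : 3 ≤ Module.finrank F V ∨ Module.finrank F V = 2 ∧ x ∈ specialGroup F V) :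
    ∃ c : F, c * c = 1 ∧ 2 ≤ Module.finrank F (kerEval x (X - C c)) := by
  have hmem : ∀ (c : F) v, v ∈ kerEval x (X - C c) ↔ x v = c • v := fun c v =>
    mem_kerEval_X_sub_C
  have hc : IsCompl (kerEval x (X - C (1 : F))) (kerEval x (X - C (-1 : F))) := by
    refine ⟨Submodule.disjoint_def.2 fun v h1 h3 => ?_,
      codisjoint_iff.2 (Submodule.eq_top_iff'.2 fun v => ?_)⟩
    · rw [hmem, one_smul] at h1
      rw [hmem, h1, neg_smul, one_smul, eq_neg_iff_add_eq_zero, ← two_smul F] at h3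
      exact (smul_eq_zero.1 h3).resolve_left h2
    · have hv : v = (2 : F)⁻¹ • (v + x v) + (2 : F)⁻¹ • (v - x v) := by
        rw [← smul_add, add_add_sub_cancel, ← two_smul F, smul_smul, inv_mul_cancel₀ h2, one_smul]
      rw [hv]
      refine Submodule.add_mem_sup (Submodule.smul_mem _ _ ?_) (Submodule.smul_mem _ _ ?_)
      · rw [hmem, map_add, hx2, one_smul, add_comm]
      · rw [hmem, map_sub, hx2, neg_smul, one_smul, neg_sub]
  have hsum := Submodule.finrank_add_eq_of_isCompl hc
  by_contra! hlt
  have hl1 := hlt 1 (by ring)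
  have hl2 := hlt (-1) (by ring)
  rcases hn with hn | ⟨hn, hdet⟩
  · omega
  · rw [mem_specialGroup, det_prod_of_isCompl hc (x : Module.End F V)
      (fun v hv => kerEval_invariant x _ rfl hv) (fun v hv => kerEval_invariant x _ rfl hv)] at hdet
    have e1 : (x : Module.End F V).restrict
        (fun v (hv : v ∈ kerEval x (X - C (1 : F))) => kerEval_invariant x _ rfl hv) =
        LinearMap.id := by
      ext v
      have h := (hmem 1 v).1 v.2
      rwa [one_smul] at h
    have e2 : (x : Module.End F V).restrict
        (fun v (hv : v ∈ kerEval x (X - C (-1 : F))) => kerEval_invariant x _ rfl hv) =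
        (-1 : F) • LinearMap.id := by
      ext v
      exact (hmem (-1) v).1 v.2
    have e3 : Module.finrank F (kerEval x (X - C (-1 : F))) = 1 := by omega
    rw [e1, e2, LinearMap.det_id, one_mul, LinearMap.det_smul, LinearMap.det_id, e3, pow_one,
      mul_one] at hdet
    exact h2 (by linear_combination -hdet)

/-- For orthogonal non-singular `v` and `w`, the equation `Q(v) s² + Q(w) t² = c Q(v)` with `c` a
non-square is solvable over a finite field of odd order, so the plane they span takes values in both
square classes. -/
theorem exists_nonsquare_value_product [Finite F] (h2 : (2 : F) ≠ 0) {M : Submodule F V}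
    (hM : 2 ≤ Module.finrank F M)
    (hnd : ∀ u ∈ M, (∀ v ∈ M, QuadraticMap.polar Q u v = 0) → u = 0) :
    ∃ v ∈ M, ∃ w ∈ M, Q v ≠ 0 ∧ Q w ≠ 0 ∧ ¬ (IsSquare (Q v) ↔ IsSquare (Q w)) := by
  obtain ⟨v, hv, w, hw, hv0, hw0, hvw⟩ := exists_orthogonal_pair h2 hM hnd
  obtain ⟨c, hc⟩ := exists_nonsquare h2
  have hc0 : c ≠ 0 := fun h => hc (h ▸ IsSquare.zero)
  let := Fintype.ofFinite F
  obtain ⟨s, t, hst⟩ := FiniteField.exists_root_sum_quadratic (R := F)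
    (f := C (Q v) * X ^ 2 + C 0 * X + C (-(c * Q v))) (g := C (Q w) * X ^ 2 + C 0 * X + C 0)
    (degree_quadratic hv0) (degree_quadratic hw0)
    (FiniteField.odd_card_of_char_ne_two fun h => h2 <| by
      have := (ringChar.eq_iff (R := F) (p := 2)).1 h
      exact CharTwo.two_eq_zero)
  have hval : Q (s • v + t • w) = c * Q v := by
    rw [QuadraticMap.map_add Q, QuadraticMap.map_smul, QuadraticMap.map_smul,
      QuadraticMap.polar_smul_left, QuadraticMap.polar_smul_right, hvw]
    simp only [eval_add, eval_mul, eval_C, eval_pow, eval_X] at hst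
    simp only [smul_eq_mul]
    linear_combination hst
  refine ⟨v, hv, _, M.add_mem (M.smul_mem s hv) (M.smul_mem t hw), hv0, ?_, ?_⟩
  · rw [hval]
    exact mul_ne_zero hc0 hv0
  · rw [hval, isSquare_mul_iff hc0 hv0]
    tauto

/-- When `x² = 1`, use the product of two reflections in vectors of one eigenspace whose values lie
in different square classes. -/
theorem exists_spinorNorm_ne_zero [FiniteDimensional F V] [Finite F] (h2 : (2 : F) ≠ 0)
    (hQ : Q.polarBilin.Nondegenerate) (hx : x ∈ quadIsometryGroup Q)
    (hs : Module.End.IsSemisimple (x : Module.End F V))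
    (hn : 3 ≤ Module.finrank F V ∨ Module.finrank F V = 2 ∧ x ∈ specialGroup F V) :
    ∃ z ∈ centralizerIn (quadIsometryGroup Q ⊓ specialGroup F V) x, spinorNorm Q z ≠ 0 := by
  by_cases hT0 : LinearMap.range ((x : Module.End F V) ^ 2 - 1) = ⊥
  swap
  · exact exists_spinorNorm_ne_zero_of_range_ne_bot h2 hQ hx hs hT0
  have hx2 : ∀ v, x (x v) = v := fun v => by
    have h := LinearMap.congr_fun (LinearMap.range_eq_bot.1 hT0) v
    rw [sq] at h
    exact sub_eq_zero.1 h
  obtain ⟨c, hc, hM⟩ := exists_two_le_finrank_kerEval h2 hx2 hn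
  obtain ⟨v, hv, w, hw, hv0, hw0, hvw⟩ := exists_nonsquare_value_product h2 hM
    (polar_nondeg_kerEval hQ hx hs hc)
  have hw1 := reflection_mem hw0
  have hcomm := fun {t : V} (ht : t ∈ kerEval x (X - C c)) (ht0 : Q t ≠ 0) =>
    mem_centralizer_of_comm (reflection_mul_comm hx ht0 (mem_kerEval_X_sub_C.1 ht) hc)
  refine ⟨reflection Q hv0 * reflection Q hw0,
    ⟨mul_mem (hcomm hv hv0) (hcomm hw hw0), mul_mem (reflection_mem hv0) hw1, ?_⟩, fun h => ?_⟩
  · refine mem_specialGroup.2 ?_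
    have h3 : ((reflection Q hv0 * reflection Q hw0 : V ≃ₗ[F] V) : Module.End F V) =
      (reflection Q hv0 : Module.End F V) * (reflection Q hw0 : Module.End F V) := rfl
    rw [h3, map_mul, det_reflection, det_reflection]
    ring
  · have h3 := spinorNorm_reflection_mul h2 hQ (one_mem _) hw0
    have h4 := spinorNorm_one h2 Q
    have h5 : reflection Q hw0 * 1 = reflection Q hw0 := mul_one _
    rw [h5, h4] at h3
    rw [spinorNorm_reflection_mul h2 hQ hw1, h3] at h
    exact hvw (by simpa using h)

end Involutions

/-! ### Centralizers in the Omega groups -/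

section OmegaCounts

variable {F V : Type*} [Field F] [AddCommGroup V] [Module F V] [FiniteDimensional F V]
  {Q : QuadraticForm F V} {x : V ≃ₗ[F] V}

theorem mem_omegaGroup_comm_iff {y : V ≃ₗ[F] V} : (y ∈ omegaGroup Q ∧ y * x = x * y) ↔
    y ∈ centralizerIn (quadIsometryGroup Q ⊓ specialGroup F V) x ∧ spinorNorm Q y = 0 :=
  ⟨fun h => ⟨⟨mem_centralizer_of_comm h.2, h.1.1, h.1.2.1⟩, h.1.2.2⟩,
    fun h => ⟨⟨h.1.2.1, h.1.2.2, h.2⟩, comm_of_mem_centralizer h.1.1⟩⟩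

theorem card_omega_of_flip [Finite F] {z : V ≃ₗ[F] V}
    (hz : z ∈ centralizerIn (quadIsometryGroup Q ⊓ specialGroup F V) x)
    (hflip : ∀ y ∈ quadIsometryGroup Q, spinorNorm Q (z * y) = 0 ↔ ¬ spinorNorm Q y = 0) :
    Nat.card (centralizerIn (quadIsometryGroup Q ⊓ specialGroup F V) x) =
      2 * Nat.card {y : V ≃ₗ[F] V // y ∈ omegaGroup Q ∧ y * x = x * y} := by
  have : Finite V := Module.finite_of_finite F
  have : Finite (V ≃ₗ[F] V) := DFunLike.finite _
  rw [card_eq_two_mul_card_of_flip _ (P := fun y => spinorNorm Q y = 0) hz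
    fun y hy => hflip y hy.2.1]
  congr 1
  exact Nat.card_congr (Equiv.subtypeEquivRight fun y => mem_omegaGroup_comm_iff.symm)

theorem card_omega_of_odd [Finite F] (h2 : (2 : F) ≠ 0)
    (hQ : Q.polarBilin.Nondegenerate) (hx : x ∈ quadIsometryGroup Q)
    (hs : Module.End.IsSemisimple (x : Module.End F V))
    (hn : 3 ≤ Module.finrank F V ∨ Module.finrank F V = 2 ∧ x ∈ specialGroup F V) :
    Nat.card (centralizerIn (quadIsometryGroup Q ⊓ specialGroup F V) x) =
      2 * Nat.card {y : V ≃ₗ[F] V // y ∈ omegaGroup Q ∧ y * x = x * y} := by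
  obtain ⟨z, hz, hz0⟩ := exists_spinorNorm_ne_zero h2 hQ hx hs hn
  refine card_omega_of_flip hz fun y hy => ?_
  rw [spinorNorm_mul h2 hQ hz.2.1 hy]
  simp [hz0]

theorem kerEval_ne_bot_of_not_isUnit (h2 : (2 : F) = 0)
    (hu : ¬ IsUnit ((x : Module.End F V) + 1)) : kerEval x (X - C 1) ≠ ⊥ := by
  intro hb
  have h1 : LinearMap.ker ((x : Module.End F V) + 1) = ⊥ := by
    rw [Submodule.eq_bot_iff]
    intro v hv
    rw [← Submodule.mem_bot F, ← hb, mem_kerEval_X_sub_C, one_smul]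
    have h3 : x v + v = 0 := hv
    have h4 : v + v = 0 := by rw [← two_smul F, h2, zero_smul]
    exact add_right_cancel (h3.trans h4.symm)
  have h3 := LinearMap.ker_eq_bot.1 h1
  exact hu ((Module.End.isUnit_iff _).2 ⟨h3, LinearMap.injective_iff_surjective.1 h3⟩)

/-- The reflection in a non-singular fixed vector of `x` commutes with `x`, has determinant `-1 =
1`, and flips the parity of `dim V_y`. -/
theorem card_omega_of_even_of_not_isUnit [Finite F] (h2 : (2 : F) = 0)
    (hQ : Q.polarBilin.Nondegenerate) (hx : x ∈ quadIsometryGroup Q)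
    (hs : Module.End.IsSemisimple (x : Module.End F V))
    (hu : ¬ IsUnit ((x : Module.End F V) + 1)) :
    Nat.card (centralizerIn (quadIsometryGroup Q ⊓ specialGroup F V) x) =
      2 * Nat.card {y : V ≃ₗ[F] V // y ∈ omegaGroup Q ∧ y * x = x * y} := by
  obtain ⟨v, hv, hz⟩ := exists_reflection hQ hx hs (one_mul 1)
    (kerEval_ne_bot_of_not_isUnit h2 hu)
  refine card_omega_of_flip (z := reflection Q hv)
    ⟨hz.1, hz.2, mem_specialGroup.2 ?_⟩ fun y hy =>
      spinorNorm_reflection_mul_of_two_eq_zero h2 hQ hy hv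
  rw [det_reflection]
  linear_combination -h2

theorem card_omega_of_even_of_isUnit (h2 : (2 : F) = 0)
    (hQ : Q.polarBilin.Nondegenerate) (hx : x ∈ quadIsometryGroup Q)
    (hu : IsUnit ((x : Module.End F V) + 1)) :
    Nat.card {y : V ≃ₗ[F] V // y ∈ omegaGroup Q ∧ y * x = x * y} =
      Nat.card (centralizerIn (quadIsometryGroup Q ⊓ specialGroup F V) x) := by
  have hinj := ((Module.End.isUnit_iff _).1 hu).1
  refine Nat.card_congr (Equiv.subtypeEquivRight fun y => ?_)
  rw [mem_omegaGroup_comm_iff, and_iff_left_iff_imp]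
  intro hy
  rw [spinorNorm, if_pos h2, ZMod.natCast_eq_zero_iff_even]
  refine even_finrank_imOneSub h2 hQ hx hy.2.1 (comm_of_mem_centralizer hy.1) fun v hv => ?_
  refine hinj (Eq.trans ?_ (map_zero _).symm)
  change x v + v = 0
  rw [hv, ← two_smul F, h2, zero_smul]

theorem mem_specialGroup_of_two_eq_zero (h2 : (2 : F) = 0) (hQ : Q.polarBilin.Nondegenerate)
    {y : V ≃ₗ[F] V} (hy : y ∈ quadIsometryGroup Q) : y ∈ specialGroup F V := by
  rw [mem_specialGroup]
  rcases det_sq_of_isometry (isEpsHermitian_polarBilin hQ) (mem_isometryGroup_polarBilin hy)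
    with h | h
  · exact h
  · rw [h]
    linear_combination -h2

/-- Comparing constant terms in `f = f*` for `f = t - c` gives `c² = 1`, so `c = 1` in
characteristic two. Hence the Φ₁ part has at most one factor, the isometry group of the fixed space
of `x`. -/
theorem phi1_eq_X_sub_one (h2 : (2 : F) = 0) {f : F[X]} (hf : f ∈ Phi1 (RingHom.id F)) :
    f = X - C 1 := by
  obtain ⟨f1, f2, -, f4, f5⟩ := hf
  obtain ⟨c, rfl⟩ : ∃ c, f = X - C c := ⟨-f.coeff 0, by
    rw [C_neg, sub_neg_eq_add]
    exact f1.eq_X_add_C f5⟩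
  have h1 : (C c : F[X]).reflect 1 = C c * X := by
    have h := reflect_C c 1
    rwa [pow_one] at h
  have h3 : dualPoly (RingHom.id F) (X - C c) = C (-c)⁻¹ * (1 - C c * X) := by
    rw [dualPoly, Polynomial.map_id, reverse, natDegree_X_sub_C, reflect_sub, reflect_one_X, h1]
    simp
  have h4 := congrArg (fun g => coeff g 0) f4
  simp only [h3, mul_sub, coeff_sub, coeff_C_mul, coeff_X_zero, coeff_C_zero,
    mul_zero, sub_zero, mul_one, zero_sub] at h4
  have hc : -c ≠ 0 := by simpa using f2
  have h5 : (c - 1) * (c - 1) = 0 := by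
    have h6 := congrArg (fun t => t * (-c)) h4
    simp only [inv_mul_cancel₀ hc] at h6
    linear_combination h6 + (1 - c) * h2
  rw [sub_eq_zero.1 (mul_self_eq_zero.1 h5)]

/-- In characteristic two membership of the Omega group is decided on the fixed space of `x`. -/
theorem mem_omegaGroup_iff_of_even [Finite F] (h2 : (2 : F) = 0)
    (hQ : Q.polarBilin.Nondegenerate) (hx : x ∈ quadIsometryGroup Q)
    (hs : Module.End.IsSemisimple (x : Module.End F V)) {y : V ≃ₗ[F] V}
    (hy : y ∈ centralizerIn (quadIsometryGroup Q) x)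
    (φ : ∀ f : GenDivisorsIn (RingHom.id F) x (Phi1 (RingHom.id F)),
      kerEval x f.1 ≃ₗ[F] kerEval x f.1) (hφ : ∀ f v, (φ f v : V) = y v) :
    y ∈ omegaGroup Q ↔ ∀ f, φ f ∈ omegaGroup (Q.comp (kerEval x f.1).subtype) := by
  have hyx := comm_of_mem_centralizer hy.1
  have hβ := isEpsHermitian_polarBilin hQ
  have hx' := mem_isometryGroup_polarBilin hx
  have hnorm : ∀ {W : Type _} [AddCommGroup W] [Module F W] [FiniteDimensional F W]
      (q : QuadraticForm F W) (z : W ≃ₗ[F] W),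
      spinorNorm q z = 0 ↔ Even (Module.finrank F (imOneSub z)) := by
    intro W _ _ _ q z
    rw [spinorNorm, if_pos h2, ZMod.natCast_eq_zero_iff_even]
  have hres : ∀ f : GenDivisorsIn (RingHom.id F) x (Phi1 (RingHom.id F)),
      Even (Module.finrank F (imOneSub y)) ↔ Even (Module.finrank F (imOneSub (φ f))) := by
    rintro ⟨f, hf⟩
    obtain rfl := phi1_eq_X_sub_one h2 hf.1
    have hz : ∀ v, (φ ⟨X - C 1, hf⟩ v : V) = y v := fun v => hφ ⟨X - C 1, hf⟩ v
    exact even_finrank_imOneSub_iff h2 hQ hx hs hy.2 hyx hz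
  constructor
  · rintro ⟨h1, -, h3⟩ f
    let Qf : QuadraticForm F (kerEval x f.1) := Q.comp (kerEval x f.1).subtype
    have hl : ∀ u : kerEval x f.1, (∀ v : kerEval x f.1, QuadraticMap.polar Q u v = 0) →
        u = 0 := fun u hu => Subtype.ext (by
      refine polar_nondeg_kerEval hQ hx hs (one_mul 1) u.1 ?_ fun v hv => hu ⟨v, ?_⟩
      · rw [← phi1_eq_X_sub_one h2 f.2.1]
        exact u.2
      · rwa [phi1_eq_X_sub_one h2 f.2.1])
    have hnd' : Qf.polarBilin.Nondegenerate :=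
      ⟨fun u hu => hl u hu, fun u hu => hl u fun v => by
        rw [QuadraticMap.polar_comm]
        exact hu v⟩
    have hφQ : φ f ∈ quadIsometryGroup Qf := fun v => by
      change Q (φ f v) = Q v
      rw [hφ]
      exact h1 v
    exact ⟨hφQ, mem_specialGroup_of_two_eq_zero h2 hnd' hφQ,
      (hnorm _ _).2 ((hres f).1 ((hnorm _ _).1 h3))⟩
  · intro h
    refine ⟨hy.2, mem_specialGroup_of_two_eq_zero h2 hQ hy.2, (hnorm _ _).2 ?_⟩
    -- Without non-zero fixed vectors the condition on the Φ₁ components is vacuous, and the spinor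
    -- norm vanishes on the whole centralizer.
    by_cases hker : kerEval x (X - C 1) = ⊥
    · refine even_finrank_imOneSub h2 hQ hx hy.2 hyx fun v hv => ?_
      rw [← Submodule.mem_bot F, ← hker, mem_kerEval_X_sub_C, one_smul, hv]
    · have h1 : (X - C 1 : F[X]) ∈ Phi1 (RingHom.id F) := X_sub_C_mem_phi1 (one_mul 1)
      let f : GenDivisorsIn (RingHom.id F) x (Phi1 (RingHom.id F)) :=
        ⟨X - C 1, h1, genMult_pos hβ hx' hs (Or.inl h1) hker⟩
      exact (hres f).2 ((hnorm _ _).1 (h f).2.2)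

end OmegaCounts

end ClassicalGroups

open ClassicalGroups in
theorem mainTheorem3 {F V : Type*} [Field F] [Finite F] [AddCommGroup V] [Module F V]
    [FiniteDimensional F V] (p k : ℕ) [Fact p.Prime] (hk : 0 < k)
    (σ : F →+* F) (hσ : ∀ a, σ a = a ^ (p ^ k))
    (x : V ≃ₗ[F] V) (hx : (orderOf x).Coprime p) :
    -- symplectic, orthogonal and unitary groups of sesquilinear forms, `q = p ^ k`
    (∀ (T : FormType) (β : V →ₗ[F] V →ₛₗ[σ] F), IsClassicalForm (p ^ k) T β →
      x ∈ isometryGroup β →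
        Nonempty (centralizerIn (isometryGroup β) x ≃*
          (∀ f : GenDivisorsIn σ x (Phi1 σ),
            isometryGroup (β.domRestrict₁₂ (kerEval x f.1) (kerEval x f.1))) ×
          (∀ f : GenDivisorsIn σ x (Phi2 σ), GLq p (genMult σ x f.1 1) (k * T.d f.1)) ×
          (∀ f : GenDivisorsIn σ x (Phi3 σ), Uq p (genMult σ x f.1 1) (k * T.d f.1))) ∧
        (T = .unitary → 0 < Module.finrank F V →
          Nat.card (centralizerIn (isometryGroup β) x) =
            (p ^ k + 1) * Nat.card (centralizerIn (isometryGroup β ⊓ specialGroup F V) x)) ∧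
        (T = .orthogonal → ¬ IsUnit ((x : Module.End F V) ^ 2 - 1) →
          Nat.card (centralizerIn (isometryGroup β) x) =
            2 * Nat.card (centralizerIn (isometryGroup β ⊓ specialGroup F V) x)) ∧
        (T = .symplectic ∨ T = .orthogonal ∧ IsUnit ((x : Module.End F V) ^ 2 - 1) →
          Nat.card (centralizerIn (isometryGroup β ⊓ specialGroup F V) x) =
            Nat.card (centralizerIn (isometryGroup β) x))) ∧
    -- orthogonal groups of quadratic forms, `q = p ^ k`
    (∀ Q : QuadraticForm F V, Nat.card F = p ^ k → Q.polarBilin.Nondegenerate →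
      x ∈ quadIsometryGroup Q →
        (∃ φ : centralizerIn (quadIsometryGroup Q) x ≃*
            (∀ f : GenDivisorsIn σ x (Phi1 σ),
              quadIsometryGroup (Q.comp (kerEval x f.1).subtype)) ×
            (∀ f : GenDivisorsIn σ x (Phi2 σ),
              GLq p (genMult σ x f.1 1) (k * FormType.orthogonal.d f.1)) ×
            (∀ f : GenDivisorsIn σ x (Phi3 σ),
              Uq p (genMult σ x f.1 1) (k * FormType.orthogonal.d f.1)),
          Even (p ^ k) → ∀ y : centralizerIn (quadIsometryGroup Q) x,
            (y : V ≃ₗ[F] V) ∈ omegaGroup Q ↔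
              ∀ f : GenDivisorsIn σ x (Phi1 σ),
                ((φ y).1 f : kerEval x f.1 ≃ₗ[F] kerEval x f.1) ∈
                  omegaGroup (Q.comp (kerEval x f.1).subtype)) ∧
        (Odd (p ^ k) → ¬ IsUnit ((x : Module.End F V) ^ 2 - 1) →
          Nat.card (centralizerIn (quadIsometryGroup Q) x) =
            2 * Nat.card (centralizerIn (quadIsometryGroup Q ⊓ specialGroup F V) x)) ∧
        (Even (p ^ k) ∨ IsUnit ((x : Module.End F V) ^ 2 - 1) →
          Nat.card (centralizerIn (quadIsometryGroup Q ⊓ specialGroup F V) x) =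
            Nat.card (centralizerIn (quadIsometryGroup Q) x)) ∧
        (Even (p ^ k) → IsUnit ((x : Module.End F V) + 1) →
          Nat.card {y : V ≃ₗ[F] V // y ∈ omegaGroup Q ∧ y * x = x * y} =
            Nat.card (centralizerIn (quadIsometryGroup Q ⊓ specialGroup F V) x)) ∧
        (Odd (p ^ k) ∨ ¬ IsUnit ((x : Module.End F V) + 1) →
          3 ≤ Module.finrank F V ∨ Module.finrank F V = 2 ∧ x ∈ specialGroup F V →
          Nat.card (centralizerIn (quadIsometryGroup Q ⊓ specialGroup F V) x) =
            2 * Nat.card {y : V ≃ₗ[F] V // y ∈ omegaGroup Q ∧ y * x = x * y})) := by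
  have hσ2 : Nat.card F = p ^ k → σ = RingHom.id F := eq_id_of_card hσ
  refine ⟨fun T β h hxβ => ⟨h.structure_equiv hσ hx hxβ, h.special_counts hσ hx hxβ⟩,
    fun Q hF hQ hxQ => ?_⟩
  obtain rfl := hσ2 hF
  have hs := isSemisimple_of_orderOf_coprime hF hx
  have hodd : Odd (p ^ k) → (2 : F) ≠ 0 := fun h => two_ne_zero_of_odd_card (hF ▸ h)
  have heven : Even (p ^ k) → (2 : F) = 0 := fun h => two_eq_zero_of_even_card (hF ▸ h)
  -- One isomorphism has to serve both the structure statement and the Omega statement; `hφ` records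
  -- that its Φ₁ components are the restrictions of `y`.
  obtain ⟨φ, hφ⟩ := quad_structure_equiv hQ hxQ hs p (fun f => k * (f.natDegree / 2))
    (fun f g => pow_half_natDegree_phi2 hF) (fun f => pow_half_natDegree_phi3 hF)
  refine ⟨⟨φ, fun he y => ?_⟩, fun ho hu => ?_, fun h => ?_, fun he hu => ?_, fun h hn => ?_⟩
  · exact mem_omegaGroup_iff_of_even (heven he) hQ hxQ hs y.2
      (fun f => ((φ y).1 f : kerEval x f.1 ≃ₗ[F] kerEval x f.1)) (hφ y)
  · exact card_centralizerIn_quad_of_not_isUnit (hodd ho) hQ hxQ hs hu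
  · exact quad_special_count_of_isUnit hQ hxQ (h.imp_left heven)
  · exact card_omega_of_even_of_isUnit (heven he) hQ hxQ hu
  · rcases Nat.even_or_odd (p ^ k) with he | ho
    · exact card_omega_of_even_of_not_isUnit (heven he) hQ hxQ hs
        (h.resolve_left (Nat.not_odd_iff_even.2 he))
    · exact card_omega_of_odd (hodd ho) hQ hxQ hs hn
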